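/- Let $\Omega$ be the upper half-plane $\Pi$, the unit disk $\mathbb D$, or $\mathbb C$, with the measure $d\mu=dA$ (area) on $\Pi$ and $\mathbb D$, and $d\mu=\omega\,dA$, $\omega(z)=\pi^{-1}e^{-|z|^2}$, on $\mathbb C$. Write $\partial=\frac12(\partial_x-i\partial_y)$, $\bar\partial=\frac12(\partial_x+i\partial_y)$. For $j\ge 0$ let $\mathcal A_j$ be the space of smooth $f\in L^2(\Omega,\mu)$ with $\bar\partial^j f=0$, and let $\mathcal A_{(j+1)}=\mathcal A_{j+1}\ominus\mathcal A_j$ be the true poly-Bergman (for $\Pi$, $\mathbb D$) or true poly-Fock (for $\mathbb C$) space of order $j+1$. For $k\ge0$ define the functions $u_k\in\mathcal A_{(j+1)}$ by $$u_k=\tfrac1{j!}\,\partial^j\Big[(z-\bar z)^j\tfrac{(z-i)^k}{(z+i)^{k+2}}\Big]\ (\Pi),\qquad u_k=\partial^j\big[(1-|z|^2)^jz^k\big]\ (\mathbb D),\qquad u_k=(-\partial+\bar z)^jz^k\ (\mathbb C).$$ *Symbols.* On $\mathbb C$ a symbol is a tempered distribution $F\in\mathcal S'(\mathbb C)$, and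 one puts $\mathfrak f_F[u_k,u_l]=(F,\omega u_k\bar u_l)$. On $\Omega=\mathbb D$ or $\Pi$ put $s(z)=1-|z|^2$ or $s(z)=4\,\mathrm{Im}\,z/|z+i|^2$, respectively. For $F\in\mathcal D'(\Omega)$ and $\varphi\in C^\infty(\Omega)$ we say that $(F,\varphi)$ is defined and equals $L$ if $\lim_{t\to\infty}(F,h(ts)\varphi)=L$ for every $h\in C^\infty(\mathbb R)$ that vanishes on $(-\infty,a]$ for some $a>0$ and equals $1$ on $[b,\infty)$ for some $b$. A symbol is a distribution $F\in\mathcal D'(\Omega)$ for which $(F,\varphi)$ is defined for all $\varphi\in C^\infty(\overline{\mathbb D})$ (disk), or for all $\varphi\in C^\infty(\overline\Pi)$ with $(\mathrm{Im}\,z)^m\|D^m\varphi(z)\|\le C_m|z+i|^{-4}$ in $\Pi$ for all $m\ge0$ (half-plane); $\mathfrak f_F[u_k,u_l]=(F,u_k\bar u_l)$. A bounded operator $T$ on $\mathcal A_{(j+1)}$ is called the Toeplitz operator with symbol $F$ if $\langle Tu_k,u_l\rangle=\mathfrak f_F[u_k,u_l]$ for all $k,l\ge0$, all the right-hand sides being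 defined. *Transformed symbols.* Put $$\mathbf EF=\sum_{a,b=0}^{j}(-1)^{a+b}\,\partial^a\bar\partial^b\big(c_a\,\overline{c_b}\,F\big),$$ where $c_a=\binom ja\frac1{a!}(z-\bar z)^a$ for $\Pi$ ($\mathbf E=\mathbf K$) and $c_a=\binom ja\frac{j!}{a!}(-\bar z)^{j-a}(1-|z|^2)^a$ for $\mathbb D$ ($\mathbf E=\mathbf M$); and $\mathbf EF=\mathbf D_jF=\sum_{k=0}^j\binom jk\frac{j!}{k!}\big(\tfrac14\Delta\big)^kF$ for $\mathbb C$. **Theorem.** Let $j\ge0$. (1) Let $F$ be a symbol on $\Omega$ such that the distribution $\mathbf EF$ has compact support in $\Omega$. Then the Toeplitz operator with symbol $F$ in $\mathcal A_{(j+1)}$ exists, is unique, and is compact. (2) The same conclusion holds if $F$ itself is a distribution with compact support in $\Omega$. -/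

import Mathlib

open Complex MeasureTheory Filter Topology TopologicalSpace
open scoped ContDiff Distributions SchwartzMap Laplacian ComplexConjugate InnerProductSpace LineDeriv

namespace PolyToeplitz

noncomputable section

/-! ### Wirtinger derivatives -/

/-- `∂ = (∂_x - i ∂_y) / 2`. -/
def dz (f : ℂ → ℂ) (z : ℂ) : ℂ := (1 / 2) * (fderiv ℝ f z 1 - I * fderiv ℝ f z I)

/-- `∂̄ = (∂_x + i ∂_y) / 2`. -/
def dzbar (f : ℂ → ℂ) (z : ℂ) : ℂ := (1 / 2) * (fderiv ℝ f z 1 + I * fderiv ℝ f z I)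

/-! ### Polyanalytic and true polyanalytic `L²` spaces -/

lemma dzbar_congr_on {Ω : Opens ℂ} {f g : ℂ → ℂ} (h : ∀ z ∈ Ω, f z = g z) :
    ∀ z ∈ Ω, dzbar f z = dzbar g z := by
  intro z hz
  have : f =ᶠ[𝓝 z] g := by
    filter_upwards [Ω.isOpen.mem_nhds hz] with w hw using h w hw
  simp [dzbar, this.fderiv_eq]

lemma dzbar_contDiffOn {Ω : Opens ℂ} {f : ℂ → ℂ} (hf : ContDiffOn ℝ ∞ f Ω) :
    ContDiffOn ℝ ∞ (dzbar f) Ω := by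
  have h := hf.fderiv_of_isOpen (m := ∞) Ω.isOpen (by simp)
  exact contDiffOn_const.mul ((h.clm_apply contDiffOn_const).add
    (contDiffOn_const.mul (h.clm_apply contDiffOn_const)))

lemma dz_contDiffOn {Ω : Opens ℂ} {f : ℂ → ℂ} (hf : ContDiffOn ℝ ∞ f Ω) :
    ContDiffOn ℝ ∞ (dz f) Ω := by
  have h := hf.fderiv_of_isOpen (m := ∞) Ω.isOpen (by simp)
  exact contDiffOn_const.mul ((h.clm_apply contDiffOn_const).sub
    (contDiffOn_const.mul (h.clm_apply contDiffOn_const)))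

lemma dzbar_iter_add {Ω : Opens ℂ} (j : ℕ) : ∀ {f g : ℂ → ℂ}, ContDiffOn ℝ ∞ f Ω →
    ContDiffOn ℝ ∞ g Ω → ∀ z ∈ Ω, dzbar^[j] (f + g) z = dzbar^[j] f z + dzbar^[j] g z := by
  induction j with
  | zero => intro f g _ _ z _; simp
  | succ j ih =>
    intro f g hf hg z hz
    have key : ∀ w ∈ Ω, dzbar (f + g) w = (dzbar f + dzbar g) w := by
      intro w hw
      have h1 := (hf.contDiffAt (Ω.isOpen.mem_nhds hw)).differentiableAt (by simp)
      have h2 := (hg.contDiffAt (Ω.isOpen.mem_nhds hw)).differentiableAt (by simp)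
      simp only [dzbar, Pi.add_apply, fderiv_add h1 h2, add_apply]
      ring
    have cong : ∀ (k : ℕ) (a b : ℂ → ℂ), (∀ w ∈ Ω, a w = b w) →
        ∀ w ∈ Ω, dzbar^[k] a w = dzbar^[k] b w := by
      intro k
      induction k with
      | zero => intro a b h; simpa using h
      | succ k ihk =>
        intro a b h
        simp only [Function.iterate_succ, Function.comp]
        exact ihk _ _ (dzbar_congr_on h)
    simp only [Function.iterate_succ, Function.comp]
    rw [cong j _ _ key z hz]
    exact ih (dzbar_contDiffOn hf) (dzbar_contDiffOn hg) z hz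

lemma dzbar_const_mul (c : ℂ) (f : ℂ → ℂ) : dzbar (c • f) = c • dzbar f := by
  funext z
  simp only [dzbar, Pi.smul_apply, smul_eq_mul, fderiv_const_smul_field, FunLike.coe_smul]
  ring

lemma dzbar_iter_smul (j : ℕ) (c : ℂ) : ∀ f : ℂ → ℂ, dzbar^[j] (c • f) = c • dzbar^[j] f := by
  induction j with
  | zero => intro f; rfl
  | succ j ih =>
    intro f
    simp only [Function.iterate_succ, Function.comp, dzbar_const_mul, ih]

/-- The space of `j`-polyanalytic functions on `Ω` that are square integrable for `μ`: classes of
smooth functions `g` on `Ω` with `∂̄^j g = 0` in `Ω`. The measures `μ` used below are concentrated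
on `Ω` and have a positive density there. -/
def polySpace (Ω : Opens ℂ) (μ : Measure ℂ) (j : ℕ) : Submodule ℂ (Lp ℂ 2 μ) where
  carrier := {f | ∃ g : ℂ → ℂ, ContDiffOn ℝ ∞ g Ω ∧ (∀ z ∈ Ω, dzbar^[j] g z = 0) ∧ f =ᵐ[μ] g}
  add_mem' := by
    rintro a b ⟨f, hf, hf0, haf⟩ ⟨g, hg, hg0, hbg⟩
    refine ⟨f + g, hf.add hg, fun z hz => ?_, (Lp.coeFn_add a b).trans (haf.add hbg)⟩
    rw [dzbar_iter_add j hf hg z hz, hf0 z hz, hg0 z hz, add_zero]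
  zero_mem' := by
    refine ⟨0, contDiffOn_const, fun z _ => ?_, Lp.coeFn_zero ℂ 2 μ⟩
    have := dzbar_iter_smul j 0 0
    rw [zero_smul, zero_smul] at this
    rw [this]; rfl
  smul_mem' := by
    rintro c a ⟨f, hf, hf0, haf⟩
    refine ⟨c • f, hf.const_smul c, fun z hz => ?_, (Lp.coeFn_smul c a).trans (haf.const_smul c)⟩
    rw [dzbar_iter_smul, Pi.smul_apply, hf0 z hz, smul_zero]

/-- The true polyanalytic space of order `j + 1`: the orthogonal complement of the polyanalytic
space of order `j` in the polyanalytic space of order `j + 1`. -/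
def trueSpace (Ω : Opens ℂ) (μ : Measure ℂ) (j : ℕ) : Submodule ℂ (Lp ℂ 2 μ) :=
  polySpace Ω μ (j + 1) ⊓ (polySpace Ω μ j)ᗮ

/-- The open unit disk. -/
def disk : Opens ℂ := ⟨Metric.ball 0 1, Metric.isOpen_ball⟩

/-- The open upper half-plane. -/
def halfPlane : Opens ℂ := ⟨{z | 0 < z.im}, isOpen_lt continuous_const continuous_im⟩

/-- The plane Gaussian measure `π⁻¹ exp (-|z|²) dA(z)`. -/
def gaussian : Measure ℂ :=
  volume.withDensity fun z => ENNReal.ofReal (Real.pi⁻¹ * Real.exp (-‖z‖ ^ 2))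

/-- The true poly-Bergman space of order `j + 1` on `Ω`, with respect to Lebesgue area measure. -/
abbrev trueBergman (Ω : Opens ℂ) (j : ℕ) : Submodule ℂ (Lp ℂ 2 (volume.restrict (Ω : Set ℂ))) :=
  trueSpace Ω (volume.restrict (Ω : Set ℂ)) j

/-- The true poly-Fock space of order `q + 1`. -/
abbrev trueFock (q : ℕ) : Submodule ℂ (Lp ℂ 2 gaussian) := trueSpace ⊤ gaussian q

/-! ### Complex distributions on an open set and differential operators -/

/-- Complex distributions on `Ω`: continuous `ℂ`-linear functionals on `C_c^∞(Ω)`. -/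
abbrev CDistribution (Ω : Opens ℂ) := 𝓓(Ω, ℂ) →L[ℂ] ℂ

/-- Multiplication of test functions by a smooth function. -/
def mulTest (Ω : Opens ℂ) (g : ℂ → ℂ) (hg : ContDiff ℝ ∞ g) : 𝓓(Ω, ℂ) →L[ℂ] 𝓓(Ω, ℂ) :=
  TestFunction.limitCLM ℂ
    (fun φ => ⟨fun z => g z * φ z, hg.mul φ.contDiff, φ.hasCompactSupport.mul_left,
      (closure_mono (Function.support_mul_subset_right g φ)).trans φ.tsupport_subset⟩)
    (fun K hK => (TestFunction.ofSupportedInCLM ℂ hK).comp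
      (ContDiffMapSupportedIn.mkCLM ℂ (fun φ z => g z * φ z)
        (fun _ _ _ => mul_add _ _ _)
        (fun c φ z => by simp [mul_left_comm])
        (fun φ => hg.mul φ.contDiff)
        (fun φ z hz => by simp [φ.zero_on_compl hz])
        (by
          intro i _
          have hB : ∀ k : ℕ, ∃ B : ℝ, 0 ≤ B ∧ ∀ x ∈ K, ‖iteratedFDeriv ℝ k g x‖ ≤ B := by
            intro k
            obtain ⟨B, hB⟩ := K.isCompact.exists_bound_of_continuousOn
              (hg.continuous_iteratedFDeriv (m := k) (by exact_mod_cast le_top)).continuousOn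
            exact ⟨max B 0, le_max_right _ _, fun x hx => (hB x hx).trans (le_max_left _ _)⟩
          choose B hB0 hB using hB
          refine ⟨Finset.range (i + 1), ∑ k ∈ Finset.range (i + 1), (i.choose k : ℝ) * B k,
            Finset.sum_nonneg fun k _ => mul_nonneg (Nat.cast_nonneg _) (hB0 k), ?_⟩
          intro φ x hx
          refine (norm_iteratedFDeriv_mul_le (N := ∞) hg φ.contDiff x
            (by exact_mod_cast le_top)).trans ?_
          rw [Finset.sum_mul]
          refine Finset.sum_le_sum fun k hk => ?_
          refine mul_le_mul (mul_le_mul_of_nonneg_left (hB k x hx) (Nat.cast_nonneg _)) ?_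
            (norm_nonneg _) (mul_nonneg (Nat.cast_nonneg _) (hB0 k))
          refine (ContDiffMapSupportedIn.norm_iteratedFDeriv_apply_le_seminorm_top ℂ
            (i := i - k)).trans ?_
          exact Seminorm.le_def.1 (Finset.le_sup
            (f := fun j => ContDiffMapSupportedIn.seminorm ℂ ℂ ℂ ⊤ K j)
            (Finset.mem_range.2 (by omega : i - k < i + 1))) φ)))
    (fun _ _ _ => rfl)

/-- The distributional derivative `∂F = (∂_x F - i ∂_y F) / 2`, where `(∂_x F, φ) = -(F, ∂_x φ)` and
`(∂_y F, φ) = -(F, ∂_y φ)`. -/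
def dzDist {Ω : Opens ℂ} (F : CDistribution Ω) : CDistribution Ω :=
  (1 / 2 : ℂ) • (-F.comp (TestFunction.lineDerivCLM ℂ 1) -
    I • -F.comp (TestFunction.lineDerivCLM ℂ I))

/-- The distributional derivative `∂̄F = (∂_x F + i ∂_y F) / 2`. -/
def dzbarDist {Ω : Opens ℂ} (F : CDistribution Ω) : CDistribution Ω :=
  (1 / 2 : ℂ) • (-F.comp (TestFunction.lineDerivCLM ℂ 1) +
    I • -F.comp (TestFunction.lineDerivCLM ℂ I))

/-- The product `gF` of a distribution and a smooth function, `(gF, φ) = (F, gφ)`. -/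
def mulDist {Ω : Opens ℂ} (g : ℂ → ℂ) (hg : ContDiff ℝ ∞ g) (F : CDistribution Ω) :
    CDistribution Ω := F.comp (mulTest Ω g hg)

/-- Given smooth coefficients `c 0, …, c j`, the differential operator
`F ↦ ∑_{a,b ≤ j} (-1)^{a+b} ∂^a ∂̄^b (c_a c̄_b F)` on distributions. If `S = ∑_{a ≤ j} c_a ∂^a`, it is
the only differential operator `E` with `(F, S f · conj (S g)) = (E F, f · conj g)` for all
holomorphic `f`, `g` (in the sense of a formal integration by parts). -/
def transOp {Ω : Opens ℂ} (j : ℕ) (c : ℕ → ℂ → ℂ) (hc : ∀ a, ContDiff ℝ ∞ (c a))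
    (F : CDistribution Ω) : CDistribution Ω :=
  ∑ a ∈ Finset.range (j + 1), ∑ b ∈ Finset.range (j + 1),
    ((-1 : ℂ) ^ (a + b)) • dzDist^[a] (dzbarDist^[b]
      (mulDist (fun z => c a z * conj (c b z)) ((hc a).mul (conjCLE.contDiff.comp (hc b))) F))

/-- Coefficients of `f ↦ ∂^j((z - z̄)^j f) / j! = ∑_a (j choose a) (a!)⁻¹ (z - z̄)^a ∂^a f` on
holomorphic `f`. -/
def halfPlaneCoeff (j a : ℕ) (z : ℂ) : ℂ :=
  (j.choose a : ℂ) / (a.factorial : ℂ) * (z - conj z) ^ a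

/-- Coefficients of
`f ↦ ∂^j((1 - |z|²)^j f) = ∑_a (j choose a) (j!/a!) (-z̄)^{j-a} (1 - |z|²)^a ∂^a f` on
holomorphic `f`. -/
def diskCoeff (j a : ℕ) (z : ℂ) : ℂ :=
  (j.choose a : ℂ) * ((j.factorial : ℂ) / (a.factorial : ℂ)) * (-conj z) ^ (j - a) *
    (1 - z * conj z) ^ a

lemma halfPlaneCoeff_contDiff (j a : ℕ) : ContDiff ℝ ∞ (halfPlaneCoeff j a) := by
  have h : ContDiff ℝ ∞ (fun z : ℂ => conj z) := conjCLE.contDiff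
  exact contDiff_const.mul ((contDiff_id.sub h).pow a)

lemma diskCoeff_contDiff (j a : ℕ) : ContDiff ℝ ∞ (diskCoeff j a) := by
  have h : ContDiff ℝ ∞ (fun z : ℂ => conj z) := conjCLE.contDiff
  exact (contDiff_const.mul (h.neg.pow _)).mul ((contDiff_const.sub (contDiff_id.mul h)).pow a)

/-- The operator `K = K_j` of the half-plane. -/
def opK (j : ℕ) (F : CDistribution halfPlane) : CDistribution halfPlane :=
  transOp j (halfPlaneCoeff j) (halfPlaneCoeff_contDiff j) F

/-- The operator `M = M_j` of the disk. -/
def opM (j : ℕ) (F : CDistribution disk) : CDistribution disk :=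
  transOp j (diskCoeff j) (diskCoeff_contDiff j) F

/-- The operator `D_q(Δ) = ∑_{k ≤ q} (q choose k) (q!/k!) (Δ/4)^k` on tempered distributions. -/
def opD (q : ℕ) (F : 𝓢'(ℂ, ℂ)) : 𝓢'(ℂ, ℂ) :=
  ∑ k ∈ Finset.range (q + 1),
    ((q.choose k : ℂ) * ((q.factorial : ℂ) / (k.factorial : ℂ)) * (1 / 4) ^ k) •
      (Δ : 𝓢'(ℂ, ℂ) → 𝓢'(ℂ, ℂ))^[k] F

/-- A distribution (classical or tempered) has compact support in `Ω`: it vanishes on the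
complement of a compact subset of `Ω`. -/
def HasCompactSupportIn {A : Type*} [FunLike A ℂ ℂ] (F : A → ℂ) (Ω : Opens ℂ) : Prop :=
  ∃ K : Set ℂ, IsCompact K ∧ K ⊆ Ω ∧ Distribution.IsVanishingOn F Kᶜ

/-! ### Action of a distribution on functions smooth up to the boundary -/

/-- A positive smooth function on `Ω` that tends to zero at the boundary (and at infinity). -/
structure BoundaryFunction (Ω : Opens ℂ) where
  toFun : ℂ → ℝ
  smooth : ContDiffOn ℝ ∞ toFun Ω
  pos : ∀ z ∈ Ω, 0 < toFun z
  compact : ∀ c : ℝ, 0 < c → IsCompact {z | z ∈ Ω ∧ c ≤ toFun z}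

/-- Smooth cutoff functions on the line: zero on a half-line `(-∞, a]` with `a > 0`, and one on some
half-line `[b, ∞)`. -/
structure Cutoff where
  toFun : ℝ → ℝ
  smooth : ContDiff ℝ ∞ toFun
  eq_zero : ∃ a : ℝ, 0 < a ∧ ∀ x ≤ a, toFun x = 0
  eq_one : ∃ b : ℝ, ∀ x, b ≤ x → toFun x = 1

/-- The test function `z ↦ h(t s(z)) φ(z)` on `Ω`, for `φ` smooth on `Ω`. As `t → ∞` the factors
`h(t s(z))` exhaust `Ω`. -/
def truncate {Ω : Opens ℂ} (s : BoundaryFunction Ω) (h : Cutoff) (t : ℝ) (φ : ℂ → ℂ)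
    (hφ : ContDiffOn ℝ ∞ φ Ω) : 𝓓(Ω, ℂ) :=
  have key : ∃ K : Set ℂ, IsCompact K ∧ K ⊆ Ω ∧
      ∀ z ∉ K, (Ω : Set ℂ).indicator (fun z => (h.toFun (t * s.toFun z) : ℂ) * φ z) z = 0 := by
    obtain ⟨a, ha, hz⟩ := h.eq_zero
    rcases le_or_gt t 0 with ht | ht
    · refine ⟨∅, isCompact_empty, Set.empty_subset _, fun z _ => ?_⟩
      by_cases hzΩ : z ∈ (Ω : Set ℂ)
      · rw [Set.indicator_of_mem hzΩ, hz _ (by nlinarith [s.pos z hzΩ])]; simp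
      · exact Set.indicator_of_notMem hzΩ _
    · refine ⟨_, s.compact (a / t) (div_pos ha ht), fun z hz => hz.1, fun z hzK => ?_⟩
      by_cases hzΩ : z ∈ (Ω : Set ℂ)
      · have h1 : s.toFun z < a / t := by
          by_contra hcon
          exact hzK ⟨hzΩ, not_lt.1 hcon⟩
        rw [Set.indicator_of_mem hzΩ, hz _ (by rw [lt_div_iff₀ ht] at h1; linarith)]; simp
      · exact Set.indicator_of_notMem hzΩ _
  { toFun := (Ω : Set ℂ).indicator fun z => (h.toFun (t * s.toFun z) : ℂ) * φ z
    contDiff' := by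
      obtain ⟨K, hK, hKΩ, h0⟩ := key
      rw [contDiff_iff_contDiffAt]
      intro z
      by_cases hz : z ∈ (Ω : Set ℂ)
      · have h1 : ContDiffOn ℝ ∞ (fun z => (h.toFun (t * s.toFun z) : ℂ) * φ z) Ω :=
          (ofRealCLM.contDiff.comp_contDiffOn
            (h.smooth.comp_contDiffOn (contDiffOn_const.mul s.smooth))).mul hφ
        refine (h1.contDiffAt (Ω.isOpen.mem_nhds hz)).congr_of_eventuallyEq ?_
        filter_upwards [Ω.isOpen.mem_nhds hz] with w hw
        exact Set.indicator_of_mem hw _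
      · refine (contDiffAt_const (c := (0 : ℂ))).congr_of_eventuallyEq ?_
        filter_upwards [hK.isClosed.isOpen_compl.mem_nhds fun hc => hz (hKΩ hc)] with w hw
        exact h0 w hw
    hasCompactSupport' := by
      obtain ⟨K, hK, hKΩ, h0⟩ := key
      exact HasCompactSupport.intro hK h0
    tsupport_subset' := by
      obtain ⟨K, hK, hKΩ, h0⟩ := key
      refine (closure_minimal ?_ hK.isClosed).trans hKΩ
      intro z hz
      by_contra hc
      exact hz (h0 z hc) }

/-- The natural extension of `F` to functions `φ` that are smooth on `Ω` without compact support: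
`(F, φ) = L` if `(F, h(t s) φ) → L` as `t → ∞`, whatever the cutoff `h`. -/
def HasValue {Ω : Opens ℂ} (s : BoundaryFunction Ω) (F : CDistribution Ω) (φ : ℂ → ℂ) (L : ℂ) :
    Prop :=
  ∃ hφ : ContDiffOn ℝ ∞ φ Ω, ∀ h : Cutoff,
    Tendsto (fun t : ℝ => F (truncate s h t φ hφ)) atTop (𝓝 L)

/-- The function `1 - |z|²` on the disk. -/
def diskBoundary : BoundaryFunction disk where
  toFun z := 1 - ‖z‖ ^ 2
  smooth := (contDiff_const.sub (contDiff_norm_sq ℝ)).contDiffOn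
  pos z hz := by
    have : ‖z‖ < 1 := by simpa [disk] using hz
    nlinarith [norm_nonneg z]
  compact c hc := by
    have : {z : ℂ | z ∈ disk ∧ c ≤ 1 - ‖z‖ ^ 2} =
        Metric.closedBall 0 1 ∩ {z | c ≤ 1 - ‖z‖ ^ 2} := by
      ext z
      constructor
      · rintro ⟨h1, h2⟩
        have : ‖z‖ < 1 := by simpa [disk] using h1
        exact ⟨by simpa using this.le, h2⟩
      · rintro ⟨h1, h2⟩
        have h2' : c ≤ 1 - ‖z‖ ^ 2 := h2
        have : ‖z‖ < 1 := by nlinarith [norm_nonneg z]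
        exact ⟨by simpa [disk] using this, h2⟩
    rw [this]
    exact (isCompact_closedBall _ _).inter_right
      (isClosed_le continuous_const (by fun_prop))

/-- The function `4 Im z / |z + i|²` on the half-plane, that is, `1 - |ζ|²` for the Cayley transform
`ζ = (z - i) / (z + i)`. -/
def halfPlaneBoundary : BoundaryFunction halfPlane where
  toFun z := 4 * z.im / ‖z + I‖ ^ 2
  smooth := by
    refine ContDiffOn.div (contDiff_const.mul imCLM.contDiff).contDiffOn
      (((contDiff_id.add contDiff_const).norm_sq ℝ).contDiffOn) fun z hz => ?_
    have hz' : 0 < z.im := hz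
    have : z + I ≠ 0 := fun h => by
      have := congrArg im h
      simp at this
      linarith
    simpa using this
  pos z hz := by
    have hz' : 0 < z.im := hz
    have : z + I ≠ 0 := fun h => by
      have := congrArg im h
      simp at this
      linarith
    have := norm_pos_iff.2 this
    positivity
  compact c hc := by
    have : {z : ℂ | z ∈ halfPlane ∧ c ≤ 4 * z.im / ‖z + I‖ ^ 2} =
        Metric.closedBall (-I) (4 / c) ∩ {z | c * ‖z + I‖ ^ 2 ≤ 4 * z.im} := by
      ext z
      have hle : z.im ≤ ‖z + I‖ - 1 := by
        have := (le_abs_self _).trans (abs_im_le_norm (z + I))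
        simp at this
        linarith
      constructor
      · rintro ⟨h1, h2⟩
        have h1' : 0 < z.im := h1
        have hn : 0 < ‖z + I‖ := by linarith
        rw [le_div_iff₀ (by positivity)] at h2
        refine ⟨?_, h2⟩
        rw [mem_closedBall_iff_norm, sub_neg_eq_add, le_div_iff₀ hc]
        nlinarith
      · rintro ⟨-, h2⟩
        have h2' : c * ‖z + I‖ ^ 2 ≤ 4 * z.im := h2
        have him : 0 < z.im := by
          by_contra hcon
          have h0 : ‖z + I‖ ^ 2 = 0 := by nlinarith [sq_nonneg ‖z + I‖]
          have h3 : z + I = 0 := by simpa using h0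
          have h4 := congrArg im h3
          simp at h4
          rw [h0] at h2'
          linarith
        have hn : 0 < ‖z + I‖ := by linarith
        exact ⟨him, by rw [le_div_iff₀ (by positivity)]; exact h2'⟩
    rw [this]
    exact (isCompact_closedBall _ _).inter_right
      (isClosed_le (by fun_prop) (continuous_const.mul continuous_im))

/-- `φ ∈ C^∞(closure Ω)`. -/
def SmoothUpToBoundary (Ω : Opens ℂ) (φ : ℂ → ℂ) : Prop :=
  ∃ U : Set ℂ, IsOpen U ∧ closure (Ω : Set ℂ) ⊆ U ∧ ContDiffOn ℝ ∞ φ U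

/-- Symbols on the disk: distributions defined (naturally extended) on `C^∞` of the closed disk. -/
def IsDiskSymbol (F : CDistribution disk) : Prop :=
  ∀ φ : ℂ → ℂ, SmoothUpToBoundary disk φ → ∃ L, HasValue diskBoundary F φ L

/-- Symbols on the half-plane: distributions defined (naturally extended) on the functions that are
smooth up to the boundary and `O(|z + i|⁻⁴)` together with all `(Im z)^m D^m φ`; all of these
functions are integrable. -/
def IsHalfPlaneSymbol (F : CDistribution halfPlane) : Prop :=
  ∀ φ : ℂ → ℂ, SmoothUpToBoundary halfPlane φ →
    (∀ m : ℕ, ∃ C : ℝ, ∀ z ∈ halfPlane,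
      z.im ^ m * ‖iteratedFDeriv ℝ m φ z‖ ≤ C / ‖z + I‖ ^ 4) →
    ∃ L, HasValue halfPlaneBoundary F φ L

/-! ### Toeplitz operators -/

/-- `∂^j((1 - |z|²)^j z^k)`: the image in the true poly-Bergman space of order `j + 1` of the
(non-normalized) standard basis `z^k` of the Bergman space of the disk. -/
def diskBasis (j k : ℕ) : ℂ → ℂ := dz^[j] fun z => (1 - z * conj z) ^ j * z ^ k

/-- `∂^j((z - z̄)^j e_k) / j!`: the image in the true poly-Bergman space of order `j + 1` of the
(non-normalized) standard basis `e_k = (z - i)^k / (z + i)^{k+2}` of the Bergman space of the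
half-plane. -/
def halfPlaneBasis (j k : ℕ) : ℂ → ℂ := fun z =>
  dz^[j] (fun z => (z - conj z) ^ j * ((z - I) ^ k / (z + I) ^ (k + 2))) z / (j.factorial : ℂ)

/-- `(-∂ + z̄)^q z^k`: the image in the true poly-Fock space of order `q + 1` of the
(non-normalized) standard basis `z^k` of the Fock space. -/
def fockBasis (q k : ℕ) : ℂ → ℂ :=
  (fun (f : ℂ → ℂ) z => -dz f z + conj z * f z)^[q] fun z => z ^ k

/-- `T` is the Toeplitz operator with symbol `F` in the true poly-Bergman space of order `j + 1` on
the disk: `⟨T u, v⟩ = (F, u v̄)` for the basis functions `u`, `v`. -/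
def IsToeplitzDisk (j : ℕ) (F : CDistribution disk)
    (T : trueBergman disk j →L[ℂ] trueBergman disk j) : Prop :=
  ∀ k l : ℕ, ∃ u v : trueBergman disk j,
    (u : Lp ℂ 2 (volume.restrict (disk : Set ℂ))) =ᵐ[volume.restrict (disk : Set ℂ)]
      diskBasis j k ∧
    (v : Lp ℂ 2 (volume.restrict (disk : Set ℂ))) =ᵐ[volume.restrict (disk : Set ℂ)]
      diskBasis j l ∧
    HasValue diskBoundary F (fun z => diskBasis j k z * conj (diskBasis j l z)) ⟪v, T u⟫_ℂ

/-- `T` is the Toeplitz operator with symbol `F` in the true poly-Bergman space of order `j + 1` on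
the half-plane: `⟨T u, v⟩ = (F, u v̄)` for the basis functions `u`, `v`. -/
def IsToeplitzHalfPlane (j : ℕ) (F : CDistribution halfPlane)
    (T : trueBergman halfPlane j →L[ℂ] trueBergman halfPlane j) : Prop :=
  ∀ k l : ℕ, ∃ u v : trueBergman halfPlane j,
    (u : Lp ℂ 2 (volume.restrict (halfPlane : Set ℂ)))
      =ᵐ[volume.restrict (halfPlane : Set ℂ)] halfPlaneBasis j k ∧
    (v : Lp ℂ 2 (volume.restrict (halfPlane : Set ℂ)))
      =ᵐ[volume.restrict (halfPlane : Set ℂ)] halfPlaneBasis j l ∧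
    HasValue halfPlaneBoundary F
      (fun z => halfPlaneBasis j k z * conj (halfPlaneBasis j l z)) ⟪v, T u⟫_ℂ

/-- `T` is the Toeplitz operator with symbol `F` in the true poly-Fock space of order `q + 1`:
`⟨T u, v⟩ = (F, ω u v̄)`, `ω(z) = π⁻¹ exp(-|z|²)`, for the basis functions `u`, `v`; here `ω u v̄` is
a Schwartz function. -/
def IsToeplitzFock (q : ℕ) (F : 𝓢'(ℂ, ℂ)) (T : trueFock q →L[ℂ] trueFock q) : Prop :=
  ∀ k l : ℕ, ∃ u v : trueFock q,
    (u : Lp ℂ 2 gaussian) =ᵐ[gaussian] fockBasis q k ∧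
    (v : Lp ℂ 2 gaussian) =ᵐ[gaussian] fockBasis q l ∧
    ∃ φ : 𝓢(ℂ, ℂ),
      (∀ z, φ z = ((Real.pi⁻¹ * Real.exp (-‖z‖ ^ 2) : ℝ) : ℂ) *
        (fockBasis q k z * conj (fockBasis q l z))) ∧
      F φ = ⟪v, T u⟫_ℂ

end

end PolyToeplitz

/-! In all three models `u_k = S e_k` with `S = ∑ c_a ∂^a` and `e_k = w ψ^k` holomorphic: `ψ` is the
coordinate on the disk and the plane and the Cayley transform on the half-plane, with `w = 1` or `w
= (z + i)⁻²` respectively. For holomorphic `f`, `g` one has `∂^a ∂̄^b (f ḡ) = ∂^a f · conj (∂^b g)`,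
so `S f · conj (S g)` is the formal transpose of `E` applied to `f ḡ` (`adjOp_holo`). Formally,
therefore, `(F, u_k ū_l) = (EF, e_k ē_l)`. On the plane the weight `ω` has to be carried along, and
the identity becomes `fockProd_self`, which comes from the commutation relation `[∂̄, -∂ + z̄] = 1`.

If `EF` has compact support, the right-hand side is a matrix `a k l` with geometric bounds. A
distribution has finite order near a compact set, and derivatives of `ψ^k ψ̄^l` of bounded order
grow at most like `ρ^{k+l}` for any `ρ` above the supremum of `|ψ|` there
(`exists_bound_iteratedFDeriv_pow`). On the other hand `‖u_k‖ ≥ c ρ'^k` for some admissible `ρ' >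
ρ`. Hence `∑ |a k l| / (‖u_k‖ ‖u_l‖)` converges, and the operator is a norm convergent sum of rank
one operators (`exists_compact_of_matrix`). Uniqueness is the density of the span of the `u_k`.

On the disk and the half-plane the formal integration by parts is justified with the cutoffs `h(t
s)`. Derivatives falling on the cutoff produce terms `η(t s) m` with `η` a bump, that is, smooth
with compact support in `(0, ∞)`. Since `h + η` is again a cutoff, such a term is a difference of
two truncations with the same limit, and its pairing with `F` tends to zero
(`BdryAlg.Fam.exists_test`). The structure `BdryAlg` records what keeps the functions `m` in the
class on which `F` is defined.

The `u_k` form an orthogonal basis by a second integration by parts (`BdryAlg.tendsto_ibp`). There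
is `θ_k` with `∂̄^j θ_k` equal to the conjugate of `u_k` up to weight and sign, so `⟨g, u_k⟩` is up
to sign the limit of `∫ ∂̄^j g · h(t s) θ_k`. It vanishes if `∂̄^j g = 0`. If `∂̄^{j+1} g = 0`, then
`∂̄^j g` is holomorphic and these integrals for all `k` determine its Taylor coefficients, through
radial weights (`eq_zero_of_tendsto_moments`). For the half-plane the last step is transported to
the disk.

If `F` itself has compact support, then so does `EF`, and `F` has a value on every smooth function,
so (2) follows by the same argument. -/

namespace PolyToeplitz

noncomputable section

/-! ### First order operators -/

/-- The first order operator `(∂_x + c ∂_y) / 2`. -/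
def wd (c : ℂ) (f : ℂ → ℂ) (z : ℂ) : ℂ := (1 / 2) * (fderiv ℝ f z 1 + c * fderiv ℝ f z I)

lemma dz_eq_wd : dz = wd (-I) := by
  funext f z; simp only [dz, wd]; ring

lemma dzbar_eq_wd : dzbar = wd I := rfl

variable {Ω : Opens ℂ} {f g : ℂ → ℂ} {c : ℂ}

lemma wd_congr_at {z : ℂ} (h : f =ᶠ[𝓝 z] g) : wd c f z = wd c g z := by
  simp [wd, h.fderiv_eq]

lemma wd_congr (h : Set.EqOn f g Ω) : Set.EqOn (wd c f) (wd c g) Ω := fun _ hz =>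
  wd_congr_at (h.eventuallyEq_of_mem (Ω.isOpen.mem_nhds hz))

lemma wd_iter_congr (n : ℕ) (h : Set.EqOn f g Ω) : Set.EqOn ((wd c)^[n] f) ((wd c)^[n] g) Ω := by
  induction n with
  | zero => exact h
  | succ n ih => simp only [Function.iterate_succ', Function.comp]; exact wd_congr ih

lemma diffAt_of_contDiffOn (hf : ContDiffOn ℝ ∞ f Ω) {z : ℂ} (hz : z ∈ Ω) :
    DifferentiableAt ℝ f z :=
  (hf.contDiffAt (Ω.isOpen.mem_nhds hz)).differentiableAt (by simp)

lemma wd_contDiffOn (hf : ContDiffOn ℝ ∞ f Ω) : ContDiffOn ℝ ∞ (wd c f) Ω := by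
  have h := hf.fderiv_of_isOpen (m := ∞) Ω.isOpen (by simp)
  exact contDiffOn_const.mul ((h.clm_apply contDiffOn_const).add
    (contDiffOn_const.mul (h.clm_apply contDiffOn_const)))

lemma wd_contDiff (hf : ContDiff ℝ ∞ f) : ContDiff ℝ ∞ (wd c f) := by
  have h := wd_contDiffOn (Ω := ⊤) (c := c) hf.contDiffOn
  rwa [Opens.coe_top, contDiffOn_univ] at h

lemma wd_iter_contDiffOn (n : ℕ) (hf : ContDiffOn ℝ ∞ f Ω) :
    ContDiffOn ℝ ∞ ((wd c)^[n] f) Ω := by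
  induction n with
  | zero => exact hf
  | succ n ih => simp only [Function.iterate_succ', Function.comp]; exact wd_contDiffOn ih

lemma wd_add_at {z : ℂ} (hf : DifferentiableAt ℝ f z) (hg : DifferentiableAt ℝ g z) :
    wd c (fun w => f w + g w) z = wd c f z + wd c g z := by
  simp only [wd, fderiv_fun_add hf hg, add_apply]; ring

lemma wd_sub_at {z : ℂ} (hf : DifferentiableAt ℝ f z) (hg : DifferentiableAt ℝ g z) :
    wd c (fun w => f w - g w) z = wd c f z - wd c g z := by
  simp only [wd, fderiv_fun_sub hf hg, sub_apply]; ring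

lemma wd_mul_at {z : ℂ} (hf : DifferentiableAt ℝ f z) (hg : DifferentiableAt ℝ g z) :
    wd c (fun w => f w * g w) z = wd c f z * g z + f z * wd c g z := by
  simp only [wd, fderiv_fun_mul hf hg, add_apply, smul_apply, smul_eq_mul]
  ring

lemma wd_const_mul (a : ℂ) (f : ℂ → ℂ) (z : ℂ) : wd c (fun w => a * f w) z = a * wd c f z := by
  have : (fun w => a * f w) = a • f := rfl
  simp only [wd, this, fderiv_const_smul_field, smul_apply, smul_eq_mul,
    Pi.smul_apply]
  ring

@[simp] lemma wd_const (a : ℂ) (z : ℂ) : wd c (fun _ => a) z = 0 := by simp [wd]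

lemma wd_iter_const_mul (n : ℕ) (a : ℂ) (f : ℂ → ℂ) (z : ℂ) :
    (wd c)^[n] (fun w => a * f w) z = a * (wd c)^[n] f z := by
  induction n generalizing z with
  | zero => rfl
  | succ n ih =>
    simp only [Function.iterate_succ', Function.comp]
    rw [← wd_const_mul, funext ih]

lemma wd_iter_add (n : ℕ) (hf : ContDiffOn ℝ ∞ f Ω) (hg : ContDiffOn ℝ ∞ g Ω) {z : ℂ}
    (hz : z ∈ Ω) : (wd c)^[n] (fun w => f w + g w) z = (wd c)^[n] f z + (wd c)^[n] g z := by
  induction n generalizing z with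
  | zero => rfl
  | succ n ih =>
    simp only [Function.iterate_succ', Function.comp]
    rw [wd_congr (fun w hw => ih hw) hz,
      wd_add_at (diffAt_of_contDiffOn (wd_iter_contDiffOn n hf) hz)
        (diffAt_of_contDiffOn (wd_iter_contDiffOn n hg) hz)]

lemma wd_iter_sum (n : ℕ) {ι : Type*} (s : Finset ι) (F : ι → ℂ → ℂ)
    (hF : ∀ i ∈ s, ContDiffOn ℝ ∞ (F i) Ω) {z : ℂ}
    (hz : z ∈ Ω) : (wd c)^[n] (fun w => ∑ i ∈ s, F i w) z = ∑ i ∈ s, (wd c)^[n] (F i) z := by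
  classical
  induction s using Finset.induction_on with
  | empty =>
    simp only [Finset.sum_empty]
    have := wd_iter_const_mul (c := c) n 0 (fun _ => 0) z
    simpa using this
  | insert a s ha ih =>
    simp only [Finset.sum_insert ha]
    rw [wd_iter_add n (hF a (Finset.mem_insert_self _ _)) (ContDiffOn.sum fun i hi =>
      hF i (Finset.mem_insert_of_mem hi)) hz, ih fun i hi => hF i (Finset.mem_insert_of_mem hi)]

lemma wd_conj_at (f : ℂ → ℂ) (z : ℂ) :
    wd c (fun w => conj (f w)) z = conj (wd (conj c) f z) := by
  have h : fderiv ℝ (fun w => conj (f w)) z = (conjCLE : ℂ →L[ℝ] ℂ).comp (fderiv ℝ f z) :=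
    conjCLE.comp_fderiv (f := f)
  simp only [wd, h, ContinuousLinearMap.comp_apply, ContinuousLinearEquiv.coe_coe, conjCLE_apply,
    map_mul, map_add, conj_conj, map_div₀, map_one, map_ofNat]

lemma wd_iter_conj (n : ℕ) (f : ℂ → ℂ) (z : ℂ) :
    (wd c)^[n] (fun w => conj (f w)) z = conj ((wd (conj c))^[n] f z) := by
  induction n generalizing z with
  | zero => rfl
  | succ n ih =>
    simp only [Function.iterate_succ', Function.comp]
    rw [← wd_conj_at, funext ih]

lemma conj_contDiffOn (hf : ContDiffOn ℝ ∞ f Ω) : ContDiffOn ℝ ∞ (fun w => conj (f w)) Ω :=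
  conjCLE.contDiff.comp_contDiffOn hf

/-- Real functions composed with smooth real functions. -/
lemma wd_comp_real_at {η : ℝ → ℝ} {s : ℂ → ℝ} {z : ℂ} (hη : Differentiable ℝ η)
    (hs : DifferentiableAt ℝ s z) (t : ℝ) :
    wd c (fun w => ((η (t * s w) : ℝ) : ℂ)) z =
      ((t * deriv η (t * s z) : ℝ) : ℂ) * wd c (fun w => (s w : ℂ)) z := by
  have h1 : HasFDerivAt (fun w => ((s w : ℝ) : ℂ)) (ofRealCLM.comp (fderiv ℝ s z)) z :=
    ofRealCLM.hasFDerivAt.comp z hs.hasFDerivAt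
  have h2 : HasFDerivAt (fun w => η (t * s w)) (deriv η (t * s z) • (t • fderiv ℝ s z)) z :=
    (hη (t * s z)).hasDerivAt.comp_hasFDerivAt z (hs.hasFDerivAt.const_mul t)
  have h3 : HasFDerivAt (fun w => ((η (t * s w) : ℝ) : ℂ))
      (ofRealCLM.comp (deriv η (t * s z) • (t • fderiv ℝ s z))) z :=
    ofRealCLM.hasFDerivAt.comp z h2
  simp only [wd, h1.fderiv, h3.fderiv, ContinuousLinearMap.comp_apply, smul_apply,
    ofRealCLM_apply, smul_eq_mul]
  push_cast; ring

/-! ### Commutation -/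

lemma wd_comm_at {d : ℂ} {z : ℂ} (hf : ContDiffAt ℝ ∞ f z) :
    wd c (wd d f) z = wd d (wd c f) z := by
  have hs : IsSymmSndFDerivAt ℝ f z := hf.isSymmSndFDerivAt (by simpa using WithTop.coe_le_coe.2 (le_top : (2 : ℕ∞) ≤ ⊤))
  have hd : DifferentiableAt ℝ (fderiv ℝ f) z :=
    (hf.fderiv_right (m := 1) (by norm_cast)).differentiableAt (by simp)
  have key : ∀ (e u : ℂ), fderiv ℝ (wd e f) z u =
      (1 / 2) * (fderiv ℝ (fderiv ℝ f) z u 1 + e * fderiv ℝ (fderiv ℝ f) z u I) := by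
    intro e u
    have h := ((hd.hasFDerivAt.clm_apply (hasFDerivAt_const (1 : ℂ) z)).add
      ((hd.hasFDerivAt.clm_apply (hasFDerivAt_const (I : ℂ) z)).const_mul e)).const_mul (1 / 2 : ℂ)
    have h' : HasFDerivAt (wd e f) _ z := h
    rw [h'.fderiv]
    simp; ring
  simp only [wd] at key ⊢
  simp only [key]
  rw [hs.eq 1 I]; ring

lemma wd_iter_comm {d : ℂ} (n : ℕ) (hf : ContDiffOn ℝ ∞ f Ω) {z : ℂ} (hz : z ∈ Ω) :
    wd c ((wd d)^[n] f) z = (wd d)^[n] (wd c f) z := by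
  induction n generalizing z with
  | zero => rfl
  | succ n ih =>
    simp only [Function.iterate_succ', Function.comp]
    rw [wd_comm_at ((wd_iter_contDiffOn n hf).contDiffAt (Ω.isOpen.mem_nhds hz))]
    exact wd_congr (fun w hw => ih hw) hz

lemma wd_iter_iter_comm {d : ℂ} (m n : ℕ) (hf : ContDiffOn ℝ ∞ f Ω) {z : ℂ} (hz : z ∈ Ω) :
    (wd c)^[m] ((wd d)^[n] f) z = (wd d)^[n] ((wd c)^[m] f) z := by
  induction m generalizing z with
  | zero => rfl
  | succ m ih =>
    simp only [Function.iterate_succ', Function.comp]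
    rw [wd_congr (fun w hw => ih hw) hz, wd_iter_comm n (wd_iter_contDiffOn m hf) hz]

/-! ### Holomorphic functions -/

lemma wd_of_differentiableAt {z : ℂ} (hf : DifferentiableAt ℂ f z) :
    wd c f z = (1 + c * I) / 2 * deriv f z := by
  have h : fderiv ℝ f z = (fderiv ℂ f z).restrictScalars ℝ := hf.fderiv_restrictScalars ℝ
  have h1 : fderiv ℂ f z I = I * deriv f z := by
    have := (fderiv ℂ f z).map_smul I 1
    rwa [smul_eq_mul, mul_one, smul_eq_mul, fderiv_apply_one_eq_deriv] at this
  simp only [wd, h, ContinuousLinearMap.coe_restrictScalars', h1, fderiv_apply_one_eq_deriv]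
  ring

lemma dz_holo {z : ℂ} (hf : DifferentiableAt ℂ f z) : wd (-I) f z = deriv f z := by
  rw [wd_of_differentiableAt hf]; linear_combination (-(1/2) * deriv f z) * I_mul_I

lemma dzbar_holo {z : ℂ} (hf : DifferentiableAt ℂ f z) : wd I f z = 0 := by
  rw [wd_of_differentiableAt hf]; linear_combination ((1/2) * deriv f z) * I_mul_I

lemma holo_contDiffOn (hf : DifferentiableOn ℂ f Ω) : ContDiffOn ℝ ∞ f Ω := by
  have h := hf.contDiffOn (n := ∞) Ω.isOpen
  exact h.restrict_scalars ℝ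

lemma holo_deriv (hf : DifferentiableOn ℂ f Ω) : DifferentiableOn ℂ (deriv f) Ω :=
  hf.deriv Ω.isOpen

lemma holo_iter_deriv (n : ℕ) (hf : DifferentiableOn ℂ f Ω) :
    DifferentiableOn ℂ (deriv^[n] f) Ω := by
  induction n with
  | zero => exact hf
  | succ n ih => rw [Function.iterate_succ', Function.comp]; exact holo_deriv ih

lemma dz_iter_holo (n : ℕ) (hf : DifferentiableOn ℂ f Ω) :
    Set.EqOn ((wd (-I))^[n] f) (deriv^[n] f) Ω := by
  induction n with
  | zero => exact fun _ _ => rfl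
  | succ n ih =>
    intro z hz
    rw [Function.iterate_succ', Function.comp, wd_congr ih hz, Function.iterate_succ',
      Function.comp, dz_holo ((holo_iter_deriv n hf).differentiableAt (Ω.isOpen.mem_nhds hz))]

lemma holo_of_dzbar_eq_zero (hf : ContDiffOn ℝ ∞ f Ω) (h : ∀ z ∈ Ω, wd I f z = 0) :
    DifferentiableOn ℂ f Ω := by
  intro z hz
  refine (differentiableAt_complex_iff_differentiableAt_real.2
    ⟨diffAt_of_contDiffOn hf hz, ?_⟩).differentiableWithinAt
  have h0 := h z hz
  simp only [wd] at h0
  rw [smul_eq_mul]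
  linear_combination (2 * (-I)) * h0 + (fderiv ℝ f z I) * I_mul_I

/-! ### Products -/

lemma wd_iter_mul_left (n : ℕ) {a g : ℂ → ℂ} (ha : ContDiffOn ℝ ∞ a Ω)
    (ha0 : ∀ z ∈ Ω, wd c a z = 0) (hg : ContDiffOn ℝ ∞ g Ω) {z : ℂ} (hz : z ∈ Ω) :
    (wd c)^[n] (fun w => a w * g w) z = a z * (wd c)^[n] g z := by
  induction n generalizing z with
  | zero => rfl
  | succ n ih =>
    simp only [Function.iterate_succ', Function.comp]
    rw [wd_congr (fun w hw => ih hw) hz, wd_mul_at (diffAt_of_contDiffOn ha hz)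
      (diffAt_of_contDiffOn (wd_iter_contDiffOn n hg) hz), ha0 z hz]
    ring

/-- Leibniz rule for a product with a power of a function `Q` whose derivative `β` is annihilated
by the operator. -/
lemma wd_iter_pow_mul (n j : ℕ) {Q β f : ℂ → ℂ} (hQ : ContDiffOn ℝ ∞ Q Ω)
    (hβ : ContDiffOn ℝ ∞ β Ω) (hQβ : ∀ z ∈ Ω, wd c Q z = β z) (hβ0 : ∀ z ∈ Ω, wd c β z = 0)
    (hf : ContDiffOn ℝ ∞ f Ω) {z : ℂ} (hz : z ∈ Ω) :
    (wd c)^[n] (fun w => Q w ^ j * f w) z =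
      ∑ a ∈ Finset.range (n + 1), (n.choose a : ℂ) *
        ((j.descFactorial (n - a) : ℂ) * β z ^ (n - a) * Q z ^ (j - (n - a))) *
          (wd c)^[a] f z := by
  have hQp : ∀ m : ℕ, ∀ z ∈ Ω, wd c (fun w => Q w ^ m) z = m * Q z ^ (m - 1) * β z := by
    intro m
    induction m with
    | zero => intro z _; simp
    | succ m ih =>
      intro z hz
      simp only [pow_succ]
      rw [wd_mul_at (diffAt_of_contDiffOn (hQ.pow m) hz) (diffAt_of_contDiffOn hQ hz), ih z hz,
        hQβ z hz]
      rcases m with _ | m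
      · simp
      · simp [pow_succ]; ring
  -- `β` behaves as a constant for the operator, so each application only lowers the power of `Q`
  -- and contributes one factor `β`.
  have hQi : ∀ i : ℕ, ∀ z ∈ Ω, (wd c)^[i] (fun w => Q w ^ j) z =
      (j.descFactorial i : ℂ) * β z ^ i * Q z ^ (j - i) := by
    intro i
    induction i with
    | zero => intro z _; simp
    | succ i ih =>
      intro z hz
      rw [Function.iterate_succ', Function.comp, wd_congr (fun w hw => ih w hw) hz]
      have hβi : ∀ z ∈ Ω, wd c (fun w => (j.descFactorial i : ℂ) * β w ^ i) z = 0 := by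
        intro z hz
        rw [wd_const_mul]
        have : ∀ m : ℕ, wd c (fun w => β w ^ m) z = 0 := by
          intro m
          induction m with
          | zero => simp
          | succ m ihm =>
            simp only [pow_succ]
            rw [wd_mul_at (diffAt_of_contDiffOn (hβ.pow m) hz) (diffAt_of_contDiffOn hβ hz), ihm,
              hβ0 z hz]; ring
        rw [this, mul_zero]
      rw [wd_mul_at (diffAt_of_contDiffOn (contDiffOn_const.mul (hβ.pow i)) hz)
        (diffAt_of_contDiffOn (hQ.pow _) hz), hβi z hz, hQp _ z hz, Nat.descFactorial_succ,
        Nat.sub_sub]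
      push_cast; ring
  -- The ordinary Leibniz rule for a first order derivation, by Pascal's rule.
  have hgen : ∀ n : ℕ, ∀ z ∈ Ω, (wd c)^[n] (fun w => Q w ^ j * f w) z =
      ∑ a ∈ Finset.range (n + 1), (n.choose a : ℂ) * (wd c)^[n - a] (fun w => Q w ^ j) z *
        (wd c)^[a] f z := by
    intro n
    induction n with
    | zero => intro z _; simp
    | succ n ih =>
      intro z hz
      have hP := hQ.pow j
      rw [Function.iterate_succ', Function.comp, wd_congr (fun w hw => ih w hw) hz]
      have h1 : wd c (fun w => ∑ a ∈ Finset.range (n + 1), (n.choose a : ℂ) *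
          (wd c)^[n - a] (fun w => Q w ^ j) w * (wd c)^[a] f w) z =
          ∑ a ∈ Finset.range (n + 1), (n.choose a : ℂ) *
            ((wd c)^[n + 1 - a] (fun w => Q w ^ j) z * (wd c)^[a] f z +
              (wd c)^[n - a] (fun w => Q w ^ j) z * (wd c)^[a + 1] f z) := by
        have := wd_iter_sum (c := c) (Ω := Ω) 1 (Finset.range (n + 1)) (fun a w => (n.choose a : ℂ) *
          (wd c)^[n - a] (fun w => Q w ^ j) w * (wd c)^[a] f w)
          (fun a _ => (contDiffOn_const.mul (wd_iter_contDiffOn _ hP)).mul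
            (wd_iter_contDiffOn _ hf)) hz
        simp only [Function.iterate_one] at this
        rw [this]
        refine Finset.sum_congr rfl fun a ha => ?_
        have ha' : a ≤ n := Nat.lt_succ_iff.1 (Finset.mem_range.1 ha)
        simp only [mul_assoc]
        rw [wd_const_mul, wd_mul_at (diffAt_of_contDiffOn (wd_iter_contDiffOn _ hP) hz)
          (diffAt_of_contDiffOn (wd_iter_contDiffOn _ hf) hz), Nat.sub_add_comm ha',
          Function.iterate_succ', Function.iterate_succ']
        rfl
      rw [h1]
      simp only [mul_add, Finset.sum_add_distrib]
      rw [Finset.sum_range_succ', Finset.sum_range_succ' (n := n + 1)]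
      rw [Finset.sum_range_succ (n := n)
        (f := fun a => (n.choose a : ℂ) * ((wd c)^[n - a] (fun w => Q w ^ j) z *
          (wd c)^[a + 1] f z)), Finset.sum_range_succ (n := n)
        (f := fun a => ((n + 1).choose (a + 1) : ℂ) *
          (wd c)^[n + 1 - (a + 1)] (fun w => Q w ^ j) z * (wd c)^[a + 1] f z)]
      have h2 : ∀ a ∈ Finset.range n, ((n + 1).choose (a + 1) : ℂ) *
          (wd c)^[n + 1 - (a + 1)] (fun w => Q w ^ j) z * (wd c)^[a + 1] f z =
          (n.choose (a + 1) : ℂ) * ((wd c)^[n + 1 - (a + 1)] (fun w => Q w ^ j) z *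
            (wd c)^[a + 1] f z) + (n.choose a : ℂ) * ((wd c)^[n - a] (fun w => Q w ^ j) z *
          (wd c)^[a + 1] f z) := by
        intro a _
        rw [Nat.choose_succ_succ, Nat.add_sub_add_right]
        push_cast; ring
      rw [Finset.sum_congr rfl h2, Finset.sum_add_distrib]
      simp
      ring
  rw [hgen n z hz]
  refine Finset.sum_congr rfl fun a _ => ?_
  rw [hQi _ z hz]

/-! ### Bounds of iterated derivatives -/

/-- This is `df = ∂f dz + ∂̄f dz̄`, each term being a fixed continuous linear map applied to a
scalar function. In this form Fréchet derivatives of any order can be estimated through Wirtinger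
derivatives alone. -/
lemma fderiv_eq_wd (f : ℂ → ℂ) (z : ℂ) :
    fderiv ℝ f z = ContinuousLinearMap.mul ℝ ℂ (wd (-I) f z) +
      ((ContinuousLinearMap.compL ℝ ℂ ℂ ℂ).flip (conjCLE : ℂ →L[ℝ] ℂ) ∘L
        ContinuousLinearMap.mul ℝ ℂ) (wd I f z) := by
  ext w
  have hw : fderiv ℝ f z w = w.re * fderiv ℝ f z 1 + w.im * fderiv ℝ f z I := by
    conv_lhs => rw [show w = w.re • (1 : ℂ) + w.im • I by simp [re_add_im]]
    rw [map_add, map_smul, map_smul, real_smul, real_smul]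
  have h2 : conj w = w.re - w.im * I := by
    apply Complex.ext <;> simp
  simp only [add_apply, ContinuousLinearMap.comp_apply, ContinuousLinearMap.flip_apply,
    ContinuousLinearMap.compL_apply, ContinuousLinearMap.mul_apply', ContinuousLinearEquiv.coe_coe,
    conjCLE_apply, hw, h2, wd]
  nth_rw 3 [← re_add_im w]
  linear_combination (fderiv ℝ f z I * w.im) * I_mul_I

/-- Induction on `n`: by `fderiv_eq_wd`, a derivative of order `n + 1` is controlled by derivatives
of order `n` of two functions lying one grade higher. The grade records how the pointwise bound
changes with each derivative. -/
lemma norm_iteratedFDeriv_le_of_wd (A : ℕ → Set (ℂ → ℂ)) (B : ℕ → ℂ → ℝ)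
    (hA : ∀ k, ∀ f ∈ A k, ContDiffOn ℝ ∞ f Ω)
    (hd : ∀ k, ∀ f ∈ A k, wd (-I) f ∈ A (k + 1) ∧ wd I f ∈ A (k + 1))
    (hB : ∀ k, ∀ f ∈ A k, ∃ C : ℝ, ∀ z ∈ Ω, ‖f z‖ ≤ C * B k z) (n : ℕ) :
    ∀ k, ∀ f ∈ A k, ∃ C : ℝ, ∀ z ∈ Ω, ‖iteratedFDeriv ℝ n f z‖ ≤ C * B (k + n) z := by
  induction n with
  | zero => intro k f hf; simpa using hB k f hf
  | succ n ih =>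
    intro k f hf
    obtain ⟨C₁, h₁⟩ := ih (k + 1) _ (hd k f hf).1
    obtain ⟨C₂, h₂⟩ := ih (k + 1) _ (hd k f hf).2
    set L₁ := ContinuousLinearMap.mul ℝ ℂ
    set L₂ := (ContinuousLinearMap.compL ℝ ℂ ℂ ℂ).flip (conjCLE : ℂ →L[ℝ] ℂ) ∘L
        ContinuousLinearMap.mul ℝ ℂ
    refine ⟨‖L₁‖ * C₁ + ‖L₂‖ * C₂, fun z hz => ?_⟩
    have hΩ := Ω.isOpen.mem_nhds hz
    have hf' := hA k f hf
    have e₁ : ContDiffAt ℝ n (wd (-I) f) z :=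
      ((wd_contDiffOn hf').contDiffAt hΩ).of_le (by exact_mod_cast le_top)
    have e₂ : ContDiffAt ℝ n (wd I f) z :=
      ((wd_contDiffOn hf').contDiffAt hΩ).of_le (by exact_mod_cast le_top)
    have h3 : fderiv ℝ f = (L₁ ∘ wd (-I) f) + (L₂ ∘ wd I f) :=
      funext fun w => fderiv_eq_wd f w
    rw [← norm_iteratedFDeriv_fderiv, h3, iteratedFDeriv_add_apply (L₁.contDiff.contDiffAt.comp z e₁)
      (L₂.contDiff.contDiffAt.comp z e₂), show k + (n + 1) = k + 1 + n by ring, add_mul, mul_assoc,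
      mul_assoc]
    refine (norm_add_le _ _).trans (add_le_add ?_ ?_)
    · exact (L₁.norm_iteratedFDeriv_comp_left e₁ le_rfl).trans
        (mul_le_mul_of_nonneg_left (h₁ z hz) (norm_nonneg _))
    · exact (L₂.norm_iteratedFDeriv_comp_left e₂ le_rfl).trans
        (mul_le_mul_of_nonneg_left (h₂ z hz) (norm_nonneg _))

end

end PolyToeplitz


namespace PolyToeplitz

noncomputable section

/-! ### Families of functions cut off near the boundary -/

/-- A smooth function on the line whose support is a compact subset of `(0, ∞)`. -/
structure IsBump (η : ℝ → ℝ) : Prop where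
  smooth : ContDiff ℝ ∞ η
  eq_zero : ∃ a : ℝ, 0 < a ∧ ∀ x ≤ a, η x = 0
  eq_zero' : ∃ b : ℝ, ∀ x, b ≤ x → η x = 0

lemma smooth_mul_deriv {η : ℝ → ℝ} (h : ContDiff ℝ ∞ η) :
    ContDiff ℝ ∞ fun x => x * deriv η x :=
  contDiff_id.mul ((contDiff_infty_iff_deriv.1 h).2)

lemma deriv_eq_zero_of_left {η : ℝ → ℝ} {a k : ℝ} (h : ∀ x ≤ a, η x = k) :
    ∀ x < a, deriv η x = 0 := by
  intro x hx
  have : η =ᶠ[𝓝 x] fun _ => k := by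
    filter_upwards [Iio_mem_nhds hx] with y hy using h y (le_of_lt hy)
  rw [this.deriv_eq, deriv_const]

lemma deriv_eq_zero_of_right {η : ℝ → ℝ} {b k : ℝ} (h : ∀ x, b ≤ x → η x = k) :
    ∀ x, b < x → deriv η x = 0 := by
  intro x hx
  have : η =ᶠ[𝓝 x] fun _ => k := by
    filter_upwards [Ioi_mem_nhds hx] with y hy using h y (le_of_lt hy)
  rw [this.deriv_eq, deriv_const]

/-- The operator `x d/dx` appears because a derivative of `η(t s)` is `(x η')(t s)` times the
logarithmic derivative of `s`: the parameter `t` then enters only through `t s`. -/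
lemma IsBump.mul_deriv {η : ℝ → ℝ} (h : IsBump η) : IsBump fun x => x * deriv η x := by
  obtain ⟨a, ha, h0⟩ := h.eq_zero
  obtain ⟨b, h1⟩ := h.eq_zero'
  -- The derivative is known to vanish only on the open half-lines, hence `a / 2` and `b + 1`.
  refine ⟨smooth_mul_deriv h.smooth, ⟨a / 2, by positivity, fun x hx => ?_⟩,
    ⟨b + 1, fun x hx => ?_⟩⟩
  · rw [deriv_eq_zero_of_left h0 x (by linarith), mul_zero]
  · rw [deriv_eq_zero_of_right h1 x (by linarith), mul_zero]

lemma Cutoff.mul_deriv (h : Cutoff) : IsBump fun x => x * deriv h.toFun x := by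
  obtain ⟨a, ha, h0⟩ := h.eq_zero
  obtain ⟨b, h1⟩ := h.eq_one
  refine ⟨smooth_mul_deriv h.smooth, ⟨a / 2, by positivity, fun x hx => ?_⟩,
    ⟨b + 1, fun x hx => ?_⟩⟩
  · rw [deriv_eq_zero_of_left h0 x (by linarith), mul_zero]
  · rw [deriv_eq_zero_of_right h1 x (by linarith), mul_zero]

/-- The sum of a cutoff function and a bump is a cutoff function. -/
def Cutoff.addBump (h : Cutoff) {η : ℝ → ℝ} (hη : IsBump η) : Cutoff where
  toFun x := h.toFun x + η x
  smooth := h.smooth.add hη.smooth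
  eq_zero := by
    obtain ⟨a, ha, h0⟩ := h.eq_zero
    obtain ⟨b, hb, h1⟩ := hη.eq_zero
    exact ⟨min a b, lt_min ha hb, fun x hx => by
      rw [h0 x (hx.trans (min_le_left _ _)), h1 x (hx.trans (min_le_right _ _)), add_zero]⟩
  eq_one := by
    obtain ⟨a, h0⟩ := h.eq_one
    obtain ⟨b, h1⟩ := hη.eq_zero'
    exact ⟨max a b, fun x hx => by
      rw [h0 x ((le_max_left _ _).trans hx), h1 x ((le_max_right _ _).trans hx), add_zero]⟩

/-- A cutoff function with values in `[0, 1]`. -/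
def stdCutoff : Cutoff where
  toFun x := Real.smoothTransition (x - 1)
  smooth := Real.smoothTransition.contDiff.comp (contDiff_id.sub contDiff_const)
  eq_zero := ⟨1, one_pos, fun _ hx => Real.smoothTransition.zero_of_nonpos (by linarith)⟩
  eq_one := ⟨2, fun _ hx => Real.smoothTransition.one_of_one_le (by linarith)⟩

lemma Cutoff.bounded (h : Cutoff) : ∃ C : ℝ, ∀ x, ‖h.toFun x‖ ≤ C := by
  obtain ⟨a, ha, h0⟩ := h.eq_zero
  obtain ⟨b, h1⟩ := h.eq_one
  obtain ⟨C, hC⟩ := (isCompact_Icc (a := a) (b := b)).exists_bound_of_continuousOn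
    h.smooth.continuous.continuousOn
  refine ⟨max C 1, fun x => ?_⟩
  rcases le_or_gt x a with hx | hx
  · rw [h0 x hx]; simp
  rcases le_or_gt b x with hb | hb
  · rw [h1 x hb]; simp
  · exact (hC x ⟨hx.le, hb.le⟩).trans (le_max_left _ _)

/-- A bump is the difference of two cutoffs, and these are bounded. -/
lemma IsBump.bounded {η : ℝ → ℝ} (h : IsBump η) : ∃ C : ℝ, ∀ x, ‖η x‖ ≤ C := by
  obtain ⟨C, hC⟩ := stdCutoff.bounded
  obtain ⟨D, hD⟩ := (stdCutoff.addBump h).bounded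
  refine ⟨D + C, fun x => ?_⟩
  have : η x = (stdCutoff.addBump h).toFun x - stdCutoff.toFun x := by
    simp [Cutoff.addBump]
  rw [this]
  exact (norm_sub_le _ _).trans (add_le_add (hD x) (hC x))

/-- An algebra of functions on `Ω` adapted to a boundary function `s`: a space `N` of smooth
functions that is stable under the first order operators weighted by `v` and under multiplication
by the weighted logarithmic derivatives of `v` and `s`. -/
structure BdryAlg {Ω : Opens ℂ} (s : BoundaryFunction Ω) where
  v : ℂ → ℂ
  N : Submodule ℂ (ℂ → ℂ)
  v_smooth : ContDiffOn ℝ ∞ v Ω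
  v_ne : ∀ z ∈ Ω, v z ≠ 0
  smooth : ∀ g ∈ N, ContDiffOn ℝ ∞ g Ω
  congr : ∀ g ∈ N, ∀ g' : ℂ → ℂ, Set.EqOn g g' Ω → g' ∈ N
  deriv_mem : ∀ c : ℂ, ∀ g ∈ N, (fun z => v z * wd c g z) ∈ N
  dv_mem : ∀ c : ℂ, ∀ g ∈ N, (fun z => wd c v z * g z) ∈ N
  ds_mem : ∀ c : ℂ, ∀ g ∈ N,
    (fun z => v z * (wd c (fun w => (s.toFun w : ℂ)) z / s.toFun z) * g z) ∈ N

variable {Ω : Opens ℂ} {s : BoundaryFunction Ω} (A : BdryAlg s) {c : ℂ}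

lemma BoundaryFunction.ne (s : BoundaryFunction Ω) {z : ℂ} (hz : z ∈ Ω) :
    (s.toFun z : ℂ) ≠ 0 := ofReal_ne_zero.2 (s.pos z hz).ne'

namespace BdryAlg

/-- The functions of the form `v ^ k * g`, `g ∈ N`. -/
def Mem (k : ℤ) (m : ℂ → ℂ) : Prop := ∃ g ∈ A.N, ∀ z ∈ Ω, m z = A.v z ^ k * g z

variable {A} {k : ℤ} {m : ℂ → ℂ}

lemma zpow_smooth (A : BdryAlg s) (k : ℤ) : ContDiffOn ℝ ∞ (fun z => A.v z ^ k) Ω := by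
  cases k with
  | ofNat n => simpa using A.v_smooth.pow n
  | negSucc n =>
    simp only [zpow_negSucc]
    exact (A.v_smooth.pow _).inv fun z hz => pow_ne_zero _ (A.v_ne z hz)

lemma Mem.smooth (h : A.Mem k m) : ContDiffOn ℝ ∞ m Ω := by
  obtain ⟨g, hg, hm⟩ := h
  exact ((zpow_smooth A k).mul (A.smooth g hg)).congr hm

lemma Mem.congr {m' : ℂ → ℂ} (h : A.Mem k m) (h' : ∀ z ∈ Ω, m' z = m z) : A.Mem k m' := by
  obtain ⟨g, hg, hm⟩ := h
  exact ⟨g, hg, fun z hz => (h' z hz).trans (hm z hz)⟩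

lemma mem_zero_iff : A.Mem 0 m ↔ m ∈ A.N := by
  constructor
  · rintro ⟨g, hg, hm⟩
    exact A.congr g hg m fun z hz => by simp [hm z hz]
  · exact fun h => ⟨m, h, fun z _ => by simp⟩

lemma Mem.vpow_mul (h : A.Mem k m) (n : ℕ) : A.Mem (k + n) fun z => A.v z ^ n * m z := by
  obtain ⟨g, hg, hm⟩ := h
  refine ⟨g, hg, fun z hz => ?_⟩
  beta_reduce
  rw [hm z hz, zpow_add₀ (A.v_ne z hz), zpow_natCast]; ring

lemma Mem.mul_of {w : ℂ → ℂ} (hw : ∀ g ∈ A.N, (fun z => w z * g z) ∈ A.N) (h : A.Mem k m) :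
    A.Mem k fun z => w z * m z := by
  obtain ⟨g, hg, hm⟩ := h
  refine ⟨_, hw g hg, fun z hz => ?_⟩
  beta_reduce
  rw [hm z hz]; ring

lemma wd_zpow (A : BdryAlg s) (k : ℤ) {z : ℂ} (hz : z ∈ Ω) :
    wd c (fun z => A.v z ^ k) z = k * A.v z ^ (k - 1) * wd c A.v z := by
  have h := ((hasDerivAt_zpow k (A.v z) (Or.inl (A.v_ne z hz))).hasFDerivAt.restrictScalars
    ℝ).comp z (diffAt_of_contDiffOn A.v_smooth hz).hasFDerivAt
  have h' : HasFDerivAt (fun z => A.v z ^ k) _ z := h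
  simp only [wd, h'.fderiv, ContinuousLinearMap.comp_apply,
    ContinuousLinearMap.coe_restrictScalars', ContinuousLinearMap.toSpanSingleton_apply,
    smul_eq_mul]
  ring

/-- `∂(v^k g) = v^{k-1} (k ∂v · g + v ∂g)`, and both summands in the bracket stay in `N`. A
derivative costs exactly one power of `v`. -/
lemma Mem.wd (c : ℂ) (h : A.Mem k m) : A.Mem (k - 1) (wd c m) := by
  obtain ⟨g, hg, hm⟩ := h
  refine ⟨_, A.N.add_mem (A.N.smul_mem (k : ℂ) (A.dv_mem c g hg)) (A.deriv_mem c g hg),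
    fun z hz => ?_⟩
  have hv := A.v_ne z hz
  rw [wd_congr (fun w hw => hm w hw) hz, wd_mul_at (diffAt_of_contDiffOn (zpow_smooth A k) hz)
    (diffAt_of_contDiffOn (A.smooth g hg) hz), wd_zpow A k hz]
  simp only [Pi.add_apply, Pi.smul_apply, smul_eq_mul]
  have : A.v z ^ k = A.v z ^ (k - 1) * A.v z := by rw [← zpow_add_one₀ hv, sub_add_cancel]
  rw [this]; ring

lemma Mem.wd_iter (c : ℂ) (n : ℕ) (h : A.Mem k m) :
    A.Mem (k - n) ((PolyToeplitz.wd c)^[n] m) := by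
  induction n with
  | zero => simpa using h
  | succ n ih =>
    rw [Function.iterate_succ', Function.comp]
    have := ih.wd c
    rwa [sub_sub] at this

lemma Mem.ds (c : ℂ) (h : A.Mem k m) : A.Mem (k - 1)
    fun z => PolyToeplitz.wd c (fun w => (s.toFun w : ℂ)) z / s.toFun z * m z := by
  obtain ⟨g, hg, hm⟩ := h
  refine ⟨_, A.ds_mem c g hg, fun z hz => ?_⟩
  have hv := A.v_ne z hz
  have : A.v z ^ k = A.v z ^ (k - 1) * A.v z := by rw [← zpow_add_one₀ hv, sub_add_cancel]
  beta_reduce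
  rw [hm z hz, this]; ring

/-- Finite sums of families `z ↦ η(t s(z)) m(z)`, where `η` is a bump and `m ∈ v ^ k N`. -/
inductive Fam (A : BdryAlg s) (k : ℤ) : (ℝ → ℂ → ℂ) → Prop
  | basic (η : ℝ → ℝ) (hη : IsBump η) (m : ℂ → ℂ) (hm : A.Mem k m) :
      Fam A k fun t z => (η (t * s.toFun z) : ℂ) * m z
  | zero : Fam A k fun _ _ => 0
  | add (Φ Ψ : ℝ → ℂ → ℂ) : Fam A k Φ → Fam A k Ψ → Fam A k fun t z => Φ t z + Ψ t z
  | congr (Φ Ψ : ℝ → ℂ → ℂ) : Fam A k Φ → (∀ t, ∀ z ∈ Ω, Ψ t z = Φ t z) → Fam A k Ψ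

variable {Φ : ℝ → ℂ → ℂ}

lemma smooth_comp (s : BoundaryFunction Ω) {η : ℝ → ℝ} (hη : ContDiff ℝ ∞ η) (t : ℝ) :
    ContDiffOn ℝ ∞ (fun z => (η (t * s.toFun z) : ℂ)) Ω :=
  ofRealCLM.contDiff.comp_contDiffOn
    (hη.comp_contDiffOn (contDiffOn_const.mul s.smooth))

lemma Fam.smooth (h : A.Fam k Φ) (t : ℝ) : ContDiffOn ℝ ∞ (Φ t) Ω := by
  induction h with
  | basic η hη m hm => exact (smooth_comp s hη.smooth t).mul hm.smooth
  | zero => exact contDiffOn_const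
  | add Φ Ψ _ _ h₁ h₂ => exact h₁.add h₂
  | congr Φ Ψ _ h ih => exact ih.congr (h t)

/-- Writing `t ∂s = (t s) (∂s / s)` leaves a profile evaluated at `t s` times a function independent
of `t`, so the families below are stable under differentiation. -/
lemma wd_cut {η : ℝ → ℝ} (hη : ContDiff ℝ ∞ η) {m : ℂ → ℂ} (hm : ContDiffOn ℝ ∞ m Ω) (t : ℝ)
    {z : ℂ} (hz : z ∈ Ω) :
    PolyToeplitz.wd c (fun z => (η (t * s.toFun z) : ℂ) * m z) z =
      ((t * s.toFun z * deriv η (t * s.toFun z) : ℝ) : ℂ) *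
        (PolyToeplitz.wd c (fun w => (s.toFun w : ℂ)) z / s.toFun z * m z) +
      (η (t * s.toFun z) : ℂ) * PolyToeplitz.wd c m z := by
  rw [wd_mul_at (diffAt_of_contDiffOn (smooth_comp s hη t) hz) (diffAt_of_contDiffOn hm hz),
    wd_comp_real_at (hη.differentiable (by simp))
      ((s.smooth.contDiffAt (Ω.isOpen.mem_nhds hz)).differentiableAt (by simp))]
  have := s.ne hz
  push_cast
  field_simp

lemma Fam.wd (c : ℂ) (h : A.Fam k Φ) : A.Fam (k - 1) fun t => PolyToeplitz.wd c (Φ t) := by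
  induction h with
  | basic η hη m hm =>
    exact .congr _ _ (.add _ _ (.basic _ hη.mul_deriv _ (hm.ds c)) (.basic η hη _ (hm.wd c)))
      fun t z hz => wd_cut hη.smooth hm.smooth t hz
  | zero => exact .congr _ _ .zero fun t z _ => wd_const 0 z
  | add Φ Ψ hΦ hΨ h₁ h₂ =>
    exact .congr _ _ (.add _ _ h₁ h₂) fun t z hz =>
      wd_add_at (diffAt_of_contDiffOn (hΦ.smooth t) hz) (diffAt_of_contDiffOn (hΨ.smooth t) hz)
  | congr Φ Ψ _ h ih => exact .congr _ _ ih fun t z hz => wd_congr (h t) hz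

lemma Fam.mul {l : ℤ} {w : ℂ → ℂ} (hw : ∀ m, A.Mem k m → A.Mem l fun z => w z * m z)
    (h : A.Fam k Φ) : A.Fam l fun t z => w z * Φ t z := by
  induction h with
  | basic η hη m hm =>
    exact .congr _ _ (.basic η hη _ (hw m hm)) fun t z _ => by ring
  | zero => simpa using Fam.zero
  | add Φ Ψ _ _ h₁ h₂ => exact .congr _ _ (.add _ _ h₁ h₂) fun t z _ => by ring
  | congr Φ Ψ _ h ih => exact .congr _ _ ih fun t z hz => by rw [h t z hz]

/-- The family `Φ` differs from `h(t s) m` by a family of bumps, `m ∈ v ^ k N`. -/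
def Near (A : BdryAlg s) (h : Cutoff) (k : ℤ) (Φ : ℝ → ℂ → ℂ) (m : ℂ → ℂ) : Prop :=
  A.Mem k m ∧ ∃ Ψ, A.Fam k Ψ ∧ ∀ t, ∀ z ∈ Ω, Φ t z = (h.toFun (t * s.toFun z) : ℂ) * m z + Ψ t z

variable {h : Cutoff}

lemma Near.of_mem (h : Cutoff) (hm : A.Mem k m) :
    A.Near h k (fun t z => (h.toFun (t * s.toFun z) : ℂ) * m z) m :=
  ⟨hm, _, .zero, fun t z _ => by ring⟩

/-- The derivative falling on `m` gives the new leading term. The one falling on `h(t s)` is a bump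
term, by `Cutoff.mul_deriv`. -/
lemma Near.wd (c : ℂ) (H : A.Near h k Φ m) :
    A.Near h (k - 1) (fun t => PolyToeplitz.wd c (Φ t)) (PolyToeplitz.wd c m) := by
  obtain ⟨hm, Ψ, hΨ, hΦ⟩ := H
  refine ⟨hm.wd c, _, .add _ _ (.basic _ h.mul_deriv _ (hm.ds c)) (hΨ.wd c), fun t z hz => ?_⟩
  beta_reduce
  rw [wd_congr (hΦ t) hz, wd_add_at
    (diffAt_of_contDiffOn ((smooth_comp s h.smooth t).mul hm.smooth) hz)
    (diffAt_of_contDiffOn (hΨ.smooth t) hz), wd_cut h.smooth hm.smooth t hz]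
  ring

lemma Near.wd_iter (c : ℂ) (n : ℕ) (H : A.Near h k Φ m) :
    A.Near h (k - n) (fun t => (PolyToeplitz.wd c)^[n] (Φ t)) ((PolyToeplitz.wd c)^[n] m) := by
  induction n with
  | zero => simpa using H
  | succ n ih =>
    simp only [Function.iterate_succ', Function.comp]
    have := ih.wd c
    rwa [sub_sub] at this

lemma Near.mul {l : ℤ} {w : ℂ → ℂ} (hw : ∀ m, A.Mem k m → A.Mem l fun z => w z * m z)
    (H : A.Near h k Φ m) : A.Near h l (fun t z => w z * Φ t z) fun z => w z * m z := by
  obtain ⟨hm, Ψ, hΨ, hΦ⟩ := H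
  refine ⟨hw m hm, _, hΨ.mul hw, fun t z hz => ?_⟩
  beta_reduce
  rw [hΦ t z hz]; ring

lemma Mem.add {m' : ℂ → ℂ} (h : A.Mem k m) (h' : A.Mem k m') : A.Mem k fun z => m z + m' z := by
  obtain ⟨g, hg, hm⟩ := h
  obtain ⟨g', hg', hm'⟩ := h'
  exact ⟨_, A.N.add_mem hg hg', fun z hz => by
    beta_reduce; rw [hm z hz, hm' z hz, Pi.add_apply]; ring⟩

lemma Near.sum {ι : Type*} (S : Finset ι) (Φ : ι → ℝ → ℂ → ℂ) (m : ι → ℂ → ℂ)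
    (H : ∀ i ∈ S, A.Near h k (Φ i) (m i)) :
    A.Near h k (fun t z => ∑ i ∈ S, Φ i t z) fun z => ∑ i ∈ S, m i z := by
  classical
  induction S using Finset.induction_on with
  | empty =>
    simp only [Finset.sum_empty]
    exact ⟨⟨0, A.N.zero_mem, fun z _ => by simp⟩, _, .zero, fun t z _ => by ring⟩
  | insert a S ha ih =>
    simp only [Finset.sum_insert ha]
    obtain ⟨h₁, Ψ₁, hΨ₁, e₁⟩ := H a (Finset.mem_insert_self _ _)
    obtain ⟨h₂, Ψ₂, hΨ₂, e₂⟩ := ih fun i hi => H i (Finset.mem_insert_of_mem hi)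
    refine ⟨h₁.add h₂, _, hΨ₁.add _ _ hΨ₂, fun t z hz => ?_⟩
    have e := e₂ t z hz
    beta_reduce at e ⊢
    rw [e₁ t z hz, e]; ring

end BdryAlg

end

end PolyToeplitz


namespace PolyToeplitz

noncomputable section

/-! ### Integration by parts -/

variable {Ω : Opens ℂ} {s : BoundaryFunction Ω} {c : ℂ}

/-- The function `Θ`, restricted to `Ω`, vanishes outside a compact subset of `Ω`. -/
def CSupp (Ω : Opens ℂ) (Θ : ℂ → ℂ) : Prop :=
  ∃ K : Set ℂ, IsCompact K ∧ K ⊆ Ω ∧ ∀ z ∈ Ω, z ∉ K → Θ z = 0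

lemma CSupp.wd {Θ : ℂ → ℂ} (h : CSupp Ω Θ) (c : ℂ) : CSupp Ω (wd c Θ) := by
  obtain ⟨K, hK, hKΩ, h0⟩ := h
  refine ⟨K, hK, hKΩ, fun z hz hzK => ?_⟩
  have : Θ =ᶠ[𝓝 z] fun _ => 0 := by
    filter_upwards [Ω.isOpen.mem_nhds hz, hK.isClosed.isOpen_compl.mem_nhds hzK] with w h₁ h₂
      using h0 w h₁ h₂
  rw [wd_congr_at this, wd_const]

lemma CSupp.mul_left {Θ : ℂ → ℂ} (h : CSupp Ω Θ) (g : ℂ → ℂ) : CSupp Ω fun z => g z * Θ z := by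
  obtain ⟨K, hK, hKΩ, h0⟩ := h
  exact ⟨K, hK, hKΩ, fun z hz hzK => by beta_reduce; rw [h0 z hz hzK, mul_zero]⟩

lemma contDiff_indicator {Θ : ℂ → ℂ} (hΘ : ContDiffOn ℝ ∞ Θ Ω) (h : CSupp Ω Θ) :
    ContDiff ℝ ∞ ((Ω : Set ℂ).indicator Θ) ∧ HasCompactSupport ((Ω : Set ℂ).indicator Θ) ∧
      tsupport ((Ω : Set ℂ).indicator Θ) ⊆ Ω := by
  obtain ⟨K, hK, hKΩ, h0⟩ := h
  have h1 : ∀ z ∉ K, (Ω : Set ℂ).indicator Θ z = 0 := by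
    intro z hz
    by_cases hzΩ : z ∈ (Ω : Set ℂ)
    · rw [Set.indicator_of_mem hzΩ, h0 z hzΩ hz]
    · exact Set.indicator_of_notMem hzΩ _
  refine ⟨?_, HasCompactSupport.intro hK h1, (closure_minimal (fun z hz => ?_) hK.isClosed).trans hKΩ⟩
  · rw [contDiff_iff_contDiffAt]
    intro z
    by_cases hz : z ∈ (Ω : Set ℂ)
    · refine (hΘ.contDiffAt (Ω.isOpen.mem_nhds hz)).congr_of_eventuallyEq ?_
      filter_upwards [Ω.isOpen.mem_nhds hz] with w hw using Set.indicator_of_mem hw _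
    · refine (contDiffAt_const (c := (0 : ℂ))).congr_of_eventuallyEq ?_
      filter_upwards [hK.isClosed.isOpen_compl.mem_nhds fun hc => hz (hKΩ hc)] with w hw
      exact h1 w hw
  · by_contra hc
    exact hz (h1 z hc)

lemma CSupp.integrableOn {Θ : ℂ → ℂ} (hΘ : ContDiffOn ℝ ∞ Θ Ω) (h : CSupp Ω Θ) :
    IntegrableOn Θ Ω := by
  obtain ⟨h1, h2, -⟩ := contDiff_indicator hΘ h
  rw [← integrable_indicator_iff Ω.isOpen.measurableSet]
  exact h1.continuous.integrable_of_hasCompactSupport h2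

/-- The extension by zero is a smooth compactly supported function on the plane, where the integral
of a derivative vanishes. -/
lemma integral_wd_eq_zero {Θ : ℂ → ℂ} (hΘ : ContDiffOn ℝ ∞ Θ Ω) (h : CSupp Ω Θ) :
    ∫ z in Ω, wd c Θ z = 0 := by
  obtain ⟨h1, h2, -⟩ := contDiff_indicator hΘ h
  set φ := (Ω : Set ℂ).indicator Θ with hφ
  have hφd : Differentiable ℝ φ := h1.differentiable (by simp)
  have hi : ∀ u, Integrable (fun z => fderiv ℝ φ z u) := fun u =>
    ((h1.continuous_fderiv (by simp)).clm_apply continuous_const).integrable_of_hasCompactSupport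
      (h2.fderiv_apply ℝ u)
  have h0 : ∀ u, ∫ z, fderiv ℝ φ z u = 0 := by
    intro u
    -- Integration by parts against the constant function `1`.
    have := integral_mul_fderiv_eq_neg_fderiv_mul_of_integrable (μ := (volume : Measure ℂ))
      (f := fun _ : ℂ => (1 : ℂ)) (g := φ) (v := u) (by simp) (by simpa using hi u)
      (by simpa using h1.continuous.integrable_of_hasCompactSupport h2)
      (fun x _ => differentiableAt_const _) (fun x _ => hφd x)
    simpa using this
  have h3 : ∫ z in Ω, wd c Θ z = ∫ z, wd c φ z := by
    rw [← integral_indicator Ω.isOpen.measurableSet]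
    congr 1
    funext z
    by_cases hz : z ∈ (Ω : Set ℂ)
    · rw [Set.indicator_of_mem hz]
      exact wd_congr (Ω := Ω) (fun w hw => (Set.indicator_of_mem hw _).symm) hz
    · rw [Set.indicator_of_notMem hz]
      have : z ∉ tsupport φ := fun hc => hz ((contDiff_indicator hΘ h).2.2 hc)
      rw [wd_congr_at (notMem_tsupport_iff_eventuallyEq.1 this)]
      simp [wd]
  rw [h3]
  simp only [wd]
  rw [integral_const_mul, integral_add (hi 1) ((hi I).const_mul c), integral_const_mul, h0, h0]
  simp

lemma integral_wd_mul {G Θ : ℂ → ℂ} (hG : ContDiffOn ℝ ∞ G Ω) (hΘ : ContDiffOn ℝ ∞ Θ Ω)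
    (h : CSupp Ω Θ) : ∫ z in Ω, wd c G z * Θ z = - ∫ z in Ω, G z * wd c Θ z := by
  have h1 := integral_wd_eq_zero (c := c) (hG.mul hΘ) (h.mul_left G)
  have i1 : IntegrableOn (fun z => wd c G z * Θ z) Ω :=
    (h.mul_left _).integrableOn ((wd_contDiffOn hG).mul hΘ)
  have i2 : IntegrableOn (fun z => G z * wd c Θ z) Ω :=
    ((h.wd c).mul_left _).integrableOn (hG.mul (wd_contDiffOn hΘ))
  rw [eq_neg_iff_add_eq_zero, ← integral_add i1 i2, ← h1]
  refine setIntegral_congr_fun Ω.isOpen.measurableSet fun z hz => ?_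
  exact (wd_mul_at (diffAt_of_contDiffOn hG hz) (diffAt_of_contDiffOn hΘ hz)).symm

lemma integral_wd_iter_mul (j : ℕ) {G Θ : ℂ → ℂ} (hG : ContDiffOn ℝ ∞ G Ω)
    (hΘ : ContDiffOn ℝ ∞ Θ Ω) (h : CSupp Ω Θ) :
    ∫ z in Ω, (wd c)^[j] G z * Θ z = (-1) ^ j * ∫ z in Ω, G z * (wd c)^[j] Θ z := by
  induction j generalizing Θ with
  | zero => simp
  | succ j ih =>
    have e := integral_wd_mul (c := c) (wd_iter_contDiffOn (c := c) j hG) hΘ h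
    rw [Function.iterate_succ_apply' (wd c) j G, e, ih (wd_contDiffOn hΘ) (h.wd c),
      Function.iterate_succ_apply (wd c) j Θ, pow_succ]
    ring

/-! ### Passage to the limit -/

lemma tendsto_cutoff (s : BoundaryFunction Ω) (h : Cutoff) {z : ℂ} (hz : z ∈ Ω) :
    Tendsto (fun t : ℝ => (h.toFun (t * s.toFun z) : ℂ)) atTop (𝓝 1) := by
  obtain ⟨b, hb⟩ := h.eq_one
  refine tendsto_const_nhds.congr' ?_
  filter_upwards [(tendsto_id.atTop_mul_const (s.pos z hz)).eventually_ge_atTop b] with t ht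
  rw [id] at ht
  rw [hb _ ht, ofReal_one]

lemma tendsto_bump (s : BoundaryFunction Ω) {η : ℝ → ℝ} (h : IsBump η) {z : ℂ} (hz : z ∈ Ω) :
    Tendsto (fun t : ℝ => (η (t * s.toFun z) : ℂ)) atTop (𝓝 0) := by
  obtain ⟨b, hb⟩ := h.eq_zero'
  refine tendsto_const_nhds.congr' ?_
  filter_upwards [(tendsto_id.atTop_mul_const (s.pos z hz)).eventually_ge_atTop b] with t ht
  rw [id] at ht
  rw [hb _ ht, ofReal_zero]

/-- Dominated convergence, for cutoffs (`l = 1`) and for bumps (`l = 0`) at once. -/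
lemma tendsto_integral_comp {η : ℝ → ℝ} (hη : ContDiff ℝ ∞ η) {C : ℝ} (hC : ∀ x, ‖η x‖ ≤ C)
    {l : ℂ} (hl : ∀ z ∈ Ω, Tendsto (fun t : ℝ => (η (t * s.toFun z) : ℂ)) atTop (𝓝 l))
    {G : ℂ → ℂ} (hG : IntegrableOn G Ω) :
    Tendsto (fun t : ℝ => ∫ z in Ω, (η (t * s.toFun z) : ℂ) * G z) atTop
      (𝓝 (∫ z in Ω, l * G z)) := by
  refine tendsto_integral_filter_of_dominated_convergence (fun z => C * ‖G z‖) ?_ ?_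
    (hG.norm.const_mul C) ?_
  · refine Eventually.of_forall fun t => ?_
    exact ((BdryAlg.smooth_comp s hη t).continuousOn.aestronglyMeasurable
      Ω.isOpen.measurableSet).mul hG.aestronglyMeasurable
  · refine Eventually.of_forall fun t => Eventually.of_forall fun z => ?_
    rw [norm_mul, norm_real]
    exact mul_le_mul_of_nonneg_right (hC _) (norm_nonneg _)
  · filter_upwards [ae_restrict_mem Ω.isOpen.measurableSet] with z hz
    exact (hl z hz).mul_const _

namespace BdryAlg

variable {A : BdryAlg s} {k : ℤ} {h : Cutoff}

lemma cut_csupp (s : BoundaryFunction Ω) {η : ℝ → ℝ} (hη : ∃ a : ℝ, 0 < a ∧ ∀ x ≤ a, η x = 0)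
    (t : ℝ) (m : ℂ → ℂ) : CSupp Ω fun z => (η (t * s.toFun z) : ℂ) * m z := by
  obtain ⟨a, ha, h0⟩ := hη
  rcases le_or_gt t 0 with ht | ht
  · refine ⟨∅, isCompact_empty, Set.empty_subset _, fun z hz _ => ?_⟩
    beta_reduce
    rw [h0 _ (by nlinarith [s.pos z hz])]; simp
  · refine ⟨_, s.compact (a / t) (div_pos ha ht), fun z hz => hz.1, fun z hz hzK => ?_⟩
    have h1 : s.toFun z < a / t := by
      by_contra hcon
      exact hzK ⟨hz, not_lt.1 hcon⟩
    rw [lt_div_iff₀ ht] at h1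
    beta_reduce
    rw [h0 _ (by linarith)]; simp

/-- At each point of `Ω` a bump `η(t s)` is eventually zero, and in grade `0` the functions `G g`
are integrable dominating functions up to a constant. -/
lemma Fam.integral {Φ : ℝ → ℂ → ℂ} (hΦ : A.Fam 0 Φ) {G : ℂ → ℂ}
    (hint : ∀ g ∈ A.N, IntegrableOn (fun z => G z * g z) Ω) :
    (∀ t, IntegrableOn (fun z => G z * Φ t z) Ω) ∧
      Tendsto (fun t : ℝ => ∫ z in Ω, G z * Φ t z) atTop (𝓝 0) := by
  induction hΦ with
  | basic η hη m hm =>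
    have hi := hint m (mem_zero_iff.1 hm)
    obtain ⟨C, hC⟩ := hη.bounded
    constructor
    · intro t
      have : (fun z => G z * ((η (t * s.toFun z) : ℂ) * m z)) =
          fun z => (η (t * s.toFun z) : ℂ) * (G z * m z) := by funext z; ring
      rw [this]
      refine hi.bdd_mul (c := C) ((smooth_comp s hη.smooth t).continuousOn.aestronglyMeasurable
        Ω.isOpen.measurableSet) (Eventually.of_forall fun z => ?_)
      rw [norm_real]; exact hC _
    · have := tendsto_integral_comp hη.smooth hC (fun z hz => tendsto_bump s hη hz) hi
      simp only [zero_mul, integral_zero] at this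
      refine this.congr fun t => ?_
      congr 1; funext z; ring
  | zero => simp
  | add Φ Ψ _ _ h₁ h₂ =>
    constructor
    · intro t
      simp only [mul_add]
      exact (h₁.1 t).add (h₂.1 t)
    · have := h₁.2.add h₂.2
      rw [add_zero] at this
      refine this.congr fun t => ?_
      simp only [mul_add]
      exact (integral_add (h₁.1 t) (h₂.1 t)).symm
  | congr Φ Ψ _ hh ih =>
    constructor
    · intro t
      exact (ih.1 t).congr_fun (fun z hz => by beta_reduce; rw [hh t z hz]) Ω.isOpen.measurableSet
    · refine ih.2.congr fun t => ?_
      exact setIntegral_congr_fun Ω.isOpen.measurableSet fun z hz => by rw [hh t z hz]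

/-- Integration by parts with a cutoff function that exhausts the domain. -/
theorem tendsto_ibp (h : Cutoff) {j : ℕ} {G θ : ℂ → ℂ} (hG : ContDiffOn ℝ ∞ G Ω)
    (hθ : A.Mem j θ) (hint : ∀ g ∈ A.N, IntegrableOn (fun z => G z * g z) Ω) :
    Tendsto (fun t : ℝ => ∫ z in Ω, (PolyToeplitz.wd c)^[j] G z *
      ((h.toFun (t * s.toFun z) : ℂ) * θ z)) atTop
      (𝓝 ((-1) ^ j * ∫ z in Ω, G z * (PolyToeplitz.wd c)^[j] θ z)) := by
  -- The `j` powers of `v` in `θ` are consumed by the `j` derivatives. The result has grade `0`,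
  -- where the integrability hypothesis applies and the bump terms disappear in the limit.
  have hn := (Near.of_mem h hθ).wd_iter c j
  rw [sub_self] at hn
  obtain ⟨hm, Ψ, hΨ, e⟩ := hn
  obtain ⟨hΨi, hΨl⟩ := hΨ.integral hint
  have hi := hint _ (mem_zero_iff.1 hm)
  obtain ⟨C, hC⟩ := h.bounded
  have e1 := tendsto_integral_comp h.smooth hC (fun z hz => tendsto_cutoff s h hz) hi
  simp only [one_mul] at e1
  have e2 := (e1.add hΨl).const_mul ((-1) ^ j)
  rw [add_zero] at e2
  refine e2.congr fun t => ?_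
  rw [integral_wd_iter_mul j hG ((smooth_comp s h.smooth t).mul hθ.smooth)
    (cut_csupp s h.eq_zero t θ), ← integral_add _ (hΨi t)]
  · congr 1
    refine setIntegral_congr_fun Ω.isOpen.measurableSet fun z hz => ?_
    have e' := e t z hz
    beta_reduce at e' ⊢
    rw [e']; ring
  · refine hi.bdd_mul (c := C) ((smooth_comp s h.smooth t).continuousOn.aestronglyMeasurable
        Ω.isOpen.measurableSet) (Eventually.of_forall fun z => ?_)
    rw [norm_real]; exact hC _

end BdryAlg

end

end PolyToeplitz


namespace PolyToeplitz

noncomputable section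

/-! ### Compact operators with prescribed matrix elements -/

section Hilbert

variable {H : Type*} [NormedAddCommGroup H] [InnerProductSpace ℂ H]

lemma dense_range_eq_zero {u : ℕ → H} (hd : Dense (Submodule.span ℂ (Set.range u) : Set H))
    {x : H} (hx : ∀ k, ⟪u k, x⟫_ℂ = 0) : x = 0 := by
  refine hd.eq_zero_of_inner_right (𝕜 := ℂ) fun v hv => ?_
  have : Submodule.span ℂ (Set.range u) ≤ (ℂ ∙ x)ᗮ := by
    rw [Submodule.span_le]
    rintro _ ⟨k, rfl⟩
    rw [SetLike.mem_coe, Submodule.mem_orthogonal_singleton_iff_inner_left]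
    exact hx k
  exact (Submodule.mem_orthogonal_singleton_iff_inner_left.1 (this hv))

/-- `T` is the sum of the rank one operators `x ↦ a k l ⟨u_k, x⟩ u_l / (‖u_k‖² ‖u_l‖²)`, whose norms
`|a k l| / (‖u_k‖ ‖u_l‖)` are summable. Partial sums have finite rank, so the norm limit is compact.
By orthogonality only one term contributes to each matrix element, and density gives uniqueness. -/
theorem exists_compact_of_matrix [CompleteSpace H] {u : ℕ → H}
    (hd : Dense (Submodule.span ℂ (Set.range u) : Set H))
    (hoff : ∀ k l, k ≠ l → ⟪u k, u l⟫_ℂ = 0) (hne : ∀ k, u k ≠ 0) {a : ℕ → ℕ → ℂ}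
    (ha : Summable fun p : ℕ × ℕ => ‖a p.1 p.2‖ / (‖u p.1‖ * ‖u p.2‖)) :
    ∃ T : H →L[ℂ] H, IsCompactOperator T ∧ (∀ k l, ⟪u l, T (u k)⟫_ℂ = a k l) ∧
      ∀ T' : H →L[ℂ] H, (∀ k l, ⟪u l, T' (u k)⟫_ℂ = a k l) → T' = T := by
  set R : ℕ × ℕ → H →L[ℂ] H := fun p =>
    (a p.1 p.2 / ((‖u p.1‖ : ℂ) ^ 2 * (‖u p.2‖ : ℂ) ^ 2)) •
      (innerSL ℂ (u p.1)).smulRight (u p.2) with hR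
  have hn : ∀ k, (‖u k‖ : ℝ) ≠ 0 := fun k => norm_ne_zero_iff.2 (hne k)
  have hRs : Summable R := by
    refine Summable.of_norm (ha.congr fun p => ?_)
    rw [hR]
    simp only [norm_smul, ContinuousLinearMap.norm_smulRight_apply, innerSL_apply_norm, norm_div,
      norm_mul, norm_pow, norm_real, norm_norm]
    have := hn p.1; have := hn p.2
    field_simp
  obtain ⟨T, hT⟩ := hRs
  have hTu : ∀ k l, ⟪u l, T (u k)⟫_ℂ = a k l := by
    intro k l
    have h0 : HasSum (fun p => R p (u k)) (T (u k)) :=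
      hT.mapL (ContinuousLinearMap.apply ℂ H (u k))
    have h1 : HasSum (fun p => ⟪u l, R p (u k)⟫_ℂ) ⟪u l, T (u k)⟫_ℂ :=
      h0.mapL (innerSL ℂ (u l))
    refine h1.unique ?_
    have h2 : ⟪u l, R (k, l) (u k)⟫_ℂ = a k l := by
      simp only [hR, smul_apply, ContinuousLinearMap.smulRight_apply,
        innerSL_apply_apply, inner_smul_right, inner_self_eq_norm_sq_to_K, coe_algebraMap]
      have h1 : (‖u k‖ : ℂ) ≠ 0 := ofReal_ne_zero.2 (hn k)
      have h2 : (‖u l‖ : ℂ) ≠ 0 := ofReal_ne_zero.2 (hn l)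
      field_simp
    rw [← h2]
    refine hasSum_single (k, l) fun p hp => ?_
    simp only [hR, smul_apply, ContinuousLinearMap.smulRight_apply,
      innerSL_apply_apply, inner_smul_right]
    by_cases h : p.1 = k
    · have h' : l ≠ p.2 := fun h' => hp (Prod.ext h h'.symm)
      rw [hoff _ _ h']; ring
    · rw [hoff _ _ h]; ring
  refine ⟨T, ?_, hTu, fun T' hT' => ?_⟩
  · refine isCompactOperator_of_tendsto hT (Eventually.of_forall fun S => ?_)
    have : ∀ p, R p ∈ compactOperator (RingHom.id ℂ) H H := by
      intro p
      refine Submodule.smul_mem _ _ ?_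
      change IsCompactOperator _
      have h1 : IsCompactOperator (ContinuousLinearMap.toSpanSingleton ℂ (u p.2)) :=
        isCompactOperator_of_locallyCompactSpace_rng (ContinuousLinearMap.toSpanSingleton ℂ (u p.2))
      exact h1.comp_clm (innerSL ℂ (u p.1))
    exact Submodule.sum_mem (compactOperator (RingHom.id ℂ) H H) fun p _ => this p
  · refine ContinuousLinearMap.ext_on hd ?_
    rintro _ ⟨k, rfl⟩
    rw [← sub_eq_zero]
    refine dense_range_eq_zero hd fun l => ?_
    rw [inner_sub_right, hT', hTu, sub_self]

end Hilbert

/-! ### True polyanalytic spaces with a basis -/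

section Poly

variable {Ω : Opens ℂ} {μ : Measure ℂ} {j : ℕ}

lemma inner_Lp_eq {f g : Lp ℂ 2 μ} {F G : ℂ → ℂ} (hf : f =ᵐ[μ] F) (hg : g =ᵐ[μ] G) :
    ⟪f, g⟫_ℂ = ∫ z, G z * conj (F z) ∂μ := by
  rw [L2.inner_def]
  refine integral_congr_ae ?_
  filter_upwards [hf, hg] with z h1 h2
  rw [h1, h2, RCLike.inner_apply]

/-- A family of functions in the true polyanalytic space with the properties that make it a basis
with good bounds. -/
structure PolyBasis (Ω : Opens ℂ) (μ : Measure ℂ) (j : ℕ) (P : Set ℝ) (U : ℕ → ℂ → ℂ) : Prop where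
  ae_mem : ∀ᵐ z ∂μ, z ∈ Ω
  smooth : ∀ k, ContDiffOn ℝ ∞ (U k) Ω
  memLp : ∀ k, MemLp (U k) 2 μ
  poly : ∀ k, ∀ z ∈ Ω, dzbar^[j + 1] (U k) z = 0
  orth : ∀ g : ℂ → ℂ, ContDiffOn ℝ ∞ g Ω → MemLp g 2 μ → (∀ z ∈ Ω, dzbar^[j] g z = 0) →
    ∀ k, ∫ z, g z * conj (U k z) ∂μ = 0
  complete : ∀ g : ℂ → ℂ, ContDiffOn ℝ ∞ g Ω → MemLp g 2 μ →
    (∀ z ∈ Ω, dzbar^[j + 1] g z = 0) → (∀ k, ∫ z, g z * conj (U k z) ∂μ = 0) →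
    ∀ z ∈ Ω, dzbar^[j] g z = 0
  off : ∀ k l, k ≠ l → ∫ z, U l z * conj (U k z) ∂μ = 0
  pos : ∀ ρ ∈ P, 0 < ρ
  gap : ∀ ρ ∈ P, ∃ ρ' ∈ P, ρ < ρ'
  low : ∀ ρ ∈ P, ∃ c : ℝ, 0 < c ∧ ∀ k, (c * ρ ^ k) ^ 2 ≤ ‖∫ z, U k z * conj (U k z) ∂μ‖
  synth : ∀ b : ℕ → ℂ, (∀ ρ ∈ P, ∃ C : ℝ, ∀ k, ‖b k‖ * ρ ^ k ≤ C) → ∃ g : ℂ → ℂ,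
    ContDiffOn ℝ ∞ g Ω ∧ (∀ z ∈ Ω, dzbar^[j + 1] g z = 0) ∧
      ∀ z ∈ Ω, HasSum (fun k => b k * U k z) (g z)

namespace PolyBasis

variable {P : Set ℝ} {U : ℕ → ℂ → ℂ} (B : PolyBasis Ω μ j P U)

/-- The basis functions as elements of `L²`. -/
def toLp (k : ℕ) : Lp ℂ 2 μ := (B.memLp k).toLp (U k)

lemma coe_toLp (k : ℕ) : B.toLp k =ᵐ[μ] U k := (B.memLp k).coeFn_toLp

lemma toLp_mem (k : ℕ) : B.toLp k ∈ trueSpace Ω μ j := by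
  refine ⟨⟨U k, B.smooth k, B.poly k, B.coe_toLp k⟩, ?_⟩
  refine (Submodule.mem_orthogonal' _ _).2 ?_
  rintro f ⟨g, hg, hg0, hfg⟩
  rw [inner_Lp_eq (B.coe_toLp k) hfg]
  exact B.orth g hg ((memLp_congr_ae hfg).1 (Lp.memLp f)) hg0 k

lemma inner_off {k l : ℕ} (h : k ≠ l) : ⟪B.toLp k, B.toLp l⟫_ℂ = 0 := by
  rw [inner_Lp_eq (B.coe_toLp k) (B.coe_toLp l)]
  exact B.off k l h

lemma norm_low {ρ : ℝ} (hρ : ρ ∈ P) : ∃ c : ℝ, 0 < c ∧ ∀ k, c * ρ ^ k ≤ ‖B.toLp k‖ := by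
  obtain ⟨c, hc, h⟩ := B.low ρ hρ
  refine ⟨c, hc, fun k => ?_⟩
  have h1 : ‖⟪B.toLp k, B.toLp k⟫_ℂ‖ = ‖B.toLp k‖ ^ 2 := by
    rw [inner_self_eq_norm_sq_to_K]; simp
  rw [inner_Lp_eq (B.coe_toLp k) (B.coe_toLp k)] at h1
  refine le_of_sq_le_sq ?_ (norm_nonneg _)
  rw [← h1]
  exact h k

/-- Completeness puts `f` into the polyanalytic space of order `j`, to which `f` is orthogonal by
definition of the true space. So `f` is orthogonal to itself. -/
lemma eq_zero_of_orth {f : Lp ℂ 2 μ} (hf : f ∈ trueSpace Ω μ j)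
    (h : ∀ k, ⟪B.toLp k, f⟫_ℂ = 0) : f = 0 := by
  obtain ⟨⟨g, hg, hg0, hfg⟩, hf2⟩ := hf
  have h1 : f ∈ polySpace Ω μ j := by
    refine ⟨g, hg, B.complete g hg ((memLp_congr_ae hfg).1 (Lp.memLp f)) hg0 fun k => ?_, hfg⟩
    rw [← inner_Lp_eq (B.coe_toLp k) hfg]
    exact h k
  exact inner_self_eq_zero.1 ((Submodule.mem_orthogonal _ _).1 hf2 f h1)

lemma ne_zero (hP : P.Nonempty) (k : ℕ) : B.toLp k ≠ 0 := by
  obtain ⟨ρ, hρ⟩ := hP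
  obtain ⟨c, hc, h⟩ := B.norm_low hρ
  have := B.pos ρ hρ
  have h2 : 0 < c * ρ ^ k := by positivity
  exact norm_pos_iff.1 (h2.trans_le (h k))

/-- The closed span of the basis. -/
def closedSpan : Submodule ℂ (Lp ℂ 2 μ) :=
  (Submodule.span ℂ (Set.range B.toLp)).topologicalClosure

/-- The normalized functions are a Hilbert basis of their closed span. The expansion is made there
and not in the true space, whose closedness is only a consequence of `closedSpan_eq`. -/
lemma hasSum_of_mem_closedSpan (hP : P.Nonempty) {f : Lp ℂ 2 μ} (hf : f ∈ B.closedSpan) :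
    HasSum (fun k => (⟪B.toLp k, f⟫_ℂ / (‖B.toLp k‖ : ℂ) ^ 2) • B.toLp k) f := by
  set H := B.closedSpan with hH
  have hsub : ∀ k, B.toLp k ∈ H := fun k =>
    Submodule.le_topologicalClosure _ (Submodule.subset_span ⟨k, rfl⟩)
  have : CompleteSpace H := (Submodule.isClosed_topologicalClosure _).completeSpace_coe
  have hn : ∀ k, (‖B.toLp k‖ : ℂ) ≠ 0 := fun k =>
    ofReal_ne_zero.2 (norm_ne_zero_iff.2 (B.ne_zero hP k))
  set w : ℕ → H := fun k => (‖B.toLp k‖ : ℂ)⁻¹ • ⟨B.toLp k, hsub k⟩ with hw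
  have hwo : Orthonormal ℂ w := by
    constructor
    · intro k
      rw [hw]
      simp only [norm_smul, norm_inv, norm_real, norm_norm]
      exact inv_mul_cancel₀ (norm_ne_zero_iff.2 (B.ne_zero hP k))
    · intro k l hkl
      change ⟪(‖B.toLp k‖ : ℂ)⁻¹ • B.toLp k, (‖B.toLp l‖ : ℂ)⁻¹ • B.toLp l⟫_ℂ = 0
      rw [inner_smul_left, inner_smul_right, B.inner_off hkl]; ring
  have hbot : (Submodule.span ℂ (Set.range w))ᗮ = ⊥ := by
    rw [Submodule.eq_bot_iff]
    intro x hx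
    have hx0 : ∀ k, ⟪B.toLp k, (x : Lp ℂ 2 μ)⟫_ℂ = 0 := by
      intro k
      have h1 := (Submodule.mem_orthogonal _ _).1 hx (w k) (Submodule.subset_span ⟨k, rfl⟩)
      change ⟪(‖B.toLp k‖ : ℂ)⁻¹ • B.toLp k, (x : Lp ℂ 2 μ)⟫_ℂ = 0 at h1
      rw [inner_smul_left] at h1
      exact (mul_eq_zero.1 h1).resolve_left (by simpa using B.ne_zero hP k)
    have h2 : (x : Lp ℂ 2 μ) ∈ (ℂ ∙ (x : Lp ℂ 2 μ))ᗮ := by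
      have h3 : B.closedSpan ≤ (ℂ ∙ (x : Lp ℂ 2 μ))ᗮ := by
        refine Submodule.topologicalClosure_minimal _ ?_ (Submodule.isClosed_orthogonal _)
        rw [Submodule.span_le]
        rintro _ ⟨k, rfl⟩
        rw [SetLike.mem_coe, Submodule.mem_orthogonal_singleton_iff_inner_left]
        exact hx0 k
      exact h3 x.2
    rw [Submodule.mem_orthogonal_singleton_iff_inner_left] at h2
    exact Subtype.ext (inner_self_eq_zero.1 h2)
  have h1 := (HilbertBasis.mkOfOrthogonalEqBot hwo hbot).hasSum_repr ⟨f, hf⟩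
  have h2 := H.subtypeL.hasSum h1
  refine h2.congr_fun fun k => ?_
  rw [HilbertBasis.repr_apply_apply, HilbertBasis.coe_mkOfOrthogonalEqBot]
  change _ = ⟪(‖B.toLp k‖ : ℂ)⁻¹ • B.toLp k, f⟫_ℂ • ((‖B.toLp k‖ : ℂ)⁻¹ • B.toLp k)
  rw [inner_smul_left, smul_smul, map_inv₀, conj_ofReal]
  congr 1
  field_simp

/-- The point is that an `L²` limit of combinations of the `u_k` is again polyanalytic: its
orthogonal series also converges pointwise, to a polyanalytic function given by `synth`. This
replaces an argument with point evaluations or elliptic regularity. -/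
lemma closedSpan_eq (hP : P.Nonempty) : B.closedSpan = trueSpace Ω μ j := by
  have hle : B.closedSpan ≤ trueSpace Ω μ j := by
    intro f hf
    constructor
    · set b : ℕ → ℂ := fun k => ⟪B.toLp k, f⟫_ℂ / (‖B.toLp k‖ : ℂ) ^ 2 with hb
      have hs := B.hasSum_of_mem_closedSpan hP hf
      -- Cauchy–Schwarz gives `|b k| ≤ ‖f‖ / ‖u_k‖`, and `‖u_k‖ ≥ c ρ^k` turns this into the growth
      -- condition required by `synth`.
      obtain ⟨g, hg, hg0, hgs⟩ := B.synth b (by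
        intro ρ hρ
        obtain ⟨c, hc, h⟩ := B.norm_low hρ
        refine ⟨‖f‖ / c, fun k => ?_⟩
        have hn : 0 < ‖B.toLp k‖ := norm_pos_iff.2 (B.ne_zero hP k)
        have h1 : ‖b k‖ ≤ ‖f‖ / ‖B.toLp k‖ := by
          rw [hb]
          simp only [norm_div, norm_pow, norm_real, norm_norm]
          rw [div_le_div_iff₀ (by positivity) hn]
          nlinarith [norm_inner_le_norm (𝕜 := ℂ) (B.toLp k) f]
        have h2 := h k
        have := B.pos ρ hρ
        calc ‖b k‖ * ρ ^ k ≤ ‖f‖ / ‖B.toLp k‖ * ρ ^ k := by gcongr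
          _ ≤ ‖f‖ / ‖B.toLp k‖ * (‖B.toLp k‖ / c) := by
            gcongr
            rw [le_div_iff₀ hc, mul_comm]; exact h2
          _ = ‖f‖ / c := by field_simp)
      refine ⟨g, hg, hg0, ?_⟩
      have hseq := hs.tendsto_sum_nat
      -- A subsequence of the partial sums converges almost everywhere to `f`, whereas all partial
      -- sums converge pointwise to `g`.
      obtain ⟨φ, hφ, hae⟩ := (tendstoInMeasure_of_tendsto_Lp hseq).exists_seq_tendsto_ae
      have hcoe : ∀ n, ((∑ k ∈ Finset.range n, b k • B.toLp k : Lp ℂ 2 μ) : ℂ → ℂ) =ᵐ[μ]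
          fun z => ∑ k ∈ Finset.range n, b k * U k z := by
        intro n
        induction n with
        | zero => simp only [Finset.range_zero, Finset.sum_empty]; exact Lp.coeFn_zero ℂ 2 μ
        | succ n ih =>
          rw [Finset.sum_range_succ]
          filter_upwards [Lp.coeFn_add (∑ k ∈ Finset.range n, b k • B.toLp k) (b n • B.toLp n), ih,
            Lp.coeFn_smul (b n) (B.toLp n), B.coe_toLp n] with z h1 h2 h3 h4
          rw [h1, Pi.add_apply, h2, h3, Pi.smul_apply, h4, Finset.sum_range_succ, smul_eq_mul]
      filter_upwards [hae, ae_all_iff.2 hcoe, B.ae_mem] with z h1 h2 h3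
      have h4 := ((hgs z h3).tendsto_sum_nat).comp hφ.tendsto_atTop
      refine tendsto_nhds_unique h1 (h4.congr fun n => ?_)
      exact (h2 (φ n)).symm
    · have h3 : B.closedSpan ≤ (polySpace Ω μ j)ᗮ := by
        refine Submodule.topologicalClosure_minimal _ ?_ (Submodule.isClosed_orthogonal _)
        rw [Submodule.span_le]
        rintro _ ⟨k, rfl⟩
        exact (B.toLp_mem k).2
      exact h3 hf
  -- The residual of the projection onto the closed span lies in the true space and is orthogonal to
  -- all `u_k`, so it vanishes by `eq_zero_of_orth`.
  refine le_antisymm hle fun f hf => ?_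
  have : CompleteSpace B.closedSpan := (Submodule.isClosed_topologicalClosure _).completeSpace_coe
  set p : Lp ℂ 2 μ := B.closedSpan.starProjection f with hp
  have hpm : p ∈ B.closedSpan := Submodule.starProjection_apply_mem _ f
  have h1 : f - p = 0 := by
    refine B.eq_zero_of_orth (Submodule.sub_mem _ hf (hle hpm)) fun k => ?_
    have h2 : f - p ∈ B.closedSpanᗮ := Submodule.sub_starProjection_mem_orthogonal f
    exact (Submodule.mem_orthogonal _ _).1 h2 _
      (Submodule.le_topologicalClosure _ (Submodule.subset_span ⟨k, rfl⟩))
  rw [sub_eq_zero.1 h1]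
  exact hpm

theorem exists_toeplitz (B : PolyBasis Ω μ j P U) {a : ℕ → ℕ → ℂ}
    (ha : ∃ ρ ∈ P, ∃ C : ℝ, ∀ k l, ‖a k l‖ ≤ C * ρ ^ (k + l)) :
    ∃ T : trueSpace Ω μ j →L[ℂ] trueSpace Ω μ j,
      (∀ k l, ∃ u v : trueSpace Ω μ j, (u : Lp ℂ 2 μ) =ᵐ[μ] U k ∧ (v : Lp ℂ 2 μ) =ᵐ[μ] U l ∧
        a k l = ⟪v, T u⟫_ℂ) ∧ IsCompactOperator T ∧
      ∀ T' : trueSpace Ω μ j →L[ℂ] trueSpace Ω μ j,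
        (∀ k l, ∃ u v : trueSpace Ω μ j, (u : Lp ℂ 2 μ) =ᵐ[μ] U k ∧
          (v : Lp ℂ 2 μ) =ᵐ[μ] U l ∧ a k l = ⟪v, T' u⟫_ℂ) → T' = T := by
  obtain ⟨ρ, hρ, C, hC⟩ := ha
  have hP : P.Nonempty := ⟨ρ, hρ⟩
  have hV := B.closedSpan_eq hP
  have hcl : IsClosed (trueSpace Ω μ j : Set (Lp ℂ 2 μ)) := by
    rw [← hV]; exact Submodule.isClosed_topologicalClosure _
  have : CompleteSpace (trueSpace Ω μ j) := hcl.completeSpace_coe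
  set u : ℕ → trueSpace Ω μ j := fun k => ⟨B.toLp k, B.toLp_mem k⟩ with hu
  -- The class of `U k` in the true space is unique, so the existential quantifiers over `u` and `v`
  -- leave no freedom.
  have huniq : ∀ (v : trueSpace Ω μ j) k, (v : Lp ℂ 2 μ) =ᵐ[μ] U k → v = u k := fun v k hv =>
    Subtype.ext (Lp.ext (hv.trans (B.coe_toLp k).symm))
  have hd : Dense (Submodule.span ℂ (Set.range u) : Set (trueSpace Ω μ j)) := by
    intro x
    rw [closure_subtype]
    have h1 : (x : Lp ℂ 2 μ) ∈ B.closedSpan := by rw [hV]; exact x.2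
    have h2 : ((↑) '' (Submodule.span ℂ (Set.range u) : Set (trueSpace Ω μ j)) : Set (Lp ℂ 2 μ)) =
        Submodule.span ℂ (Set.range B.toLp) := by
      have := Submodule.map_span (trueSpace Ω μ j).subtype (Set.range u)
      rw [← Set.range_comp] at this
      exact congrArg (fun S : Submodule ℂ (Lp ℂ 2 μ) => (S : Set (Lp ℂ 2 μ))) this
    rw [h2]
    exact h1
  have hsum : Summable fun p : ℕ × ℕ => ‖a p.1 p.2‖ / (‖u p.1‖ * ‖u p.2‖) := by
    -- The matrix grows like `ρ^{k+l}` and the norms at least like `ρ'^k`; the strict gap makes the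
    -- quotients a double geometric series.
    obtain ⟨ρ', hρ', hlt⟩ := B.gap ρ hρ
    obtain ⟨c, hc, hlow⟩ := B.norm_low hρ'
    have h0 := B.pos ρ hρ
    have h0' := B.pos ρ' hρ'
    have hg : Summable fun k : ℕ => (ρ / ρ') ^ k :=
      summable_geometric_of_lt_one (by positivity) ((div_lt_one h0').2 hlt)
    have hg2 := (hg.mul_of_nonneg hg (fun _ => by positivity) fun _ => by positivity).mul_left
      (|C| / c ^ 2)
    refine Summable.of_nonneg_of_le (fun p => by positivity) (fun p => ?_) hg2
    have e : |C| / c ^ 2 * ((ρ / ρ') ^ p.1 * (ρ / ρ') ^ p.2) =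
        |C| * ρ ^ (p.1 + p.2) / ((c * ρ' ^ p.1) * (c * ρ' ^ p.2)) := by
      rw [div_pow, div_pow, pow_add]; field_simp
    rw [e]
    have e1 : ‖a p.1 p.2‖ ≤ |C| * ρ ^ (p.1 + p.2) :=
      (hC _ _).trans (mul_le_mul_of_nonneg_right (le_abs_self C) (by positivity))
    have e2 : c * ρ' ^ p.1 ≤ ‖u p.1‖ := hlow p.1
    have e3 : c * ρ' ^ p.2 ≤ ‖u p.2‖ := hlow p.2
    gcongr
  obtain ⟨T, hTc, hT, hTu⟩ := exists_compact_of_matrix hd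
    (fun k l hkl => B.inner_off hkl)
    (fun k hk => B.ne_zero hP k (congrArg Subtype.val hk)) hsum
  refine ⟨T, fun k l => ⟨u k, u l, B.coe_toLp k, B.coe_toLp l, (hT k l).symm⟩, hTc,
    fun T' hT' => hTu T' fun k l => ?_⟩
  obtain ⟨u', v', h1, h2, h3⟩ := hT' k l
  rw [h3, huniq u' k h1, huniq v' l h2]

end PolyBasis

end Poly

end

end PolyToeplitz


namespace PolyToeplitz

noncomputable section

/-! ### Holomorphic functions and radial weights -/

variable {U : Opens ℂ}

/-- In polar coordinates the weight is constant on each circle, and the circle averages of `k` equal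
`k 0 = 0`. -/
lemma integral_radial_mul_eq_zero {Φ k : ℂ → ℂ} {r : ℝ} (hΦ : ∀ z w : ℂ, ‖z‖ = ‖w‖ → Φ z = Φ w)
    (h0 : ∀ z : ℂ, r < ‖z‖ → Φ z = 0) (hr : Metric.closedBall 0 r ⊆ (U : Set ℂ))
    (hk : DifferentiableOn ℂ k U) (hk0 : k 0 = 0) : ∫ z, Φ z * k z = 0 := by
  rw [← Complex.integral_comp_polarCoord_symm]
  -- Integrability is needed only for Fubini; otherwise the integral is zero by convention.
  by_cases hi : IntegrableOn (fun p : ℝ × ℝ => p.1 • (Φ (Complex.polarCoord.symm p) *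
      k (Complex.polarCoord.symm p))) polarCoord.target
  swap
  · exact integral_undef hi
  rw [polarCoord_target, Measure.volume_eq_prod] at hi ⊢
  rw [setIntegral_prod _ hi]
  refine setIntegral_eq_zero_of_forall_eq_zero fun ρ hρ => ?_
  have hρ0 : 0 < ρ := hρ
  have hpol : ∀ θ : ℝ, Complex.polarCoord.symm (ρ, θ) = circleMap 0 ρ θ := by
    intro θ
    rw [Complex.polarCoord_symm_apply, circleMap, zero_add, exp_mul_I]
    simp
  have hΦc : ∀ θ : ℝ, Φ (circleMap 0 ρ θ) = Φ ρ := fun θ => hΦ _ _ (by simp)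
  simp only [hpol, hΦc]
  rcases lt_or_ge r ρ with h | h
  · rw [h0 ρ (by simpa [abs_of_pos hρ0] using h)]; simp
  have hb : Metric.closedBall (0 : ℂ) |ρ| ⊆ (U : Set ℂ) :=
    (Metric.closedBall_subset_closedBall (by rwa [abs_of_pos hρ0])).trans hr
  have hmean : Real.circleAverage k 0 ρ = 0 := by
    rw [DiffContOnCl.circleAverage, hk0]
    refine ⟨hk.mono (Metric.ball_subset_closedBall.trans hb), hk.continuousOn.mono ?_⟩
    exact Metric.closure_ball_subset_closedBall.trans hb
  -- The average over `[0, 2π]` is shifted to `(-π, π)`, the range of the angle in the polar chart.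
  rw [Real.circleAverage_eq_integral_add (-Real.pi)] at hmean
  have h2 := (smul_eq_zero.1 hmean).resolve_left (by positivity)
  rw [intervalIntegral.integral_comp_add_right (fun θ => k (circleMap 0 ρ θ)),
    intervalIntegral.integral_of_le (by linarith [Real.pi_pos]),
    integral_Ioc_eq_integral_Ioo] at h2
  have e : ∀ θ : ℝ, ρ • (Φ ρ * k (circleMap 0 ρ θ)) = ρ * Φ ρ * k (circleMap 0 ρ θ) := by
    intro θ; rw [real_smul]; ring
  simp only [e]
  rw [integral_const_mul]
  have e2 : (2 * Real.pi + -Real.pi) = Real.pi := by ring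
  rw [zero_add, e2] at h2
  rw [h2, mul_zero]

lemma integral_radial_mul {Φ g : ℂ → ℂ} {r : ℝ} (hΦ : ∀ z w : ℂ, ‖z‖ = ‖w‖ → Φ z = Φ w)
    (hc : Continuous Φ)
    (h0 : ∀ z : ℂ, r < ‖z‖ → Φ z = 0) (hr : Metric.closedBall 0 r ⊆ (U : Set ℂ))
    (hg : DifferentiableOn ℂ g U) : ∫ z in U, Φ z * g z = g 0 * ∫ z in U, Φ z := by
  have hz : ∀ z : ℂ, z ∉ Metric.closedBall (0 : ℂ) r → Φ z = 0 := fun z hz =>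
    h0 z (by simpa using hz)
  have hout : ∀ k : ℂ → ℂ, ∫ z in U, Φ z * k z = ∫ z, Φ z * k z := fun k =>
    setIntegral_eq_integral_of_forall_compl_eq_zero fun z hzU => by
      rw [hz z fun h => hzU (hr h), zero_mul]
  have hi : ∀ k : ℂ → ℂ, ContinuousOn k U → Integrable fun z => Φ z * k z := by
    intro k hk
    have h1 : IntegrableOn (fun z => Φ z * k z) (Metric.closedBall 0 r) :=
      ((hc.continuousOn).mul (hk.mono hr)).integrableOn_compact (isCompact_closedBall _ _)
    refine (integrableOn_iff_integrable_of_support_subset fun z hzs => ?_).1 h1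
    by_contra hcon
    exact hzs (by beta_reduce; rw [hz z hcon, zero_mul])
  have h1 := integral_radial_mul_eq_zero (k := fun z => g z - g 0) hΦ h0 hr
    (hg.sub (differentiableOn_const _)) (sub_self _)
  have h2 := hout fun _ => 1
  simp only [mul_one] at h2
  rw [hout, h2]
  have h3 := integral_sub (hi g hg.continuousOn) (hi (fun _ => g 0) continuousOn_const)
  simp only [← mul_sub] at h3
  rw [h1, integral_mul_const] at h3
  linear_combination -h3

/-- A holomorphic function whose moments with respect to an exhausting family of radial weights
tend to zero vanishes. -/
lemma eq_zero_of_tendsto_moments {H : ℂ → ℂ} (hH : DifferentiableOn ℂ H U)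
    (hU : IsPreconnected (U : Set ℂ)) (h0U : (0 : ℂ) ∈ U) {Φ : ℝ → ℂ → ℂ}
    (hΦ : ∀ t, ∀ z w : ℂ, ‖z‖ = ‖w‖ → Φ t z = Φ t w) (hc : ∀ t, Continuous (Φ t))
    (hs : ∀ t, ∃ r : ℝ, Metric.closedBall 0 r ⊆ (U : Set ℂ) ∧ ∀ z : ℂ, r < ‖z‖ → Φ t z = 0)
    (hlow : ∀ m : ℕ, ∃ c : ℝ, 0 < c ∧
      ∀ᶠ t in atTop, c ≤ ‖∫ z in U, Φ t z * (‖z‖ : ℂ) ^ (2 * m)‖)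
    (hlim : ∀ m : ℕ, Tendsto (fun t => ∫ z in U, Φ t z * (H z * conj z ^ m)) atTop (𝓝 0)) :
    ∀ z ∈ U, H z = 0 := by
  -- The zero at the origin is shown to have arbitrarily high order. If `H = z^m g`, then `H z̄^m =
  -- |z|^{2m} g`, and the mean value property reduces the `m`-th moment to `g 0` times a moment of
  -- the weight that stays away from zero. Hence `g 0 = 0`, and one more factor `z` splits off.
  have key : ∀ m : ℕ, ∃ g : ℂ → ℂ, DifferentiableOn ℂ g U ∧ ∀ z, z ∈ U → H z = z ^ m * g z := by
    intro m
    induction m with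
    | zero => exact ⟨H, hH, fun z _ => by simp⟩
    | succ m ih =>
      obtain ⟨g, hg, hHg⟩ := ih
      obtain ⟨c, hc0, hcl⟩ := hlow m
      have e : ∀ t, ∫ z in U, Φ t z * (H z * conj z ^ m) =
          g 0 * ∫ z in U, Φ t z * (‖z‖ : ℂ) ^ (2 * m) := by
        intro t
        obtain ⟨r, hr, hr0⟩ := hs t
        rw [← integral_radial_mul (Φ := fun z => Φ t z * (‖z‖ : ℂ) ^ (2 * m))
          (fun z w hzw => by rw [hΦ t z w hzw, hzw])
          ((hc t).mul (by fun_prop)) (fun z hz => by rw [hr0 z hz, zero_mul]) hr hg]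
        refine setIntegral_congr_fun U.isOpen.measurableSet fun z hz => ?_
        rw [hHg z hz, pow_mul, ← mul_conj']
        ring
      have hg0 : g 0 = 0 := by
        by_contra hne
        have h1 := (hlim m).norm
        simp only [e, norm_mul, norm_zero] at h1
        have h2 : ∀ᶠ t in atTop, ‖g 0‖ * c ≤
            ‖g 0‖ * ‖∫ z in U, Φ t z * (‖z‖ : ℂ) ^ (2 * m)‖ := by
          filter_upwards [hcl] with t ht
          exact mul_le_mul_of_nonneg_left ht (norm_nonneg _)
        have h3 := ge_of_tendsto h1 h2
        have : 0 < ‖g 0‖ * c := mul_pos (norm_pos_iff.2 hne) hc0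
        linarith
      refine ⟨dslope g 0, (differentiableOn_dslope (U.isOpen.mem_nhds h0U)).2 hg, fun z hz => ?_⟩
      have h4 := sub_smul_dslope g 0 z
      rw [hg0, sub_zero, sub_zero, smul_eq_mul] at h4
      rw [hHg z hz, ← h4]; ring
  have hA : AnalyticOnNhd ℂ H U := hH.analyticOnNhd U.isOpen
  -- A zero of infinite order and connectedness force `H = 0`.
  have htop : analyticOrderAt H 0 = ⊤ := by
    rw [ENat.eq_top_iff_forall_ge]
    intro m
    rw [natCast_le_analyticOrderAt (hA 0 h0U)]
    obtain ⟨g, hg, hHg⟩ := key m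
    refine ⟨g, hg.analyticAt (U.isOpen.mem_nhds h0U), ?_⟩
    filter_upwards [U.isOpen.mem_nhds h0U] with z hz
    rw [hHg z hz, sub_zero, smul_eq_mul]
  intro z hz
  exact hA.eqOn_zero_of_preconnected_of_eventuallyEq_zero hU h0U
    (analyticOrderAt_eq_top.1 htop) hz

/-- Orthogonality of monomials for a radial weight. -/
lemma integral_radial_monomial {Φ : ℂ → ℂ} (hΦ : ∀ z w : ℂ, ‖z‖ = ‖w‖ → Φ z = Φ w) {k l : ℕ}
    (hkl : k ≠ l) : ∫ z, Φ z * (z ^ k * conj z ^ l) = 0 := by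
  -- Rotation by one radian multiplies the integral by `e^{i(k - l)}`. This factor is not `1` for `k
  -- ≠ l` because `π` is irrational.
  set a : Circle := Circle.exp 1 with ha
  have h1 := (rotation a).measurePreserving.integral_comp
    (rotation a).toHomeomorph.measurableEmbedding fun z : ℂ => Φ z * (z ^ k * conj z ^ l)
  have h2 : ∀ z : ℂ, Φ (rotation a z) * ((rotation a z) ^ k * conj (rotation a z) ^ l) =
      ((a : ℂ) ^ k * conj (a : ℂ) ^ l) * (Φ z * (z ^ k * conj z ^ l)) := by
    intro z
    rw [hΦ (rotation a z) z ((rotation a).norm_map z), rotation_apply, map_mul]; ring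
  simp only [h2] at h1
  rw [integral_const_mul] at h1
  have h3 : (a : ℂ) ^ k * conj (a : ℂ) ^ l = Complex.exp (((k : ℝ) - (l : ℝ) : ℝ) * I) := by
    rw [ha, Circle.coe_exp, ← exp_conj, ← exp_nat_mul, ← exp_nat_mul, ← exp_add]
    congr 1
    simp; ring
  by_contra hne
  have h4 : Complex.exp (((k : ℝ) - (l : ℝ) : ℝ) * I) = 1 := by
    rw [← h3]
    exact mul_right_cancel₀ hne (by rw [h1, one_mul])
  rw [Complex.exp_eq_one_iff] at h4
  obtain ⟨n, hn⟩ := h4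
  have h5 : ((k : ℝ) - l) = n * (2 * Real.pi) := by
    have := congrArg im hn
    simpa using this
  have hirr := irrational_pi
  have hn0 : n ≠ 0 := by
    rintro rfl
    simp only [Int.cast_zero, zero_mul, sub_eq_zero, Nat.cast_inj] at h5
    exact hkl h5
  apply hirr
  refine ⟨((k : ℚ) - l) / (2 * n), ?_⟩
  push_cast
  rw [h5]
  have : (n : ℝ) ≠ 0 := Int.cast_ne_zero.2 hn0
  field_simp

end

end PolyToeplitz


namespace PolyToeplitz

noncomputable section

/-! ### Polyanalytic functions -/

/-- `g` is smooth and `n`-polyanalytic on `Ω`. -/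
def PA (Ω : Opens ℂ) (n : ℕ) (g : ℂ → ℂ) : Prop :=
  ContDiffOn ℝ ∞ g Ω ∧ ∀ z ∈ Ω, (wd I)^[n] g z = 0

variable {Ω : Opens ℂ} {n : ℕ} {f g α β : ℂ → ℂ}

lemma wd_iter_zero (c : ℂ) (n : ℕ) : (wd c)^[n] (fun _ => (0 : ℂ)) = fun _ => 0 := by
  induction n with
  | zero => rfl
  | succ n ih =>
    rw [Function.iterate_succ_apply]
    have : wd c (fun _ => (0 : ℂ)) = fun _ => 0 := by funext z; simp
    rw [this, ih]

lemma PA.congr (h : PA Ω n f) (e : Set.EqOn g f Ω) : PA Ω n g :=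
  ⟨h.1.congr e, fun z hz => (wd_iter_congr n e hz).trans (h.2 z hz)⟩

lemma PA.mono {m : ℕ} (h : PA Ω n f) (hm : n ≤ m) : PA Ω m f := by
  refine ⟨h.1, fun z hz => ?_⟩
  obtain ⟨k, rfl⟩ := Nat.exists_eq_add_of_le hm
  rw [add_comm, Function.iterate_add_apply,
    wd_iter_congr k (g := fun _ => 0) (fun w hw => h.2 w hw) hz, wd_iter_zero]

lemma PA.of_holo (h : DifferentiableOn ℂ f Ω) : PA Ω 1 f :=
  ⟨holo_contDiffOn h, fun z hz => dzbar_holo ((h z hz).differentiableAt (Ω.isOpen.mem_nhds hz))⟩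

lemma PA.add (hf : PA Ω n f) (hg : PA Ω n g) : PA Ω n fun z => f z + g z := by
  refine ⟨hf.1.add hg.1, fun z hz => ?_⟩
  rw [wd_iter_add n hf.1 hg.1 hz, hf.2 z hz, hg.2 z hz, add_zero]

lemma PA.holo_mul (hα : DifferentiableOn ℂ α Ω) (hf : PA Ω n f) :
    PA Ω n fun z => α z * f z := by
  refine ⟨(holo_contDiffOn hα).mul hf.1, fun z hz => ?_⟩
  rw [wd_iter_mul_left n (holo_contDiffOn hα)
    (fun w hw => dzbar_holo ((hα w hw).differentiableAt (Ω.isOpen.mem_nhds hw))) hf.1 hz,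
    hf.2 z hz, mul_zero]

lemma PA.sum {ι : Type*} (s : Finset ι) (F : ι → ℂ → ℂ) (h : ∀ i ∈ s, PA Ω n (F i)) :
    PA Ω n fun z => ∑ i ∈ s, F i z := by
  refine ⟨ContDiffOn.sum fun i hi => (h i hi).1, fun z hz => ?_⟩
  rw [wd_iter_sum n s F (fun i hi => (h i hi).1) hz]
  exact Finset.sum_eq_zero fun i hi => (h i hi).2 z hz

lemma contDiff_conj : ContDiff ℝ ∞ fun z : ℂ => conj z := conjCLE.contDiff

lemma wd_conj_id (c z : ℂ) : wd c (fun w => conj w) z = (1 - c * I) / 2 := by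
  have h : HasFDerivAt (fun w : ℂ => conj w) (conjCLE : ℂ →L[ℝ] ℂ) z := conjCLE.hasFDerivAt
  simp [wd, h.fderiv]; ring

/-- `∂̄((α + β z̄) f) = (α + β z̄) ∂̄f + β f`: the first term is handled by induction and the second
has the order of `f`. -/
lemma PA.lin_mul (hα : DifferentiableOn ℂ α Ω) (hβ : DifferentiableOn ℂ β Ω) :
    ∀ {n : ℕ} {f : ℂ → ℂ}, PA Ω n f → PA Ω (n + 1) fun z => (α z + β z * conj z) * f z := by
  intro n
  have hq : ContDiffOn ℝ ∞ (fun z => α z + β z * conj z) Ω :=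
    (holo_contDiffOn hα).add ((holo_contDiffOn hβ).mul contDiff_conj.contDiffOn)
  induction n with
  | zero =>
    intro f hf
    exact (PA.congr (f := fun _ => 0) (n := 0) ⟨contDiffOn_const, fun _ _ => rfl⟩ fun z hz => by
      have := hf.2 z hz
      simp at this; simp [this]).mono (Nat.zero_le _)
  | succ n ih =>
    intro f hf
    have h1 : PA Ω n (wd I f) := ⟨wd_contDiffOn hf.1, hf.2⟩
    have h2 := (ih h1).add (PA.holo_mul hβ hf)
    refine ⟨hq.mul hf.1, fun z hz => ?_⟩
    rw [Function.iterate_succ_apply]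
    refine (h2.congr fun w hw => ?_).2 z hz
    have hα' := (hα w hw).differentiableAt (Ω.isOpen.mem_nhds hw)
    have hβ' := (hβ w hw).differentiableAt (Ω.isOpen.mem_nhds hw)
    have hc := (contDiff_conj.differentiable (by simp)) w
    rw [wd_mul_at (diffAt_of_contDiffOn hq hw) (diffAt_of_contDiffOn hf.1 hw),
      wd_add_at (hα'.restrictScalars ℝ) ((hβ'.restrictScalars ℝ).fun_mul hc),
      wd_mul_at (hβ'.restrictScalars ℝ) hc, dzbar_holo hα', dzbar_holo hβ', wd_conj_id]
    rw [I_mul_I]; ring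

lemma PA.lin_pow_mul (hα : DifferentiableOn ℂ α Ω) (hβ : DifferentiableOn ℂ β Ω)
    (hf : PA Ω n f) (m : ℕ) : PA Ω (n + m) fun z => (α z + β z * conj z) ^ m * f z := by
  induction m with
  | zero => simpa using hf
  | succ m ih =>
    exact (PA.lin_mul hα hβ ih).congr fun z _ => by beta_reduce; ring

/-! ### Series of holomorphic functions -/

lemma deriv_iter_sum {ι : Type*} (s : Finset ι) (b : ι → ℂ) (e : ι → ℂ → ℂ)
    (he : ∀ i, DifferentiableOn ℂ (e i) Ω) (a : ℕ) {z : ℂ} (hz : z ∈ Ω) :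
    deriv^[a] (fun w => ∑ i ∈ s, b i * e i w) z = ∑ i ∈ s, b i * deriv^[a] (e i) z := by
  have h : ∀ i, DifferentiableOn ℂ (fun w => b i * e i w) Ω := fun i => (he i).const_mul _
  rw [← dz_iter_holo a (DifferentiableOn.fun_sum fun i _ => h i) hz,
    wd_iter_sum a s _ (fun i _ => holo_contDiffOn (h i)) hz]
  refine Finset.sum_congr rfl fun i _ => ?_
  rw [wd_iter_const_mul, dz_iter_holo a (he i) hz]

/-- On a compact set `|ψ| ≤ ρ`, and the coefficient bound at a larger `ρ'` gives a geometric
majorant. Locally uniform convergence of holomorphic functions passes to all derivatives by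
Weierstrass's theorem. -/
lemma exists_hasSum_iter_deriv {P : Set ℝ} (hpos : ∀ ρ ∈ P, 0 < ρ)
    (hgap : ∀ ρ ∈ P, ∃ ρ' ∈ P, ρ < ρ') {w ψ : ℂ → ℂ} (hw : DifferentiableOn ℂ w Ω)
    (hψ : DifferentiableOn ℂ ψ Ω)
    (hK : ∀ K : Set ℂ, IsCompact K → K ⊆ Ω → ∃ ρ ∈ P, ∀ z ∈ K, ‖ψ z‖ ≤ ρ)
    (b : ℕ → ℂ) (hb : ∀ ρ ∈ P, ∃ C : ℝ, ∀ k, ‖b k‖ * ρ ^ k ≤ C) :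
    ∃ h : ℂ → ℂ, DifferentiableOn ℂ h Ω ∧ ∀ a : ℕ, ∀ z ∈ Ω,
      HasSum (fun k => b k * deriv^[a] (fun w' => w w' * ψ w' ^ k) z) (deriv^[a] h z) := by
  set e : ℕ → ℂ → ℂ := fun k z => w z * ψ z ^ k with he
  have hhe : ∀ k, DifferentiableOn ℂ (e k) Ω := fun k => hw.mul (hψ.pow k)
  set F : Finset ℕ → ℂ → ℂ := fun t z => ∑ k ∈ t, b k * e k z with hF
  have hFd : ∀ t, DifferentiableOn ℂ (F t) Ω := fun t =>
    DifferentiableOn.fun_sum fun k _ => (hhe k).const_mul _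
  set h : ℂ → ℂ := fun z => ∑' k, b k * e k z with hh
  have h0 : TendstoLocallyUniformlyOn F h atTop Ω := by
    rw [tendstoLocallyUniformlyOn_iff_forall_isCompact Ω.isOpen]
    intro K hKΩ hKc
    obtain ⟨ρ, hρ, hρK⟩ := hK K hKc hKΩ
    obtain ⟨ρ', hρ', hlt⟩ := hgap ρ hρ
    obtain ⟨C, hC⟩ := hb ρ' hρ'
    obtain ⟨D, hD⟩ := hKc.exists_bound_of_continuousOn (hw.continuousOn.mono hKΩ)
    have h0ρ := hpos ρ hρ
    have h0ρ' := hpos ρ' hρ'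
    have hC0 : 0 ≤ C := le_trans (by positivity) (hC 0)
    refine tendstoUniformlyOn_tsum (u := fun k => C * |D| * (ρ / ρ') ^ k)
      ((summable_geometric_of_lt_one (by positivity) ((div_lt_one h0ρ').2 hlt)).mul_left _) ?_
    intro k z hz
    rw [norm_mul, norm_mul, norm_pow]
    have h1 : ‖b k‖ ≤ C / ρ' ^ k := by rw [le_div_iff₀ (by positivity)]; exact hC k
    calc ‖b k‖ * (‖w z‖ * ‖ψ z‖ ^ k) ≤ C / ρ' ^ k * (|D| * ρ ^ k) := by
          gcongr
          · exact (hD z hz).trans (le_abs_self _)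
          · exact hρK z hz
      _ = _ := by rw [div_pow]; field_simp
  have hdiff : DifferentiableOn ℂ h Ω := h0.differentiableOn (.of_forall hFd) Ω.isOpen
  have hiter : ∀ a : ℕ, TendstoLocallyUniformlyOn (fun t => deriv^[a] (F t)) (deriv^[a] h)
      atTop Ω := by
    intro a
    induction a with
    | zero => exact h0
    | succ a ih =>
      simp only [Function.iterate_succ_apply']
      exact ih.deriv (.of_forall fun t => holo_iter_deriv a (hFd t)) Ω.isOpen
  refine ⟨h, hdiff, fun a z hz => ?_⟩
  have := (hiter a).tendsto_at hz
  refine this.congr fun t => ?_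
  exact deriv_iter_sum t b e hhe a hz

/-! ### Operators from holomorphic to polyanalytic functions -/

/-- The differential operator `∑_{a ≤ j} c_a ∂^a` on holomorphic functions. -/
def holoOp (j : ℕ) (c : ℕ → ℂ → ℂ) (f : ℂ → ℂ) (z : ℂ) : ℂ :=
  ∑ a ∈ Finset.range (j + 1), c a z * deriv^[a] f z

lemma holoOp_contDiffOn {j : ℕ} {c : ℕ → ℂ → ℂ} (hc : ∀ a, ContDiff ℝ ∞ (c a))
    (hf : DifferentiableOn ℂ f Ω) : ContDiffOn ℝ ∞ (holoOp j c f) Ω :=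
  ContDiffOn.sum fun a _ => (hc a).contDiffOn.mul (holo_contDiffOn (holo_iter_deriv a hf))

/-- The coefficients `c_a` map holomorphic functions to `j + 1`-polyanalytic functions. -/
def PACoeff (Ω : Opens ℂ) (j : ℕ) (c : ℕ → ℂ → ℂ) : Prop :=
  ∀ a ≤ j, ∀ f : ℂ → ℂ, DifferentiableOn ℂ f Ω → PA Ω (j + 1) fun z => c a z * f z

lemma PACoeff.holoOp {j : ℕ} {c : ℕ → ℂ → ℂ} (hc : PACoeff Ω j c)
    (hf : DifferentiableOn ℂ f Ω) : PA Ω (j + 1) (holoOp j c f) :=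
  PA.sum _ _ fun a ha => hc a (by simpa [Nat.lt_succ_iff] using ha) _ (holo_iter_deriv a hf)

/-- The limit is `S h` with `h = ∑ b_k w ψ^k`; convergence of the derivatives allows `S` to be
applied term by term. -/
lemma PACoeff.synth {j : ℕ} {c : ℕ → ℂ → ℂ} (hc : PACoeff Ω j c)
    {P : Set ℝ} (hpos : ∀ ρ ∈ P, 0 < ρ)
    (hgap : ∀ ρ ∈ P, ∃ ρ' ∈ P, ρ < ρ') {w ψ : ℂ → ℂ} (hw : DifferentiableOn ℂ w Ω)
    (hψ : DifferentiableOn ℂ ψ Ω)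
    (hK : ∀ K : Set ℂ, IsCompact K → K ⊆ Ω → ∃ ρ ∈ P, ∀ z ∈ K, ‖ψ z‖ ≤ ρ)
    (b : ℕ → ℂ) (hb : ∀ ρ ∈ P, ∃ C : ℝ, ∀ k, ‖b k‖ * ρ ^ k ≤ C) :
    ∃ g, PA Ω (j + 1) g ∧ ∀ z ∈ Ω,
      HasSum (fun k => b k * PolyToeplitz.holoOp j c (fun w' => w w' * ψ w' ^ k) z) (g z) := by
  obtain ⟨h, hh, hs⟩ := exists_hasSum_iter_deriv hpos hgap hw hψ hK b hb
  refine ⟨_, hc.holoOp hh, fun z hz => ?_⟩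
  unfold PolyToeplitz.holoOp
  simp only [Finset.mul_sum]
  refine hasSum_sum fun a _ => ?_
  have e := (hs a z hz).mul_left (c a z)
  simpa only [mul_left_comm] using e

end

end PolyToeplitz


namespace PolyToeplitz

noncomputable section

/-! ### Derivatives of powers -/

variable {Ω : Opens ℂ}

/-- The norm of the scaled jet of order `n` of `f` at `x`. -/
def jetNorm (n : ℕ) (ε : ℝ) (f : ℂ → ℂ) (x : ℂ) : ℝ :=
  ∑ i ∈ Finset.range (n + 1), ε ^ i / i.factorial * ‖iteratedFDeriv ℝ i f x‖

lemma jetNorm_nonneg {n : ℕ} {ε : ℝ} (hε : 0 ≤ ε) (f : ℂ → ℂ) (x : ℂ) : 0 ≤ jetNorm n ε f x :=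
  Finset.sum_nonneg fun _ _ => by positivity

lemma le_jetNorm {n : ℕ} {ε : ℝ} (hε : 0 < ε) (f : ℂ → ℂ) (x : ℂ) {i : ℕ} (hi : i ≤ n) :
    ‖iteratedFDeriv ℝ i f x‖ ≤ i.factorial / ε ^ i * jetNorm n ε f x := by
  have h := Finset.single_le_sum (f := fun i => ε ^ i / i.factorial * ‖iteratedFDeriv ℝ i f x‖)
    (fun _ _ => by positivity) (Finset.mem_range.2 (Nat.lt_succ_of_le hi))
  calc ‖iteratedFDeriv ℝ i f x‖
      = i.factorial / ε ^ i * (ε ^ i / i.factorial * ‖iteratedFDeriv ℝ i f x‖) := by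
        have := Nat.factorial_ne_zero i
        field_simp
    _ ≤ _ := by gcongr; exact h

lemma norm_iteratedFDeriv_mul_le_on {f g : ℂ → ℂ} (hf : ContDiffOn ℝ ∞ f Ω)
    (hg : ContDiffOn ℝ ∞ g Ω) {x : ℂ} (hx : x ∈ Ω) (i : ℕ) :
    ‖iteratedFDeriv ℝ i (fun z => f z * g z) x‖ ≤ ∑ p ∈ Finset.range (i + 1),
      (i.choose p : ℝ) * ‖iteratedFDeriv ℝ p f x‖ * ‖iteratedFDeriv ℝ (i - p) g x‖ := by
  have h := norm_iteratedFDerivWithin_mul_le hf hg Ω.isOpen.uniqueDiffOn hx (n := i)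
    (by exact_mod_cast le_top)
  simpa only [iteratedFDerivWithin_of_isOpen _ Ω.isOpen hx] using h

/-- The weights `ε^i / i!` absorb the binomial coefficients of the Leibniz rule, which becomes a
Cauchy product. The truncated jet norm is therefore submultiplicative with constant one, so no
constant is raised to the power `k` in the estimate of `f^k`. -/
lemma jetNorm_mul_le {n : ℕ} {ε : ℝ} (hε : 0 ≤ ε) {f g : ℂ → ℂ} (hf : ContDiffOn ℝ ∞ f Ω)
    (hg : ContDiffOn ℝ ∞ g Ω) {x : ℂ} (hx : x ∈ Ω) :
    jetNorm n ε (fun z => f z * g z) x ≤ jetNorm n ε f x * jetNorm n ε g x := by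
  set u : ℕ → ℝ := fun i => ε ^ i / i.factorial * ‖iteratedFDeriv ℝ i f x‖
  set v : ℕ → ℝ := fun i => ε ^ i / i.factorial * ‖iteratedFDeriv ℝ i g x‖
  have hu : ∀ i, 0 ≤ u i := fun i => by positivity
  have hv : ∀ i, 0 ≤ v i := fun i => by positivity
  have h1 : ∀ i, ε ^ i / i.factorial * ‖iteratedFDeriv ℝ i (fun z => f z * g z) x‖ ≤
      ∑ p ∈ Finset.range (i + 1), u p * v (i - p) := by
    intro i
    calc _ ≤ ε ^ i / i.factorial * ∑ p ∈ Finset.range (i + 1),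
          (i.choose p : ℝ) * ‖iteratedFDeriv ℝ p f x‖ * ‖iteratedFDeriv ℝ (i - p) g x‖ := by
          gcongr; exact norm_iteratedFDeriv_mul_le_on hf hg hx i
      _ = _ := by
          rw [Finset.mul_sum]
          refine Finset.sum_congr rfl fun p hp => ?_
          have hp' : p ≤ i := by simpa [Nat.lt_succ_iff] using hp
          have e1 : ε ^ i = ε ^ p * ε ^ (i - p) := by rw [← pow_add, Nat.add_sub_cancel' hp']
          have e2 : (i.factorial : ℝ) = i.choose p * p.factorial * (i - p).factorial := by
            exact_mod_cast (Nat.choose_mul_factorial_mul_factorial hp').symm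
          have h3 : (i.choose p : ℝ) ≠ 0 := by exact_mod_cast (Nat.choose_pos hp').ne'
          have h4 := Nat.factorial_ne_zero p
          have h5 := Nat.factorial_ne_zero (i - p)
          simp only [u, v]
          rw [e1, e2]
          field_simp
  calc jetNorm n ε (fun z => f z * g z) x
      ≤ ∑ i ∈ Finset.range (n + 1), ∑ p ∈ Finset.range (i + 1), u p * v (i - p) :=
        Finset.sum_le_sum fun i _ => h1 i
    _ = ∑ i ∈ Finset.range (n + 1), ∑ q ∈ Finset.HasAntidiagonal.antidiagonal i, u q.1 * v q.2 := by
        refine Finset.sum_congr rfl fun i _ => ?_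
        rw [Finset.Nat.sum_antidiagonal_eq_sum_range_succ (fun a b => u a * v b)]
    _ = ∑ q ∈ (Finset.range (n + 1)).biUnion Finset.HasAntidiagonal.antidiagonal, u q.1 * v q.2 := by
        rw [Finset.sum_biUnion]
        intro i _ k _ hik
        rw [Function.onFun, Finset.disjoint_left]
        intro q hq hq'
        exact hik ((Finset.HasAntidiagonal.mem_antidiagonal.1 hq).symm.trans (Finset.HasAntidiagonal.mem_antidiagonal.1 hq'))
    _ ≤ ∑ q ∈ Finset.range (n + 1) ×ˢ Finset.range (n + 1), u q.1 * v q.2 := by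
        refine Finset.sum_le_sum_of_subset_of_nonneg ?_ fun q _ _ => mul_nonneg (hu _) (hv _)
        intro q hq
        simp only [Finset.mem_biUnion, Finset.mem_range, Finset.HasAntidiagonal.mem_antidiagonal,
          Finset.mem_product] at hq ⊢
        omega
    _ = jetNorm n ε f x * jetNorm n ε g x := by
        rw [Finset.sum_product, jetNorm, jetNorm, Finset.sum_mul_sum]

lemma jetNorm_pow_le {n : ℕ} {ε : ℝ} (hε : 0 ≤ ε) {f : ℂ → ℂ} (hf : ContDiffOn ℝ ∞ f Ω)
    {x : ℂ} (hx : x ∈ Ω) {ρ : ℝ} (hρ : jetNorm n ε f x ≤ ρ) (k : ℕ) {g : ℂ → ℂ}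
    (hg : ContDiffOn ℝ ∞ g Ω) :
    jetNorm n ε (fun z => f z ^ k * g z) x ≤ ρ ^ k * jetNorm n ε g x := by
  induction k with
  | zero => simp
  | succ k ih =>
    have e : (fun z => f z ^ (k + 1) * g z) = fun z => f z * (f z ^ k * g z) := by
      funext z; ring
    have h0 := jetNorm_nonneg (n := n) hε f x
    rw [e]
    calc _ ≤ jetNorm n ε f x * jetNorm n ε (fun z => f z ^ k * g z) x :=
          jetNorm_mul_le hε hf ((hf.pow k).mul hg) hx
      _ ≤ ρ * (ρ ^ k * jetNorm n ε g x) :=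
          mul_le_mul hρ ih (jetNorm_nonneg hε _ _) (h0.trans hρ)
      _ = _ := by ring

lemma exists_bound_iteratedFDeriv {f : ℂ → ℂ} (hf : ContDiffOn ℝ ∞ f Ω) {L : Set ℂ}
    (hL : IsCompact L) (hLΩ : L ⊆ Ω) (n : ℕ) :
    ∃ M : ℝ, 0 ≤ M ∧ ∀ i ≤ n, ∀ x ∈ L, ‖iteratedFDeriv ℝ i f x‖ ≤ M := by
  have h : ∀ i : ℕ, ∃ M : ℝ, 0 ≤ M ∧ ∀ x ∈ L, ‖iteratedFDeriv ℝ i f x‖ ≤ M := by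
    intro i
    have h1 : ContinuousOn (iteratedFDeriv ℝ i f) Ω :=
      (hf.continuousOn_iteratedFDerivWithin (m := i) (by exact_mod_cast le_top)
        Ω.isOpen.uniqueDiffOn).congr fun x hx =>
          (iteratedFDerivWithin_of_isOpen i Ω.isOpen hx).symm
    obtain ⟨M, hM⟩ := hL.exists_bound_of_continuousOn (h1.mono hLΩ)
    exact ⟨max M 0, le_max_right _ _, fun x hx => (hM x hx).trans (le_max_left _ _)⟩
  choose M h0 hM using h
  refine ⟨∑ i ∈ Finset.range (n + 1), M i, Finset.sum_nonneg fun i _ => h0 i, fun i hi x hx =>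
    (hM i x hx).trans (Finset.single_le_sum (fun i _ => h0 i)
      (Finset.mem_range.2 (Nat.lt_succ_of_le hi)))⟩

/-- The term of order zero is at most `ρ₀` and the others are `O(ε)`, so scaling the jet makes its
norm as close to the supremum of `|f|` as desired. -/
lemma exists_jetNorm_le {f : ℂ → ℂ} (hf : ContDiffOn ℝ ∞ f Ω) {L : Set ℂ}
    (hL : IsCompact L) (hLΩ : L ⊆ Ω) (n : ℕ) {ρ₀ ρ : ℝ} (h₀ : ∀ x ∈ L, ‖f x‖ ≤ ρ₀)
    (hρ : ρ₀ < ρ) : ∃ δ : ℝ, 0 < δ ∧ ∀ ε, 0 < ε → ε ≤ δ → ∀ x ∈ L, jetNorm n ε f x ≤ ρ := by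
  obtain ⟨M, hM0, hM⟩ := exists_bound_iteratedFDeriv hf hL hLΩ n
  -- For `ε ≤ 1` each of the `n` higher terms is at most `ε M`; the `+ 1` keeps the denominator
  -- positive.
  refine ⟨min 1 ((ρ - ρ₀) / (n * M + 1)), lt_min one_pos (div_pos (by linarith) (by positivity)),
    fun ε hε hεδ x hx => ?_⟩
  have hε1 : ε ≤ 1 := hεδ.trans (min_le_left _ _)
  have hε2 : ε * (n * M + 1) ≤ ρ - ρ₀ :=
    (le_div_iff₀ (by positivity)).1 (hεδ.trans (min_le_right _ _))
  rw [jetNorm, Finset.sum_range_succ']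
  have h1 : ∑ i ∈ Finset.range n, ε ^ (i + 1) / (i + 1).factorial *
      ‖iteratedFDeriv ℝ (i + 1) f x‖ ≤ ∑ i ∈ Finset.range n, ε * M := by
    refine Finset.sum_le_sum fun i hi => ?_
    refine mul_le_mul ?_ (hM _ (Nat.succ_le_of_lt (Finset.mem_range.1 hi)) x hx)
      (norm_nonneg _) hε.le
    have hfac : (1 : ℝ) ≤ (i + 1).factorial := by exact_mod_cast Nat.succ_le_of_lt (Nat.factorial_pos _)
    calc ε ^ (i + 1) / (i + 1).factorial ≤ ε ^ (i + 1) / 1 := by gcongr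
      _ = ε ^ i * ε := by ring
      _ ≤ 1 * ε := by gcongr; exact pow_le_one₀ hε.le hε1
      _ = ε := one_mul _
  have h2 : ε ^ 0 / (Nat.factorial 0 : ℝ) * ‖iteratedFDeriv ℝ 0 f x‖ ≤ ρ₀ := by
    simpa using h₀ x hx
  have h3 : ∑ i ∈ Finset.range n, ε * M = ε * (n * M) := by simp; ring
  nlinarith

/-- Derivatives of `Θ ψ^k ψ̄^l` on a compact set grow like `ρ^{k+l}`, for every `ρ > sup |ψ|`. -/
lemma exists_bound_iteratedFDeriv_pow {Θ ψ : ℂ → ℂ} (hΘ : ContDiffOn ℝ ∞ Θ Ω)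
    (hψ : ContDiffOn ℝ ∞ ψ Ω) {L : Set ℂ} (hL : IsCompact L) (hLΩ : L ⊆ Ω) (n : ℕ) {ρ₀ ρ : ℝ}
    (hρ0 : 0 < ρ) (h₀ : ∀ x ∈ L, ‖ψ x‖ ≤ ρ₀) (hρ : ρ₀ < ρ) :
    ∃ C : ℝ, 0 ≤ C ∧ ∀ k l i : ℕ, i ≤ n → ∀ x ∈ L,
      ‖iteratedFDeriv ℝ i (fun z => ψ z ^ k * (conj (ψ z) ^ l * Θ z)) x‖ ≤ C * ρ ^ (k + l) := by
  have hψc := conj_contDiffOn hψ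
  obtain ⟨δ₁, hδ₁, H₁⟩ := exists_jetNorm_le hψ hL hLΩ n h₀ hρ
  obtain ⟨δ₂, hδ₂, H₂⟩ := exists_jetNorm_le hψc hL hLΩ n (fun x hx => by
    simpa using h₀ x hx) hρ
  obtain ⟨M, hM0, hM⟩ := exists_bound_iteratedFDeriv hΘ hL hLΩ n
  set ε := min δ₁ δ₂
  have hε : 0 < ε := lt_min hδ₁ hδ₂
  set D : ℝ := ∑ i ∈ Finset.range (n + 1), ε ^ i / i.factorial * M
  set E : ℝ := ∑ i ∈ Finset.range (n + 1), i.factorial / ε ^ i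
  have hD0 : 0 ≤ D := Finset.sum_nonneg fun i _ => by positivity
  have hE0 : 0 ≤ E := Finset.sum_nonneg fun i _ => by positivity
  refine ⟨E * D, mul_nonneg hE0 hD0, fun k l i hi x hx => ?_⟩
  have hx' := hLΩ hx
  have h1 : jetNorm n ε Θ x ≤ D := Finset.sum_le_sum fun i hi => by
    gcongr; exact hM i (by simpa [Nat.lt_succ_iff] using hi) x hx
  have h2 := jetNorm_pow_le hε.le hψc hx' (H₂ ε hε (min_le_right _ _) x hx) l hΘ
  have h3 := jetNorm_pow_le hε.le hψ hx' (H₁ ε hε (min_le_left _ _) x hx) k ((hψc.pow l).mul hΘ)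
  have h4 : (i.factorial : ℝ) / ε ^ i ≤ E :=
    Finset.single_le_sum (f := fun i : ℕ => (i.factorial : ℝ) / ε ^ i)
      (fun i _ => by positivity) (Finset.mem_range.2 (Nat.lt_succ_of_le hi))
  calc _ ≤ i.factorial / ε ^ i * jetNorm n ε _ x := le_jetNorm hε _ x hi
    _ ≤ E * (ρ ^ k * (ρ ^ l * D)) := by
        refine mul_le_mul h4 (h3.trans ?_) (jetNorm_nonneg hε.le _ _) hE0
        refine mul_le_mul_of_nonneg_left (h2.trans ?_) (by positivity)
        exact mul_le_mul_of_nonneg_left h1 (by positivity)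
    _ = _ := by rw [pow_add]; ring

/-! ### Distributions -/

lemma testFunction_ext {φ χ : 𝓓(Ω, ℂ)} (h : ∀ z ∈ Ω, φ z = χ z) : φ = χ := by
  refine TestFunction.ext fun z => ?_
  by_cases hz : z ∈ Ω
  · exact h z hz
  · rw [image_eq_zero_of_notMem_tsupport fun h => hz (φ.tsupport_subset h),
      image_eq_zero_of_notMem_tsupport fun h => hz (χ.tsupport_subset h)]

/-- A distribution has finite order on compact sets. -/
lemma CDistribution.exists_bound (F : CDistribution Ω) {L : Set ℂ} (hL : IsCompact L)
    (hLΩ : L ⊆ Ω) : ∃ n : ℕ, ∃ C : ℝ, 0 ≤ C ∧ ∀ φ : 𝓓(Ω, ℂ), (∀ z ∉ L, φ z = 0) → ∀ M : ℝ, 0 ≤ M →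
      (∀ i ≤ n, ∀ z ∈ L, ‖iteratedFDeriv ℝ i φ z‖ ≤ M) → ‖F φ‖ ≤ C * M := by
  let K : Compacts ℂ := ⟨L, hL⟩
  let T : 𝓓_{K}(ℂ, ℂ) →L[ℂ] ℂ := F.comp (TestFunction.ofSupportedInCLM ℂ (K := K) hLΩ)
  obtain ⟨s, C, -, hC⟩ := Seminorm.bound_of_continuous
    (ContDiffMapSupportedIn.withSeminorms ℂ ℂ ℂ ⊤ K)
    ((normSeminorm ℂ ℂ).comp T.toLinearMap) (continuous_norm.comp T.continuous)
  refine ⟨s.sup id, C, C.2, fun φ hφ M hM0 hM => ?_⟩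
  let ψ : 𝓓_{K}(ℂ, ℂ) := ⟨φ, φ.contDiff, fun z hz => hφ z hz⟩
  have h1 : F φ = T ψ := rfl
  have h2 := Seminorm.le_def.1 hC ψ
  have h3 : (s.sup (ContDiffMapSupportedIn.seminorm ℂ ℂ ℂ ⊤ K)) ψ ≤ M := by
    refine Seminorm.finset_sup_apply_le hM0 fun i hi => ?_
    rw [ContDiffMapSupportedIn.seminorm_top_le_iff ℂ hM0]
    intro z hz
    exact hM i (Finset.le_sup (f := id) hi) z hz
  rw [h1]
  refine (show ‖T ψ‖ ≤ _ from h2).trans ?_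
  exact mul_le_mul_of_nonneg_left h3 C.2

/-- The Wirtinger derivatives of test functions. -/
def wdTest (Ω : Opens ℂ) (c : ℂ) (φ : 𝓓(Ω, ℂ)) : 𝓓(Ω, ℂ) :=
  (1 / 2 : ℂ) • (TestFunction.lineDerivCLM ℂ (1 : ℂ) φ + c • TestFunction.lineDerivCLM ℂ I φ)

lemma wdTest_apply (c : ℂ) (φ : 𝓓(Ω, ℂ)) : (wdTest Ω c φ : ℂ → ℂ) = wd c φ := by
  funext z
  simp only [wdTest, wd, FunLike.coe_smul, FunLike.coe_add, Pi.smul_apply, Pi.add_apply,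
    smul_eq_mul]
  rw [TestFunction.lineDerivCLM_apply_of_le (by simp), TestFunction.lineDerivCLM_apply_of_le (by simp)]
  have h := (φ.contDiff.differentiable (by simp)) z
  rw [h.lineDeriv_eq_fderiv, h.lineDeriv_eq_fderiv]

lemma wdTest_iter (c : ℂ) (n : ℕ) (φ : 𝓓(Ω, ℂ)) :
    ((wdTest Ω c)^[n] φ : ℂ → ℂ) = (wd c)^[n] φ := by
  induction n with
  | zero => rfl
  | succ n ih => rw [Function.iterate_succ_apply', wdTest_apply, ih, Function.iterate_succ_apply']

lemma dzDist_apply (F : CDistribution Ω) (φ : 𝓓(Ω, ℂ)) :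
    dzDist F φ = -F (wdTest Ω (-I) φ) := by
  simp [dzDist, wdTest]; ring

lemma dzbarDist_apply (F : CDistribution Ω) (φ : 𝓓(Ω, ℂ)) :
    dzbarDist F φ = -F (wdTest Ω I φ) := by
  simp [dzbarDist, wdTest]; ring

lemma dzDist_iter (n : ℕ) (F : CDistribution Ω) (φ : 𝓓(Ω, ℂ)) :
    dzDist^[n] F φ = (-1) ^ n * F ((wdTest Ω (-I))^[n] φ) := by
  induction n generalizing φ with
  | zero => simp
  | succ n ih =>
    rw [Function.iterate_succ_apply', dzDist_apply, ih, Function.iterate_succ_apply]; ring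

lemma dzbarDist_iter (n : ℕ) (F : CDistribution Ω) (φ : 𝓓(Ω, ℂ)) :
    dzbarDist^[n] F φ = (-1) ^ n * F ((wdTest Ω I)^[n] φ) := by
  induction n generalizing φ with
  | zero => simp
  | succ n ih =>
    rw [Function.iterate_succ_apply', dzbarDist_apply, ih, Function.iterate_succ_apply]; ring

/-- The formal transpose of `transOp`, on functions. -/
def adjOp (j : ℕ) (c : ℕ → ℂ → ℂ) (Φ : ℂ → ℂ) (z : ℂ) : ℂ :=
  ∑ a ∈ Finset.range (j + 1), ∑ b ∈ Finset.range (j + 1),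
    c a z * conj (c b z) * (wd I)^[b] ((wd (-I))^[a] Φ) z

/-- Transposing `∂^a ∂̄^b` produces the sign `(-1)^{a+b}`, which cancels the one in `transOp`. The
test function `χ` does not depend on `F`. -/
lemma exists_transOp_apply {j : ℕ} {c : ℕ → ℂ → ℂ} (hc : ∀ a, ContDiff ℝ ∞ (c a))
    (φ : 𝓓(Ω, ℂ)) : ∃ χ : 𝓓(Ω, ℂ), (∀ z, χ z = adjOp j c φ z) ∧
      ∀ F : CDistribution Ω, transOp j c hc F φ = F χ := by
  refine ⟨∑ a ∈ Finset.range (j + 1), ∑ b ∈ Finset.range (j + 1),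
    mulTest Ω (fun z => c a z * conj (c b z)) ((hc a).mul (conjCLE.contDiff.comp (hc b)))
      ((wdTest Ω I)^[b] ((wdTest Ω (-I))^[a] φ)), fun z => ?_, fun F => ?_⟩
  · have hcoe : ∀ (s : Finset ℕ) (X : ℕ → 𝓓(Ω, ℂ)), (∑ a ∈ s, X a) z = ∑ a ∈ s, X a z := by
      intro s X
      induction s using Finset.cons_induction with
      | empty => simp
      | cons a s ha ih => rw [Finset.sum_cons, Finset.sum_cons, ← ih]; rfl
    rw [hcoe]
    refine Finset.sum_congr rfl fun a _ => ?_
    rw [hcoe]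
    refine Finset.sum_congr rfl fun b _ => ?_
    have : ∀ (g : ℂ → ℂ) (hg : ContDiff ℝ ∞ g) (χ : 𝓓(Ω, ℂ)), mulTest Ω g hg χ z = g z * χ z :=
      fun _ _ _ => rfl
    rw [this, wdTest_iter, wdTest_iter]
  · have hcoe : ∀ (s : Finset ℕ) (X : ℕ → CDistribution Ω), (∑ a ∈ s, X a) φ = ∑ a ∈ s, X a φ := by
      intro s X
      induction s using Finset.cons_induction with
      | empty => simp
      | cons a s ha ih => rw [Finset.sum_cons, Finset.sum_cons, ← ih]; rfl
    rw [transOp, hcoe, map_sum]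
    refine Finset.sum_congr rfl fun a _ => ?_
    rw [hcoe, map_sum]
    refine Finset.sum_congr rfl fun b _ => ?_
    have e : ∀ (r : ℂ) (G : CDistribution Ω), (r • G) φ = r * G φ := fun _ _ => rfl
    rw [e, dzDist_iter, dzbarDist_iter, pow_add]
    have e2 : ∀ (g : ℂ → ℂ) (hg : ContDiff ℝ ∞ g) (χ : 𝓓(Ω, ℂ)),
      mulDist g hg F χ = F (mulTest Ω g hg χ) := fun _ _ _ => rfl
    rw [e2]
    have h1 : ((-1 : ℂ) ^ a) * (-1) ^ a = 1 := by rw [← mul_pow]; simp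
    have h2 : ((-1 : ℂ) ^ b) * (-1) ^ b = 1 := by rw [← mul_pow]; simp
    linear_combination (F _ * (-1) ^ b * (-1) ^ b) * h1 + (F _) * h2

end

end PolyToeplitz


namespace PolyToeplitz

noncomputable section

/-! ### Values of symbols -/

variable {Ω : Opens ℂ} {s : BoundaryFunction Ω} {A : BdryAlg s} {F : CDistribution Ω}

lemma truncate_apply (h : Cutoff) (t : ℝ) {φ : ℂ → ℂ} (hφ : ContDiffOn ℝ ∞ φ Ω) {z : ℂ}
    (hz : z ∈ Ω) : truncate s h t φ hφ z = (h.toFun (t * s.toFun z) : ℂ) * φ z :=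
  Set.indicator_of_mem (s := (Ω : Set ℂ)) hz fun z => (h.toFun (t * s.toFun z) : ℂ) * φ z

/-- The family `η(t s) m` is the difference of the truncations of `m` by the cutoffs `h + η` and
`h`. Both have the same limit because a value is required to be independent of the cutoff. -/
lemma BdryAlg.Fam.exists_test {Φ : ℝ → ℂ → ℂ} (hF : ∀ g ∈ A.N, ∃ L, HasValue s F g L)
    (h : A.Fam 0 Φ) : ∃ X : ℝ → 𝓓(Ω, ℂ), (∀ t, ∀ z ∈ Ω, X t z = Φ t z) ∧
      Tendsto (fun t => F (X t)) atTop (𝓝 0) := by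
  induction h with
  | basic η hη m hm =>
    obtain ⟨L, hφ, hL⟩ := hF m (mem_zero_iff.1 hm)
    refine ⟨fun t => truncate s (stdCutoff.addBump hη) t m hφ - truncate s stdCutoff t m hφ,
      fun t z hz => ?_, ?_⟩
    · have : ∀ φ χ : 𝓓(Ω, ℂ), (φ - χ) z = φ z - χ z := fun _ _ => rfl
      rw [this, truncate_apply _ _ _ hz, truncate_apply _ _ _ hz]
      simp only [Cutoff.addBump]
      push_cast; ring
    · simpa using (hL (stdCutoff.addBump hη)).sub (hL stdCutoff)
  | zero => exact ⟨fun _ => 0, fun _ _ _ => rfl, by simp⟩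
  | add Φ Ψ _ _ h₁ h₂ =>
    obtain ⟨X, hX, hX0⟩ := h₁
    obtain ⟨Y, hY, hY0⟩ := h₂
    refine ⟨fun t => X t + Y t, fun t z hz => ?_, by simpa using hX0.add hY0⟩
    beta_reduce
    rw [← hX t z hz, ← hY t z hz]; rfl
  | congr Φ Ψ _ h ih =>
    obtain ⟨X, hX, hX0⟩ := ih
    exact ⟨X, fun t z hz => (hX t z hz).trans (h t z hz).symm, hX0⟩

/-- The products `c_a c̄_b` compensate the growth of derivatives of orders `a` and `b`. -/
def CoeffMem (A : BdryAlg s) (j : ℕ) (c : ℕ → ℂ → ℂ) : Prop :=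
  ∀ a ≤ j, ∀ b ≤ j, ∀ m : ℂ → ℂ, A.Mem (0 - (a : ℤ) - (b : ℤ)) m →
    A.Mem 0 fun z => c a z * conj (c b z) * m z

variable {j : ℕ} {c : ℕ → ℂ → ℂ}

/-- The `a + b` powers of `v` lost by differentiation are restored by `c_a c̄_b`, so the commutator
with the cutoff consists of bump terms of grade `0`. -/
lemma CoeffMem.near_adjOp (hcoef : CoeffMem A j c) (h : Cutoff) {m : ℂ → ℂ} (hm : A.Mem 0 m) :
    A.Near h 0 (fun t => adjOp j c fun z => (h.toFun (t * s.toFun z) : ℂ) * m z) (adjOp j c m) :=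
  BdryAlg.Near.sum _ _ _ fun a ha => BdryAlg.Near.sum _ _ _ fun b hb =>
    (((BdryAlg.Near.of_mem h hm).wd_iter (-I) a).wd_iter I b).mul
      (hcoef a (by simpa [Nat.lt_succ_iff] using ha) b (by simpa [Nat.lt_succ_iff] using hb))

lemma wd_conj_holo {f : ℂ → ℂ} {z : ℂ} (hf : DifferentiableAt ℂ f z) :
    wd (-I) (fun w => conj (f w)) z = 0 := by
  have h := wd_iter_conj (c := -I) 1 f z
  simp only [Function.iterate_one, map_neg, conj_I, neg_neg] at h
  rw [h, dzbar_holo hf, map_zero]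

/-- Antiholomorphic factors are constants for `∂`, holomorphic ones for `∂̄`. -/
lemma wd_iter_holo_mul_conj {f g : ℂ → ℂ} (hf : DifferentiableOn ℂ f Ω)
    (hg : DifferentiableOn ℂ g Ω) (a b : ℕ) {z : ℂ} (hz : z ∈ Ω) :
    (wd I)^[b] ((wd (-I))^[a] fun w => f w * conj (g w)) z =
      deriv^[a] f z * conj (deriv^[b] g z) := by
  have hfs := holo_contDiffOn hf
  have hgs := conj_contDiffOn (holo_contDiffOn hg)
  have hfa := holo_iter_deriv a hf
  have h1 : Set.EqOn ((wd (-I))^[a] fun w => f w * conj (g w))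
      (fun w => deriv^[a] f w * conj (g w)) Ω := by
    intro w hw
    have := wd_iter_mul_left (c := -I) a hgs (fun v hv =>
      wd_conj_holo ((hg v hv).differentiableAt (Ω.isOpen.mem_nhds hv))) hfs hw
    rw [dz_iter_holo a hf hw] at this
    simpa only [mul_comm] using this
  rw [wd_iter_congr b h1 hz, wd_iter_mul_left b (holo_contDiffOn hfa) (fun v hv =>
    dzbar_holo ((hfa v hv).differentiableAt (Ω.isOpen.mem_nhds hv))) hgs hz, wd_iter_conj,
    conj_I, dz_iter_holo b hg hz]

/-- The pointwise identity that explains the definition of `E`: its transpose factors on products `f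
ḡ`. -/
lemma adjOp_holo {f g : ℂ → ℂ} (hf : DifferentiableOn ℂ f Ω) (hg : DifferentiableOn ℂ g Ω)
    {z : ℂ} (hz : z ∈ Ω) :
    adjOp j c (fun w => f w * conj (g w)) z = holoOp j c f z * conj (holoOp j c g z) := by
  simp only [adjOp, holoOp, map_sum, Finset.sum_mul_sum, map_mul]
  refine Finset.sum_congr rfl fun a _ => Finset.sum_congr rfl fun b _ => ?_
  rw [wd_iter_holo_mul_conj hf hg a b hz]; ring

lemma wd_iter_congr_open {V : Set ℂ} (hV : IsOpen V) {f g : ℂ → ℂ} (h : Set.EqOn f g V) (d : ℂ)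
    (n : ℕ) : Set.EqOn ((wd d)^[n] f) ((wd d)^[n] g) V :=
  wd_iter_congr (Ω := ⟨V, hV⟩) n h

lemma adjOp_congr {V : Set ℂ} (hV : IsOpen V) {f g : ℂ → ℂ} (h : Set.EqOn f g V) :
    Set.EqOn (adjOp j c f) (adjOp j c g) V := by
  intro z hz
  refine Finset.sum_congr rfl fun a _ => Finset.sum_congr rfl fun b _ => ?_
  rw [wd_iter_congr_open hV (wd_iter_congr_open hV h (-I) a) I b hz]

/-- Cutoff functions are eventually one near a compact set. -/
lemma BoundaryFunction.exists_nhds_eq_one (s : BoundaryFunction Ω) {K : Set ℂ} (hK : IsCompact K)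
    (hKΩ : K ⊆ Ω) : ∃ V : Set ℂ, IsOpen V ∧ K ⊆ V ∧ V ⊆ Ω ∧ ∀ h : Cutoff, ∃ T : ℝ, 0 < T ∧
      ∀ t, T ≤ t → ∀ z ∈ V, h.toFun (t * s.toFun z) = 1 := by
  obtain ⟨K', hK', h1, h2⟩ := exists_compact_between hK Ω.isOpen hKΩ
  refine ⟨interior K', isOpen_interior, h1, interior_subset.trans h2, fun h => ?_⟩
  obtain ⟨b, hb⟩ := h.eq_one
  have hc : ∃ c > 0, ∀ z ∈ K', c ≤ s.toFun z := by
    rcases K'.eq_empty_or_nonempty with rfl | hne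
    · exact ⟨1, one_pos, fun z hz => absurd hz (Set.notMem_empty z)⟩
    · obtain ⟨x, hx, hmin⟩ := hK'.exists_isMinOn hne (s.smooth.continuousOn.mono h2)
      exact ⟨s.toFun x, s.pos x (h2 hx), fun z hz => hmin hz⟩
  obtain ⟨c, hc0, hc⟩ := hc
  refine ⟨max 1 (b / c), lt_max_of_lt_left one_pos, fun t ht z hz => hb _ ?_⟩
  have h3 : b / c ≤ t := (le_max_right _ _).trans ht
  have h4 : 0 < t := one_pos.trans_le ((le_max_left _ _).trans ht)
  rw [div_le_iff₀ hc0] at h3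
  exact h3.trans (mul_le_mul_of_nonneg_left (hc z (interior_subset hz)) h4.le)

lemma eq_of_isVanishingOn {G : CDistribution Ω} {K V : Set ℂ}
    (hG : Distribution.IsVanishingOn G Kᶜ) (hV : IsOpen V) (hKV : K ⊆ V) {φ χ : 𝓓(Ω, ℂ)}
    (h : Set.EqOn φ χ V) : G φ = G χ := by
  have h1 : G (φ - χ) = 0 := by
    refine hG _ ?_
    have h2 : tsupport (φ - χ : 𝓓(Ω, ℂ)) ⊆ Vᶜ := by
      refine closure_minimal (fun z hz hzV => hz ?_) hV.isClosed_compl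
      have : (φ - χ) z = φ z - χ z := rfl
      rw [this, h hzV, sub_self]
    exact h2.trans (Set.compl_subset_compl.2 hKV)
  rwa [map_sub, sub_eq_zero] at h1

/-- If `EF` has compact support, then the values of the symbol `F` on `S f · conj (S g)` are those
of `EF` on `f · conj g`. -/
lemma hasValue_holoOp (hcoef : CoeffMem A j c) (hc : ∀ a, ContDiff ℝ ∞ (c a))
    (hF : ∀ g ∈ A.N, ∃ L, HasValue s F g L) {K : Set ℂ} (hK : IsCompact K) (hKΩ : K ⊆ Ω)
    (hv : Distribution.IsVanishingOn (transOp j c hc F) Kᶜ) :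
    ∃ T : ℝ, 0 < T ∧ ∀ f g : ℂ → ℂ, DifferentiableOn ℂ f Ω → DifferentiableOn ℂ g Ω →
      (fun z => f z * conj (g z)) ∈ A.N → ∀ hφ, HasValue s F
        (fun z => holoOp j c f z * conj (holoOp j c g z))
        (transOp j c hc F (truncate s stdCutoff T (fun z => f z * conj (g z)) hφ)) := by
  obtain ⟨V, hV, hKV, hVΩ, hone⟩ := s.exists_nhds_eq_one hK hKΩ
  obtain ⟨T, hT0, hT⟩ := hone stdCutoff
  refine ⟨T, hT0, fun f g hf hg hfg hφ => ⟨(holoOp_contDiffOn hc hf).mul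
    (conj_contDiffOn (holoOp_contDiffOn hc hg)), fun h => ?_⟩⟩
  obtain ⟨T', -, hT'⟩ := hone h
  -- The transpose of `E` applied to `h(t s) f ḡ` is `h(t s) S f · conj (S g)` plus bump terms, and
  -- `F` tends to zero on the latter.
  obtain ⟨-, Ψ, hΨ, hΦ⟩ := hcoef.near_adjOp h (BdryAlg.mem_zero_iff.2 hfg)
  obtain ⟨X, hX, hX0⟩ := hΨ.exists_test hF
  have hlim := (tendsto_const_nhds (x := transOp j c hc F
    (truncate s stdCutoff T (fun z => f z * conj (g z)) hφ))).sub hX0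
  rw [sub_zero] at hlim
  refine hlim.congr' ?_
  filter_upwards [eventually_ge_atTop T'] with t ht
  -- For large `t` both truncations of `f ḡ` agree with `f ḡ` near the support of `EF`, so the value
  -- at the fixed cutoff `stdCutoff`, `T` may be replaced by the one at `h`, `t`.
  rw [eq_of_isVanishingOn hv hV hKV (χ := truncate s h t (fun z => f z * conj (g z)) hφ)]
  · obtain ⟨χ, hχ, hFχ⟩ := exists_transOp_apply (Ω := Ω) hc
      (truncate s h t (fun z => f z * conj (g z)) hφ)
    rw [hFχ, ← map_sub]
    congr 1
    refine testFunction_ext fun z hz => ?_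
    have e : (χ - X t) z = χ z - X t z := rfl
    have e2 := hΦ t z hz
    beta_reduce at e2
    rw [e, hχ, hX t z hz, truncate_apply _ _ _ hz,
      adjOp_congr Ω.isOpen (fun w hw => truncate_apply h t hφ hw) hz, e2, adjOp_holo hf hg hz]
    ring
  · intro z hz
    rw [truncate_apply _ _ _ (hVΩ hz), truncate_apply _ _ _ (hVΩ hz), hT T le_rfl z hz,
      hT' t ht z hz]

lemma HasValue.congr {φ χ : ℂ → ℂ} {L : ℂ} (h : HasValue s F φ L) (e : Set.EqOn χ φ Ω) :
    HasValue s F χ L := by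
  obtain ⟨hφ, hL⟩ := h
  refine ⟨hφ.congr e, fun h => (hL h).congr fun t => ?_⟩
  congr 1
  refine testFunction_ext fun z hz => ?_
  rw [truncate_apply _ _ _ hz, truncate_apply _ _ _ hz, e hz]

lemma HasValue.unique {φ : ℂ → ℂ} {L M : ℂ} (h : HasValue s F φ L) (h' : HasValue s F φ M) :
    L = M := by
  obtain ⟨_, hL⟩ := h
  obtain ⟨_, hM⟩ := h'
  exact tendsto_nhds_unique (hL stdCutoff) (hM stdCutoff)

/-- Values of a compactly supported distribution on cut off products `f_k f̄_l`, `f_k = w ψ^k`. -/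
lemma CDistribution.exists_bound_pow (G : CDistribution Ω) {T : ℝ} (hT : 0 < T) {P : Set ℝ}
    (hpos : ∀ ρ ∈ P, 0 < ρ) (hgap : ∀ ρ ∈ P, ∃ ρ' ∈ P, ρ < ρ') {w ψ : ℂ → ℂ}
    (hw : DifferentiableOn ℂ w Ω) (hψ : DifferentiableOn ℂ ψ Ω)
    (hP : ∀ K : Set ℂ, IsCompact K → K ⊆ Ω → ∃ ρ ∈ P, ∀ z ∈ K, ‖ψ z‖ ≤ ρ) :
    ∃ ρ ∈ P, ∃ C : ℝ, ∀ k l, ∀ hφ, ‖G (truncate s stdCutoff T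
      (fun z => w z * ψ z ^ k * conj (w z * ψ z ^ l)) hφ)‖ ≤ C * ρ ^ (k + l) := by
  -- `stdCutoff` vanishes on `(-∞, 1]`, so functions truncated at scale `T` vanish outside `L`.
  set L : Set ℂ := {z | z ∈ Ω ∧ 1 / T ≤ s.toFun z}
  have hL : IsCompact L := s.compact _ (by positivity)
  have hLΩ : L ⊆ Ω := fun z hz => hz.1
  obtain ⟨ρ₀, hρ₀, hψρ⟩ := hP L hL hLΩ
  obtain ⟨ρ, hρ, hlt⟩ := hgap ρ₀ hρ₀
  obtain ⟨n, C, hC0, hC⟩ := CDistribution.exists_bound G hL hLΩ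
  have hws := holo_contDiffOn hw
  have hΘ : ContDiffOn ℝ ∞ (fun z => (stdCutoff.toFun (T * s.toFun z) : ℂ) *
      (w z * conj (w z))) Ω :=
    (BdryAlg.smooth_comp s stdCutoff.smooth T).mul (hws.mul (conj_contDiffOn hws))
  obtain ⟨D, hD0, hD⟩ := exists_bound_iteratedFDeriv_pow hΘ (holo_contDiffOn hψ) hL hLΩ n
    (hpos ρ hρ) hψρ hlt
  refine ⟨ρ, hρ, C * D, fun k l hφ => ?_⟩
  rw [mul_assoc]
  refine hC _ (fun z hz => ?_) _ (mul_nonneg hD0 (pow_nonneg (hpos ρ hρ).le _))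
    fun i hi z hz => ?_
  · by_cases hzΩ : z ∈ Ω
    · have h1 : s.toFun z < 1 / T := by
        by_contra hcon
        exact hz ⟨hzΩ, not_lt.1 hcon⟩
      rw [lt_div_iff₀ hT] at h1
      rw [truncate_apply _ _ _ hzΩ]
      have : stdCutoff.toFun (T * s.toFun z) = 0 :=
        Real.smoothTransition.zero_of_nonpos (by linarith)
      rw [this]; simp
    · exact image_eq_zero_of_notMem_tsupport fun h => hzΩ (TestFunction.tsupport_subset _ h)
  · have e : (truncate s stdCutoff T (fun z => w z * ψ z ^ k * conj (w z * ψ z ^ l)) hφ : ℂ → ℂ)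
        =ᶠ[𝓝 z] fun z => ψ z ^ k * (conj (ψ z) ^ l *
          ((stdCutoff.toFun (T * s.toFun z) : ℂ) * (w z * conj (w z)))) := by
      filter_upwards [Ω.isOpen.mem_nhds (hLΩ hz)] with x hx
      rw [truncate_apply _ _ _ hx, map_mul, map_pow]; ring
    rw [(e.iteratedFDeriv ℝ i).eq_of_nhds]
    exact hD k l i hi z hz

/-- The matrix of a symbol `F` such that `EF` has compact support. -/
theorem exists_matrix (hcoef : CoeffMem A j c) (hc : ∀ a, ContDiff ℝ ∞ (c a))
    (hF : ∀ g ∈ A.N, ∃ L, HasValue s F g L)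
    (hv : HasCompactSupportIn (transOp j c hc F) Ω) {P : Set ℝ}
    (hpos : ∀ ρ ∈ P, 0 < ρ) (hgap : ∀ ρ ∈ P, ∃ ρ' ∈ P, ρ < ρ') {w ψ : ℂ → ℂ}
    (hw : DifferentiableOn ℂ w Ω) (hψ : DifferentiableOn ℂ ψ Ω)
    (hP : ∀ K : Set ℂ, IsCompact K → K ⊆ Ω → ∃ ρ ∈ P, ∀ z ∈ K, ‖ψ z‖ ≤ ρ)
    (hmem : ∀ k l : ℕ, (fun z => w z * ψ z ^ k * conj (w z * ψ z ^ l)) ∈ A.N) :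
    ∃ a : ℕ → ℕ → ℂ, (∀ k l, HasValue s F (fun z => holoOp j c (fun v => w v * ψ v ^ k) z *
      conj (holoOp j c (fun v => w v * ψ v ^ l) z)) (a k l)) ∧
      ∃ ρ ∈ P, ∃ C : ℝ, ∀ k l, ‖a k l‖ ≤ C * ρ ^ (k + l) := by
  obtain ⟨K, hK, hKΩ, hv⟩ := hv
  obtain ⟨T, hT, H⟩ := hasValue_holoOp hcoef hc hF hK hKΩ hv
  have he : ∀ k : ℕ, DifferentiableOn ℂ (fun v => w v * ψ v ^ k) Ω := fun k => hw.mul (hψ.pow k)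
  obtain ⟨ρ, hρ, C, hC⟩ := CDistribution.exists_bound_pow (s := s) (transOp j c hc F) hT hpos hgap
    hw hψ hP
  exact ⟨_, fun k l => H _ _ (he k) (he l) (hmem k l) (A.smooth _ (hmem k l)), ρ, hρ, C,
    fun k l => hC k l _⟩

/-- The truncations eventually agree near the support, so the limit is attained for large `t`. This
supplies the symbol condition that (2) does not assume. -/
lemma exists_hasValue_of_hasCompactSupportIn (hF : HasCompactSupportIn F Ω) {φ : ℂ → ℂ}
    (hφ : ContDiffOn ℝ ∞ φ Ω) : ∃ L, HasValue s F φ L := by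
  obtain ⟨K, hK, hKΩ, hv⟩ := hF
  obtain ⟨V, hV, hKV, hVΩ, hone⟩ := s.exists_nhds_eq_one hK hKΩ
  obtain ⟨T, hT0, hT⟩ := hone stdCutoff
  refine ⟨F (truncate s stdCutoff T φ hφ), hφ, fun h => ?_⟩
  obtain ⟨T', -, hT'⟩ := hone h
  refine tendsto_const_nhds.congr' ?_
  filter_upwards [eventually_ge_atTop T'] with t ht
  refine eq_of_isVanishingOn hv hV hKV fun z hz => ?_
  rw [truncate_apply _ _ _ (hVΩ hz), truncate_apply _ _ _ (hVΩ hz), hT T le_rfl z hz,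
    hT' t ht z hz]

lemma HasCompactSupportIn.transOp (hF : HasCompactSupportIn F Ω) (hc : ∀ a, ContDiff ℝ ∞ (c a)) :
    HasCompactSupportIn (PolyToeplitz.transOp j c hc F) Ω := by
  obtain ⟨K, hK, hKΩ, hv⟩ := hF
  refine ⟨K, hK, hKΩ, fun φ hφ => ?_⟩
  obtain ⟨χ, hχ, hFχ⟩ := exists_transOp_apply (Ω := Ω) hc φ
  rw [hFχ]
  refine hv χ (Set.Subset.trans ?_ hφ)
  refine closure_minimal (fun z hz => ?_) (isClosed_tsupport _)
  by_contra hcon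
  refine hz ?_
  have h1 : Set.EqOn φ (fun _ => (0 : ℂ)) (tsupport φ)ᶜ := fun w hw =>
    image_eq_zero_of_notMem_tsupport hw
  rw [hχ, adjOp_congr (isClosed_tsupport _).isOpen_compl h1 hcon]
  simp [adjOp, wd_iter_zero]

end

end PolyToeplitz


namespace PolyToeplitz

noncomputable section

/-! ### Radially symmetric domains -/

/-- The closed annulus `r ≤ |z| ≤ r'`. -/
def annulus (r r' : ℝ) : Set ℂ := {z | r ≤ ‖z‖ ∧ ‖z‖ ≤ r'}

lemma isCompact_annulus (r r' : ℝ) : IsCompact (annulus r r') := by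
  have : annulus r r' = Metric.closedBall 0 r' ∩ {z | r ≤ ‖z‖} := by
    ext z; simp [annulus, and_comm]
  rw [this]
  exact (isCompact_closedBall _ _).inter_right (isClosed_le continuous_const continuous_norm)

lemma volume_annulus_pos {r r' : ℝ} (h0 : 0 < r) (h : r < r') :
    0 < (volume (annulus r r')).toReal := by
  refine ENNReal.toReal_pos ?_ (isCompact_annulus r r').measure_lt_top.ne
  have hopen : IsOpen {z : ℂ | r < ‖z‖ ∧ ‖z‖ < r'} :=
    (isOpen_lt continuous_const continuous_norm).inter (isOpen_lt continuous_norm continuous_const)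
  have hne : {z : ℂ | r < ‖z‖ ∧ ‖z‖ < r'}.Nonempty := by
    refine ⟨(((r + r') / 2 : ℝ) : ℂ), ?_⟩
    have : ‖(((r + r') / 2 : ℝ) : ℂ)‖ = (r + r') / 2 := by
      rw [norm_real, Real.norm_of_nonneg (by linarith)]
    constructor <;> rw [this] <;> linarith
  exact ((hopen.measure_pos volume hne).trans_le
    (measure_mono (t := annulus r r') fun z hz => ⟨le_of_lt hz.1, le_of_lt hz.2⟩)).ne'

/-- Only the annulus is kept, where `|z|^{2k} ≥ r^{2k}`; the constant in front does not depend on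
`k`. -/
lemma le_norm_integral_annulus {S : Set ℂ} (hS : MeasurableSet S) {r r' c₀ : ℝ} (h0 : 0 < r)
    (hc : 0 ≤ c₀) (hA : annulus r r' ⊆ S) {Φ : ℂ → ℝ} (hΦ0 : ∀ z ∈ S, 0 ≤ Φ z)
    (hΦ : ∀ z ∈ annulus r r', c₀ ≤ Φ z) (k : ℕ)
    (hi : IntegrableOn (fun z => Φ z * ‖z‖ ^ (2 * k)) S) :
    c₀ * (volume (annulus r r')).toReal * r ^ (2 * k) ≤
      ‖∫ z in S, (Φ z : ℂ) * (‖z‖ : ℂ) ^ (2 * k)‖ := by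
  have e : ∫ z in S, (Φ z : ℂ) * (‖z‖ : ℂ) ^ (2 * k) =
      ((∫ z in S, Φ z * ‖z‖ ^ (2 * k) : ℝ) : ℂ) := by
    rw [← integral_complex_ofReal]
    simp
  have hAm : MeasurableSet (annulus r r') := (isCompact_annulus r r').measurableSet
  have h1 : ∫ _ in annulus r r', c₀ * r ^ (2 * k) ≤ ∫ z in annulus r r', Φ z * ‖z‖ ^ (2 * k) := by
    refine setIntegral_mono_on ?_ (hi.mono_set hA) hAm fun z hz => ?_
    · exact integrableOn_const (isCompact_annulus r r').measure_lt_top.ne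
    · have h3 := hΦ z hz
      exact mul_le_mul h3 (pow_le_pow_left₀ h0.le hz.1 _) (pow_nonneg h0.le _) (hc.trans h3)
  have h2 : ∫ z in annulus r r', Φ z * ‖z‖ ^ (2 * k) ≤ ∫ z in S, Φ z * ‖z‖ ^ (2 * k) := by
    refine setIntegral_mono_set hi ?_ hA.eventuallyLE
    filter_upwards [ae_restrict_mem hS] with z hz
    exact mul_nonneg (hΦ0 z hz) (by positivity)
  rw [setIntegral_const, smul_eq_mul] at h1
  rw [e, norm_real]
  refine le_trans ?_ (le_abs_self _)
  refine le_trans (le_of_eq ?_) (h1.trans h2)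
  rw [measureReal_def]; ring

variable {Ω : Opens ℂ} {s : BoundaryFunction Ω}

/-- A test function on a domain that is symmetric under rotations lives in a disk contained in the
domain. -/
lemma exists_closedBall (hrad : ∀ z w : ℂ, ‖w‖ ≤ ‖z‖ → z ∈ Ω → w ∈ Ω) (φ : 𝓓(Ω, ℂ)) :
    ∃ r : ℝ, Metric.closedBall 0 r ⊆ (Ω : Set ℂ) ∧ ∀ z : ℂ, r < ‖z‖ → φ z = 0 := by
  rcases (tsupport φ).eq_empty_or_nonempty with h | h
  · refine ⟨-1, by simp, fun z _ => image_eq_zero_of_notMem_tsupport (by simp [h])⟩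
  · obtain ⟨z₀, hz₀, hmax⟩ := φ.hasCompactSupport.exists_isMaxOn h continuous_norm.continuousOn
    refine ⟨‖z₀‖, fun z hz => hrad z₀ z (by simpa using hz) (φ.tsupport_subset hz₀), fun z hz => ?_⟩
    refine image_eq_zero_of_notMem_tsupport fun hz' => ?_
    exact absurd (hmax hz') (not_le.2 hz)

/-- Lower bounds for the moments of truncated positive functions. -/
lemma exists_le_norm_integral_truncate (s : BoundaryFunction Ω) {W : ℂ → ℝ}
    (hWs : ContDiffOn ℝ ∞ W Ω) (hW0 : ∀ z ∈ Ω, 0 < W z)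
    (hWc : ContDiffOn ℝ ∞ (fun z => (W z : ℂ)) Ω) {ρ ρ' : ℝ} (hρ : 0 < ρ) (hlt : ρ < ρ')
    (hP : Metric.closedBall 0 ρ' ⊆ (Ω : Set ℂ)) : ∃ c : ℝ, 0 < c ∧ ∀ m : ℕ, ∀ᶠ t in atTop,
      c * ρ ^ (2 * m) ≤ ‖∫ z in Ω, truncate s stdCutoff t (fun z => (W z : ℂ)) hWc z *
        (‖z‖ : ℂ) ^ (2 * m)‖ := by
  have hΩm : MeasurableSet (Ω : Set ℂ) := Ω.isOpen.measurableSet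
  set Φ : ℝ → 𝓓(Ω, ℂ) := fun t => truncate s stdCutoff t (fun z => (W z : ℂ)) hWc with hΦdef
  have hΦ : ∀ t, ∀ z ∈ Ω, Φ t z = (stdCutoff.toFun (t * s.toFun z) : ℂ) * W z := fun t z hz =>
    truncate_apply _ _ _ hz
  have hAΩ : annulus ρ ρ' ⊆ Ω := fun z hz => hP (by simpa using hz.2)
  obtain ⟨V, -, hAV, hVΩ, hone⟩ := s.exists_nhds_eq_one (isCompact_annulus ρ ρ') hAΩ
  obtain ⟨T, -, hT⟩ := hone stdCutoff
  have hv := volume_annulus_pos hρ hlt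
  have hWA : ∃ c₀ > 0, ∀ z ∈ annulus ρ ρ', c₀ ≤ W z := by
    have hne : (annulus ρ ρ').Nonempty := by
      by_contra hcon
      rw [Set.not_nonempty_iff_eq_empty.1 hcon] at hv
      simp at hv
    obtain ⟨x, hx, hmin⟩ := (isCompact_annulus ρ ρ').exists_isMinOn hne
      (hWs.continuousOn.mono hAΩ)
    exact ⟨W x, hW0 x (hAΩ hx), fun z hz => hmin hz⟩
  obtain ⟨c₀, hc₀, hc₀W⟩ := hWA
  refine ⟨c₀ * (volume (annulus ρ ρ')).toReal, by positivity, fun m => ?_⟩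
  filter_upwards [eventually_ge_atTop T] with t ht
  have e : ∫ z in Ω, Φ t z * (‖z‖ : ℂ) ^ (2 * m) = ∫ z in Ω,
      ((stdCutoff.toFun (t * s.toFun z) * W z : ℝ) : ℂ) * (‖z‖ : ℂ) ^ (2 * m) := by
    refine setIntegral_congr_fun hΩm fun z hz => ?_
    rw [hΦ t z hz]; push_cast; ring
  rw [e]
  refine le_norm_integral_annulus hΩm hρ hc₀.le hAΩ
    (fun z hz => mul_nonneg (Real.smoothTransition.nonneg _) (hW0 z hz).le)
    (fun z hz => ?_) m ?_
  · have := hT t ht z (hAV hz)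
    change c₀ ≤ stdCutoff.toFun (t * s.toFun z) * W z
    rw [this, one_mul]; exact hc₀W z hz
  · have h1 : Integrable fun z => Φ t z * (‖z‖ : ℂ) ^ (2 * m) :=
      ((Φ t).continuous.mul (by fun_prop)).integrable_of_hasCompactSupport
        (Φ t).hasCompactSupport.mul_right
    have h2 : IntegrableOn (fun z => (Φ t z * (‖z‖ : ℂ) ^ (2 * m)).re) Ω :=
      h1.integrableOn.re
    refine IntegrableOn.congr_fun h2 (fun z hz => ?_) hΩm
    rw [hΦ t z hz]
    norm_cast

variable {A : BdryAlg s} {μ : Measure ℂ} {j : ℕ} {P : Set ℝ} {U : ℕ → ℂ → ℂ}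

/-- A family of functions as in the definition of the true polyanalytic spaces, on a domain that is
symmetric under rotations, is an orthogonal basis. -/
theorem PolyBasis.of_radial (wt : ℂ → ℂ) (W : ℂ → ℝ) (κ : ℂ) (hκ : ‖κ‖ = 1)
    (hae : ∀ᵐ z ∂μ, z ∈ Ω) (hμ : ∀ f : ℂ → ℂ, ∫ z, f z ∂μ = ∫ z in Ω, wt z * f z)
    (hint : ∀ g : ℂ → ℂ, ContDiffOn ℝ ∞ g Ω → MemLp g 2 μ → ∀ m ∈ A.N,
      IntegrableOn (fun z => g z * m z) Ω)
    (hrad : ∀ z w : ℂ, ‖w‖ ≤ ‖z‖ → z ∈ Ω → w ∈ Ω) (hΩ : IsPreconnected (Ω : Set ℂ))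
    (hs : ∀ z w : ℂ, ‖z‖ = ‖w‖ → s.toFun z = s.toFun w)
    (hW : ∀ z w : ℂ, ‖z‖ = ‖w‖ → W z = W w) (hWs : ContDiffOn ℝ ∞ W Ω)
    (hW0 : ∀ z ∈ Ω, 0 < W z)
    (hmem : ∀ k : ℕ, A.Mem j fun z => (W z : ℂ) * conj z ^ k)
    (hθ : ∀ k : ℕ, ∀ z ∈ Ω, (wd I)^[j] (fun z => (W z : ℂ) * conj z ^ k) z =
      κ * (wt z * conj (U k z)))
    (hlam : ∀ k, ∃ l : ℂ, 1 ≤ ‖l‖ ∧ ∀ z ∈ Ω, (wd I)^[j] (U k) z = l * z ^ k)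
    (smooth : ∀ k, ContDiffOn ℝ ∞ (U k) Ω) (memLp : ∀ k, MemLp (U k) 2 μ)
    (poly : ∀ k, ∀ z ∈ Ω, dzbar^[j + 1] (U k) z = 0)
    (hPne : P.Nonempty) (pos : ∀ ρ ∈ P, 0 < ρ) (gap : ∀ ρ ∈ P, ∃ ρ' ∈ P, ρ < ρ')
    (hP : ∀ ρ ∈ P, Metric.closedBall 0 ρ ⊆ (Ω : Set ℂ))
    (synth : ∀ b : ℕ → ℂ, (∀ ρ ∈ P, ∃ C : ℝ, ∀ k, ‖b k‖ * ρ ^ k ≤ C) → ∃ g : ℂ → ℂ,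
      ContDiffOn ℝ ∞ g Ω ∧ (∀ z ∈ Ω, dzbar^[j + 1] g z = 0) ∧
        ∀ z ∈ Ω, HasSum (fun k => b k * U k z) (g z)) :
    PolyBasis Ω μ j P U := by
  have hΩm : MeasurableSet (Ω : Set ℂ) := Ω.isOpen.measurableSet
  have hWc : ContDiffOn ℝ ∞ (fun z => (W z : ℂ)) Ω := ofRealCLM.contDiff.comp_contDiffOn hWs
  set Φ : ℝ → 𝓓(Ω, ℂ) := fun t => truncate s stdCutoff t (fun z => (W z : ℂ)) hWc with hΦdef
  have hΦ : ∀ t, ∀ z ∈ Ω, Φ t z = (stdCutoff.toFun (t * s.toFun z) : ℂ) * W z := fun t z hz =>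
    truncate_apply _ _ _ hz
  have hΦout : ∀ t, ∀ z, z ∉ Ω → Φ t z = 0 := fun t z hz =>
    image_eq_zero_of_notMem_tsupport fun h => hz ((Φ t).tsupport_subset h)
  have hΦrad : ∀ t, ∀ z w : ℂ, ‖z‖ = ‖w‖ → Φ t z = Φ t w := by
    intro t z w hzw
    by_cases hz : z ∈ Ω
    · have hw : w ∈ Ω := hrad z w hzw.ge hz
      rw [hΦ t z hz, hΦ t w hw, hs z w hzw, hW z w hzw]
    · have hw : w ∉ Ω := fun hw => hz (hrad w z hzw.le hw)
      rw [hΦout t z hz, hΦout t w hw]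
  -- Orthogonality, completeness and the inner products of the `U k` are all read off from this
  -- limit, by inserting what is known about `∂̄^j g`.
  have ibp : ∀ g : ℂ → ℂ, ContDiffOn ℝ ∞ g Ω → MemLp g 2 μ → ∀ k,
      Tendsto (fun t => ∫ z in Ω, (wd I)^[j] g z * (Φ t z * conj z ^ k)) atTop
        (𝓝 ((-1) ^ j * κ * ∫ z, g z * conj (U k z) ∂μ)) := by
    intro g hg hgL k
    have h1 := BdryAlg.tendsto_ibp (c := I) stdCutoff hg (hmem k) (hint g hg hgL)
    have e1 : ∫ z in Ω, g z * (wd I)^[j] (fun z => (W z : ℂ) * conj z ^ k) z =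
        κ * ∫ z, g z * conj (U k z) ∂μ := by
      rw [hμ, ← integral_const_mul]
      refine setIntegral_congr_fun hΩm fun z hz => ?_
      rw [hθ k z hz]; ring
    rw [e1, ← mul_assoc] at h1
    refine h1.congr fun t => setIntegral_congr_fun hΩm fun z hz => ?_
    rw [hΦ t z hz]; ring
  have hne : ((-1) ^ j * κ : ℂ) ≠ 0 := by
    rw [← norm_ne_zero_iff, norm_mul, hκ]; simp
  have hnorm : ‖((-1) ^ j * κ : ℂ)‖ = 1 := by rw [norm_mul, hκ]; simp
  have hlow : ∀ ρ ∈ P, ∃ c : ℝ, 0 < c ∧ ∀ m : ℕ, ∀ᶠ t in atTop,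
      c * ρ ^ (2 * m) ≤ ‖∫ z in Ω, Φ t z * (‖z‖ : ℂ) ^ (2 * m)‖ := by
    intro ρ hρ
    obtain ⟨ρ', hρ', hlt⟩ := gap ρ hρ
    exact exists_le_norm_integral_truncate s hWs hW0 hWc (pos ρ hρ) hlt (hP ρ' hρ')
  have hdiag : ∀ z : ℂ, ∀ k : ℕ, z ^ k * conj z ^ k = (‖z‖ : ℂ) ^ (2 * k) := by
    intro z k
    rw [← mul_pow, mul_conj, normSq_eq_norm_sq, pow_mul]; norm_cast
  refine ⟨hae, smooth, memLp, poly, ?_, ?_, ?_, pos, gap, ?_, synth⟩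
  · intro g hg hgL hg0 k
    have h1 := ibp g hg hgL k
    have e : ∀ t, ∫ z in Ω, (wd I)^[j] g z * (Φ t z * conj z ^ k) = 0 := fun t =>
      setIntegral_eq_zero_of_forall_eq_zero fun z hz => by
        rw [show (wd I)^[j] g z = 0 from hg0 z hz, zero_mul]
    simp only [e] at h1
    exact (mul_eq_zero.1 (tendsto_nhds_unique h1 tendsto_const_nhds)).resolve_left hne
  · intro g hg hgL hg0 horth
    -- `∂̄^j g` is holomorphic, and orthogonality to all `U k` says that its moments for the weights
    -- `Φ t` tend to zero.
    have hH : DifferentiableOn ℂ ((wd I)^[j] g) Ω := by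
      refine holo_of_dzbar_eq_zero (wd_iter_contDiffOn j hg) fun z hz => ?_
      have := hg0 z hz
      rwa [Function.iterate_succ_apply'] at this
    obtain ⟨ρ, hρ⟩ := hPne
    have h0 : (0 : ℂ) ∈ Ω := hP ρ hρ (by simpa using (pos ρ hρ).le)
    refine eq_zero_of_tendsto_moments hH hΩ h0 hΦrad (fun t => (Φ t).continuous)
      (fun t => exists_closedBall hrad (Φ t)) (fun m => ?_) fun m => ?_
    · obtain ⟨c, hc0, hc⟩ := hlow ρ hρ
      exact ⟨c * ρ ^ (2 * m), mul_pos hc0 (pow_pos (pos ρ hρ) _), hc m⟩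
    · have h1 := ibp g hg hgL m
      rw [horth m, mul_zero] at h1
      refine h1.congr fun t => ?_
      congr 1; funext z; rw [dzbar_eq_wd]; ring
  · intro k l hkl
    obtain ⟨c, -, hc⟩ := hlam l
    have h1 := ibp (U l) (smooth l) (memLp l) k
    -- `∂̄^j (U l)` is a multiple of `z^l`, so the integrals before the limit vanish by rotational
    -- symmetry.
    have e : ∀ t, ∫ z in Ω, (wd I)^[j] (U l) z * (Φ t z * conj z ^ k) = 0 := by
      intro t
      have e1 : ∫ z in Ω, (wd I)^[j] (U l) z * (Φ t z * conj z ^ k) =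
          ∫ z in Ω, c * (Φ t z * (z ^ l * conj z ^ k)) := by
        refine setIntegral_congr_fun hΩm fun z hz => ?_
        rw [hc z hz]; ring
      rw [e1, integral_const_mul, setIntegral_eq_integral_of_forall_compl_eq_zero fun z hz => by
        rw [hΦout t z hz, zero_mul], integral_radial_monomial (hΦrad t) hkl.symm, mul_zero]
    simp only [e] at h1
    exact (mul_eq_zero.1 (tendsto_nhds_unique h1 tendsto_const_nhds)).resolve_left hne
  · intro ρ hρ
    obtain ⟨c, hc0, hc⟩ := hlow ρ hρ
    refine ⟨√c, Real.sqrt_pos.2 hc0, fun k => ?_⟩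
    obtain ⟨l, hl1, hl⟩ := hlam k
    have h1 := (ibp (U k) (smooth k) (memLp k) k).norm
    rw [norm_mul, hnorm, one_mul] at h1
    rw [mul_pow, Real.sq_sqrt hc0.le, ← pow_mul, mul_comm k 2]
    refine ge_of_tendsto h1 ?_
    filter_upwards [hc k] with t ht
    -- The squared norm is the limit of `l` times moments of `|z|^{2k}`. Since `|l| ≥ 1`, it
    -- inherits their lower bound.
    have e1 : ∫ z in Ω, (wd I)^[j] (U k) z * (Φ t z * conj z ^ k) =
        l * ∫ z in Ω, Φ t z * (‖z‖ : ℂ) ^ (2 * k) := by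
      rw [← integral_const_mul]
      refine setIntegral_congr_fun hΩm fun z hz => ?_
      rw [hl z hz, ← hdiag]; ring
    rw [e1, norm_mul]
    exact ht.trans (le_mul_of_one_le_left (norm_nonneg _) hl1)

end

end PolyToeplitz


namespace PolyToeplitz

noncomputable section

/-! ### Derivatives of powers of functions that are affine in `z̄` -/

lemma wd_id (c z : ℂ) : wd c (fun w => w) z = (1 + c * I) / 2 := by
  have h : HasFDerivAt (fun w : ℂ => w) (ContinuousLinearMap.id ℝ ℂ) z := hasFDerivAt_id z
  simp [wd, h.fderiv]; ring

/-- `∂̄^j (Q^j f) = j! β^j f` for holomorphic `f`, if `∂̄Q = β` is holomorphic. -/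
lemma dzbar_iter_pow_mul_holo {Ω : Opens ℂ} (j : ℕ) {Q β f : ℂ → ℂ} (hQ : ContDiffOn ℝ ∞ Q Ω)
    (hβ : DifferentiableOn ℂ β Ω) (hQβ : ∀ z ∈ Ω, wd I Q z = β z)
    (hf : DifferentiableOn ℂ f Ω) {z : ℂ} (hz : z ∈ Ω) :
    (wd I)^[j] (fun w => Q w ^ j * f w) z = j.factorial * β z ^ j * f z := by
  have hfs := holo_contDiffOn hf
  rw [wd_iter_pow_mul j j hQ (holo_contDiffOn hβ) hQβ
    (fun w hw => dzbar_holo ((hβ w hw).differentiableAt (Ω.isOpen.mem_nhds hw))) hfs hz,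
    Finset.sum_eq_single_of_mem 0 (by simp)]
  · simp [Nat.descFactorial_self]
  · intro a _ ha
    rw [((PA.of_holo hf).mono (Nat.one_le_iff_ne_zero.2 ha)).2 z hz, mul_zero]

/-! ### The disk -/

lemma wd_diskBoundary (c z : ℂ) :
    wd c (fun w => 1 - w * conj w) z = -((1 + c * I) / 2 * conj z + z * ((1 - c * I) / 2)) := by
  have h1 : DifferentiableAt ℝ (fun w : ℂ => conj w) z :=
    (contDiff_conj.differentiable (by simp)) z
  rw [wd_sub_at (differentiableAt_const _) (differentiableAt_fun_id.fun_mul h1),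
    wd_mul_at differentiableAt_fun_id h1, wd_id, wd_conj_id, wd_const]
  ring

lemma contDiff_diskWeight : ContDiff ℝ ∞ fun z : ℂ => 1 - z * conj z :=
  contDiff_const.sub (contDiff_id.mul contDiff_conj)

lemma diskBoundary_eq (z : ℂ) : (diskBoundary.toFun z : ℂ) = 1 - z * conj z := by
  rw [mul_conj, normSq_eq_norm_sq]
  simp [diskBoundary]

lemma diskWeight_ne {z : ℂ} (hz : z ∈ disk) : 1 - z * conj z ≠ 0 := by
  rw [← diskBoundary_eq]
  exact diskBoundary.ne hz

/-- The restrictions to the disk of smooth functions on the plane. -/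
def diskAlg : BdryAlg diskBoundary where
  v z := 1 - z * conj z
  N :=
    { carrier := {g | ∃ G : ℂ → ℂ, ContDiff ℝ ∞ G ∧ Set.EqOn g G disk}
      add_mem' := by
        rintro g g' ⟨G, hG, e⟩ ⟨G', hG', e'⟩
        exact ⟨_, hG.add hG', fun z hz => by rw [Pi.add_apply, e hz, e' hz]⟩
      zero_mem' := ⟨fun _ => 0, contDiff_const, fun _ _ => rfl⟩
      smul_mem' := by
        rintro c g ⟨G, hG, e⟩
        exact ⟨_, contDiff_const.mul hG, fun z hz => by rw [Pi.smul_apply, e hz, smul_eq_mul]⟩ }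
  v_smooth := contDiff_diskWeight.contDiffOn
  v_ne _ hz := diskWeight_ne hz
  smooth := by
    rintro g ⟨G, hG, e⟩
    exact hG.contDiffOn.congr e
  congr := by
    rintro g ⟨G, hG, e⟩ g' e'
    exact ⟨G, hG, e'.symm.trans e⟩
  deriv_mem := by
    rintro c g ⟨G, hG, e⟩
    exact ⟨_, contDiff_diskWeight.mul (wd_contDiff hG), fun z hz => by
      beta_reduce; rw [wd_congr e hz]⟩
  dv_mem := by
    rintro c g ⟨G, hG, e⟩
    exact ⟨_, (wd_contDiff contDiff_diskWeight).mul hG, fun z hz => by beta_reduce; rw [e hz]⟩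
  ds_mem := by
    rintro c g ⟨G, hG, e⟩
    refine ⟨_, (wd_contDiff (c := c) contDiff_diskWeight).mul hG, fun z hz => ?_⟩
    -- Here `v` and `s` coincide, so `v ∂s / s` is simply the smooth function `∂s`.
    have h1 : (fun w => (diskBoundary.toFun w : ℂ)) = fun w => 1 - w * conj w :=
      funext diskBoundary_eq
    have h2 := diskWeight_ne hz
    beta_reduce
    rw [h1, diskBoundary_eq, e hz]
    field_simp

lemma mem_diskAlg {g : ℂ → ℂ} (hg : ContDiff ℝ ∞ g) : g ∈ diskAlg.N := ⟨g, hg, fun _ _ => rfl⟩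

/-- `c_a` contains the factor `(1 - |z|²)^a = v^a`; the remaining factors are smooth on the plane.
-/
lemma diskAlg_coeffMem (j : ℕ) : CoeffMem diskAlg j (diskCoeff j) := by
  intro a _ b _ m hm
  have h1 := hm.vpow_mul (a + b)
  have hk : (0 - (a : ℤ) - (b : ℤ)) + ((a + b : ℕ) : ℤ) = 0 := by push_cast; ring
  rw [hk] at h1
  have hw : ContDiff ℝ ∞ fun z : ℂ => (j.choose a : ℂ) * ((j.factorial : ℂ) / (a.factorial : ℂ)) *
      (-conj z) ^ (j - a) * ((j.choose b : ℂ) * ((j.factorial : ℂ) / (b.factorial : ℂ)) *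
      (-z) ^ (j - b)) :=
    (contDiff_const.mul (contDiff_conj.neg.pow _)).mul
      (contDiff_const.mul (contDiff_id.neg.pow _))
  refine (h1.mul_of (w := fun z => (j.choose a : ℂ) * ((j.factorial : ℂ) / (a.factorial : ℂ)) *
      (-conj z) ^ (j - a) * ((j.choose b : ℂ) * ((j.factorial : ℂ) / (b.factorial : ℂ)) *
      (-z) ^ (j - b))) (fun g hg => ?_)).congr fun z _ => ?_
  · obtain ⟨G, hG, e⟩ := hg
    exact ⟨_, hw.mul hG, fun z hz => by beta_reduce; rw [e hz]⟩
  · simp only [diskCoeff, map_mul, map_pow, map_div₀, map_natCast, map_neg, map_sub, map_one,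
      conj_conj, diskAlg]
    ring

/-- The Leibniz rule with `Q = 1 - |z|²`, whose derivative `∂Q = -z̄` is annihilated by `∂`. -/
lemma diskBasis_eq (j k : ℕ) {z : ℂ} (hz : z ∈ disk) :
    diskBasis j k z = holoOp j (diskCoeff j) (fun w => w ^ k) z := by
  have hf : DifferentiableOn ℂ (fun w : ℂ => w ^ k) (disk : Set ℂ) :=
    (differentiable_id.pow k).differentiableOn
  rw [diskBasis, dz_eq_wd, wd_iter_pow_mul j j (Ω := disk) (β := fun w => -conj w)
    contDiff_diskWeight.contDiffOn contDiff_conj.neg.contDiffOn (fun w _ => by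
      rw [wd_diskBoundary]; ring_nf; rw [I_sq]; ring) (fun w _ => by
      have := wd_const_mul (c := -I) (-1) (fun w => conj w) w
      simp only [neg_one_mul] at this
      rw [this, wd_conj_id]; ring_nf; simp) (holo_contDiffOn hf) hz, holoOp]
  refine Finset.sum_congr rfl fun a ha => ?_
  have ha' : a ≤ j := by simpa [Nat.lt_succ_iff] using ha
  have h1 : j - (j - a) = a := by omega
  have h2 : (j.descFactorial (j - a) : ℂ) = (j.factorial : ℂ) / (a.factorial : ℂ) := by
    have := Nat.factorial_mul_descFactorial (Nat.sub_le j a)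
    rw [h1] at this
    rw [← this]
    have := Nat.factorial_ne_zero a
    push_cast
    field_simp
  rw [dz_iter_holo a hf hz, diskCoeff, h1, h2]
  ring

/-- `c_a` has degree `(j - a) + a = j` in `z̄`. -/
lemma diskCoeff_pa (j : ℕ) : PACoeff disk j (diskCoeff j) := by
  intro a ha f hf
  have h1 := PA.lin_pow_mul (Ω := disk) (α := fun _ => 0) (β := fun _ => -1)
    (differentiable_const _).differentiableOn (differentiable_const _).differentiableOn
    (PA.of_holo (hf.const_mul ((j.choose a : ℂ) * ((j.factorial : ℂ) / (a.factorial : ℂ))))) (j - a)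
  have h2 := PA.lin_pow_mul (α := fun _ => 1) (β := fun z => -z)
    (differentiable_const _).differentiableOn differentiable_id.neg.differentiableOn h1 a
  refine (h2.mono (by omega)).congr fun z _ => ?_
  simp only [diskCoeff]
  ring

lemma diskBasis_contDiff (j k : ℕ) : ContDiff ℝ ∞ (diskBasis j k) := by
  rw [diskBasis, dz_eq_wd]
  have h : ContDiffOn ℝ ∞ (fun z : ℂ => (1 - z * conj z) ^ j * z ^ k) ((⊤ : Opens ℂ) : Set ℂ) :=
    ((contDiff_diskWeight.pow j).mul (contDiff_id.pow k)).contDiffOn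
  exact contDiffOn_univ.1 (wd_iter_contDiffOn (c := -I) j h)

lemma memLp_disk {g : ℂ → ℂ} (hg : g ∈ diskAlg.N) :
    MemLp g 2 (volume.restrict (disk : Set ℂ)) := by
  obtain ⟨G, hG, e⟩ := hg
  obtain ⟨C, hC⟩ := (isCompact_closedBall (0 : ℂ) 1).exists_bound_of_continuousOn
    hG.continuous.continuousOn
  have hfin : IsFiniteMeasure (volume.restrict (disk : Set ℂ)) :=
    ⟨by rw [Measure.restrict_apply_univ]; exact measure_ball_lt_top⟩
  have hm : ∀ᵐ z ∂volume.restrict (disk : Set ℂ), z ∈ (disk : Set ℂ) :=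
    ae_restrict_mem disk.isOpen.measurableSet
  refine MemLp.ae_eq (f := G) (hm.mono fun z hz => (e hz).symm) ?_
  exact MemLp.of_bound hG.continuous.aestronglyMeasurable C
    (hm.mono fun z hz => hC z (Metric.ball_subset_closedBall hz))

/-- `∂̄^j` commutes with `∂^j`, and `∂̄^j ((1 - |z|²)^j z^k) = j! (-z)^j z^k` because `∂̄(1 - |z|²)
= -z` is holomorphic. -/
lemma dzbar_iter_diskBasis (j k : ℕ) {z : ℂ} (hz : z ∈ disk) :
    (wd I)^[j] (diskBasis j k) z =
      ((-1) ^ j * j.factorial * (k + j).descFactorial j : ℂ) * z ^ k := by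
  have hs : ContDiffOn ℝ ∞ (fun z : ℂ => (1 - z * conj z) ^ j * z ^ k) (disk : Set ℂ) :=
    ((contDiff_diskWeight.pow j).mul (contDiff_id.pow k)).contDiffOn
  have h1 : Set.EqOn ((wd I)^[j] fun z : ℂ => (1 - z * conj z) ^ j * z ^ k)
      (fun z => ((-1) ^ j * j.factorial : ℂ) * z ^ (k + j)) disk := by
    intro w hw
    rw [dzbar_iter_pow_mul_holo (Ω := disk) j (β := fun z => -z)
      contDiff_diskWeight.contDiffOn differentiable_id.neg.differentiableOn (fun w _ => by
        rw [wd_diskBoundary]; ring_nf; rw [I_sq]; ring)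
      (differentiableOn_pow k) hw, neg_pow]
    ring
  rw [diskBasis, dz_eq_wd, wd_iter_iter_comm j j hs hz, wd_iter_congr j h1 hz, wd_iter_const_mul,
    dz_iter_holo (Ω := disk) j (differentiableOn_pow (k + j)) hz]
  have := iter_deriv_pow (𝕜 := ℂ) (k + j) z j
  have hp : ∏ i ∈ Finset.range j, (((k + j : ℕ) : ℂ) - i) = ((k + j).descFactorial j : ℂ) := by
    rw [Nat.descFactorial_eq_prod_range, Nat.cast_prod]
    refine Finset.prod_congr rfl fun i hi => ?_
    rw [Nat.cast_sub (by have := Finset.mem_range.1 hi; omega)]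
  rw [this, hp, Nat.add_sub_cancel]; ring

/-! ### Orthogonal basis and Toeplitz operators on the disk -/

lemma mem_disk {z : ℂ} : z ∈ disk ↔ ‖z‖ < 1 := by simp [disk]

lemma exists_disk_bound {K : Set ℂ} (hK : IsCompact K) (hKd : K ⊆ (disk : Set ℂ)) :
    ∃ ρ ∈ Set.Ioo (0 : ℝ) 1, ∀ z ∈ K, ‖z‖ ≤ ρ := by
  rcases K.eq_empty_or_nonempty with rfl | hne
  · exact ⟨1 / 2, ⟨by norm_num, by norm_num⟩, fun z hz => absurd hz (Set.notMem_empty z)⟩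
  · obtain ⟨x, hx, hmax⟩ := hK.exists_isMaxOn hne continuous_norm.continuousOn
    have hx1 : ‖x‖ < 1 := mem_disk.1 (hKd hx)
    exact ⟨max ‖x‖ (1 / 2), ⟨lt_max_of_lt_right (by norm_num), max_lt hx1 (by norm_num)⟩,
      fun z hz => (hmax hz).trans (le_max_left _ _)⟩

lemma exists_gt_Ioo : ∀ ρ ∈ Set.Ioo (0 : ℝ) 1, ∃ ρ' ∈ Set.Ioo (0 : ℝ) 1, ρ < ρ' :=
  fun ρ hρ => ⟨(ρ + 1) / 2, ⟨by linarith [hρ.1], by linarith [hρ.2]⟩, by linarith [hρ.2]⟩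

/-- Here `θ_k = (1 - |z|²)^j z̄^k` is the conjugate of the function whose `∂^j` is `u_k`, so `∂̄^j
θ_k = ū_k` with weight and sign equal to one. -/
theorem disk_polyBasis (j : ℕ) :
    PolyBasis disk (volume.restrict (disk : Set ℂ)) j (Set.Ioo 0 1) (diskBasis j) := by
  have hW : ∀ z : ℂ, (((1 - ‖z‖ ^ 2) ^ j : ℝ) : ℂ) = (1 - z * conj z) ^ j := by
    intro z
    rw [← diskBoundary_eq]; simp [diskBoundary]
  have hpa : ∀ k, PA disk (j + 1) (diskBasis j k) := fun k =>
    ((diskCoeff_pa j).holoOp (differentiableOn_pow k)).congr fun z hz =>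
      diskBasis_eq j k hz
  refine PolyBasis.of_radial (A := diskAlg) (fun _ => 1) (fun z => (1 - ‖z‖ ^ 2) ^ j) 1 (by simp)
    (ae_restrict_mem disk.isOpen.measurableSet) (fun f => by simp) ?_ ?_
    (convex_ball (0 : ℂ) 1).isPreconnected (fun z w h => by simp [diskBoundary, h])
    (fun z w h => by simp [h]) (((contDiff_const.sub (contDiff_norm_sq ℝ)).pow j).contDiffOn)
    (fun z hz => pow_pos (diskBoundary.pos z hz) j) ?_ ?_ ?_
    (fun k => (diskBasis_contDiff j k).contDiffOn)
    (fun k => memLp_disk (mem_diskAlg (diskBasis_contDiff j k))) (fun k => (hpa k).2)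
    ⟨1 / 2, by norm_num, by norm_num⟩ (fun ρ hρ => hρ.1) exists_gt_Ioo ?_ ?_
  · intro g _ hgL m hm
    exact hgL.integrable_mul (memLp_disk hm)
  · intro z w hzw hz
    rw [mem_disk] at *
    linarith
  · intro k
    refine ⟨fun z => conj z ^ k, mem_diskAlg (contDiff_conj.pow k), fun z _ => ?_⟩
    beta_reduce
    rw [hW, zpow_natCast]; rfl
  · intro k z _
    have e : (fun z : ℂ => (((1 - ‖z‖ ^ 2) ^ j : ℝ) : ℂ) * conj z ^ k) =
        fun z => conj ((1 - z * conj z) ^ j * z ^ k) := by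
      funext z
      rw [hW]
      simp only [map_mul, map_pow, map_sub, map_one, conj_conj]
      ring
    rw [e, wd_iter_conj, conj_I, diskBasis, dz_eq_wd]; simp
  · intro k
    refine ⟨_, ?_, fun z hz => dzbar_iter_diskBasis j k hz⟩
    have h1 : 1 ≤ j.factorial * (k + j).descFactorial j :=
      Nat.one_le_iff_ne_zero.2 (mul_ne_zero (Nat.factorial_ne_zero j)
        (by rw [Ne, Nat.descFactorial_eq_zero_iff_lt]; omega))
    rw [mul_assoc, norm_mul, ← Nat.cast_mul, Complex.norm_natCast]
    simpa using (by exact_mod_cast h1 : (1 : ℝ) ≤ ((j.factorial * (k + j).descFactorial j : ℕ) : ℝ))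
  · intro ρ hρ z hz
    rw [SetLike.mem_coe, mem_disk]
    exact lt_of_le_of_lt (by simpa using hz) hρ.2
  · intro b hb
    obtain ⟨g, hg, hs⟩ := (diskCoeff_pa j).synth (P := Set.Ioo 0 1) (fun ρ hρ => hρ.1) exists_gt_Ioo
      (w := fun _ => 1) (ψ := fun z => z) (differentiable_const _).differentiableOn
      differentiable_id.differentiableOn (fun K hK hKd => exists_disk_bound hK hKd) b hb
    refine ⟨g, hg.1, hg.2, fun z hz => ?_⟩
    have := hs z hz
    simp only [one_mul] at this
    simpa only [diskBasis_eq j _ hz] using this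

theorem disk_toeplitz (j : ℕ) (F : CDistribution disk)
    (hF : (IsDiskSymbol F ∧ HasCompactSupportIn (opM j F) disk) ∨ HasCompactSupportIn F disk) :
    ∃ T, IsToeplitzDisk j F T ∧ IsCompactOperator T ∧ ∀ T', IsToeplitzDisk j F T' → T' = T := by
  have hN : ∀ g ∈ diskAlg.N, ∃ L, HasValue diskBoundary F g L := by
    rintro g ⟨G, hG, e⟩
    rcases hF with ⟨h, -⟩ | h
    · obtain ⟨L, hL⟩ := h G ⟨Set.univ, isOpen_univ, Set.subset_univ _, hG.contDiffOn⟩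
      exact ⟨L, hL.congr e⟩
    · exact exists_hasValue_of_hasCompactSupportIn h (hG.contDiffOn.congr e)
  have hv : HasCompactSupportIn (opM j F) disk := by
    rcases hF with ⟨-, h⟩ | h
    · exact h
    · exact h.transOp _
  obtain ⟨a, ha, hab⟩ := exists_matrix (diskAlg_coeffMem j) (diskCoeff_contDiff j) hN hv
    (P := Set.Ioo 0 1) (fun ρ hρ => hρ.1) exists_gt_Ioo
    (w := fun _ => 1) (ψ := fun z => z) (differentiable_const _).differentiableOn
    differentiable_id.differentiableOn (fun K hK hKd => exists_disk_bound hK hKd)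
    (fun k l => mem_diskAlg (((contDiff_const.mul (contDiff_id.pow k))).mul
      (contDiff_conj.comp (contDiff_const.mul (contDiff_id.pow l)))))
  have ha' : ∀ k l, HasValue diskBoundary F
      (fun z => diskBasis j k z * conj (diskBasis j l z)) (a k l) := fun k l => by
    refine (ha k l).congr fun z hz => ?_
    simp only [one_mul, diskBasis_eq j _ hz]
  obtain ⟨T, hT, hTc, hTu⟩ := (disk_polyBasis j).exists_toeplitz hab
  refine ⟨T, fun k l => ?_, hTc, fun T' hT' => hTu T' fun k l => ?_⟩
  · obtain ⟨u, v, hu, hv, e⟩ := hT k l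
    exact ⟨u, v, hu, hv, e ▸ ha' k l⟩
  · obtain ⟨u, v, hu, hv, e⟩ := hT' k l
    exact ⟨u, v, hu, hv, (ha' k l).unique e⟩

end

end PolyToeplitz


namespace PolyToeplitz

noncomputable section

/-! ### Tempered distributions -/

/-- The restriction of a tempered distribution to test functions. -/
def restrictTest (G : 𝓢'(ℂ, ℂ)) : CDistribution ⊤ :=
  TestFunction.limitCLM ℂ (fun φ => G (φ.hasCompactSupport.toSchwartzMap φ.contDiff))
    (fun K hK => ContDiffMapSupportedIn.mkCLMtoNormedSpace ℂ
      (fun φ => G (φ.hasCompactSupport.toSchwartzMap φ.contDiff))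
      (fun φ χ => by rw [← map_add]; congr 1)
      (fun c φ => by rw [← map_smul]; congr 1)
      (by
        obtain ⟨S, C, -, hC⟩ := Seminorm.bound_of_continuous (schwartz_withSeminorms ℂ ℂ ℂ)
          ((normSeminorm ℂ ℂ).comp (G : 𝓢(ℂ, ℂ) →L[ℂ] ℂ).toLinearMap)
          (continuous_norm.comp (G : 𝓢(ℂ, ℂ) →L[ℂ] ℂ).continuous)
        obtain ⟨R, hR⟩ := K.isCompact.exists_bound_of_continuousOn
          (f := fun z : ℂ => z) continuousOn_id
        set M := S.sup Prod.fst
        -- On `K` the polynomial weights of the finitely many Schwartz seminorms involved are at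
        -- most `(max 1 R)^M`, `M` being the largest exponent.
        refine ⟨S.image Prod.snd, C * (max 1 R) ^ M, by positivity, fun φ => ?_⟩
        have h0 : (0 : ℝ) ≤ ((S.image Prod.snd).sup fun i =>
            ContDiffMapSupportedIn.seminorm ℂ ℂ ℂ ⊤ K i) φ := apply_nonneg _ _
        refine (show ‖G _‖ ≤ _ from Seminorm.le_def.1 hC _).trans ?_
        rw [smul_apply, NNReal.smul_def, smul_eq_mul, mul_assoc]
        refine mul_le_mul_of_nonneg_left ?_ C.2
        refine Seminorm.finset_sup_apply_le (by positivity) fun p hp => ?_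
        refine SchwartzMap.seminorm_le_bound ℂ p.1 p.2 _ (by positivity) fun x => ?_
        by_cases hx : x ∈ K
        · refine mul_le_mul ?_ ?_ (norm_nonneg _) (by positivity)
          · calc ‖x‖ ^ p.1 ≤ (max 1 R) ^ p.1 := by
                  gcongr; exact (hR x hx).trans (le_max_right _ _)
              _ ≤ (max 1 R) ^ M := pow_le_pow_right₀ (le_max_left _ _)
                  (Finset.le_sup (f := Prod.fst) hp)
          · refine (ContDiffMapSupportedIn.norm_iteratedFDeriv_apply_le_seminorm_top ℂ).trans ?_
            exact Seminorm.le_def.1 (Finset.le_sup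
              (f := fun i => ContDiffMapSupportedIn.seminorm ℂ ℂ ℂ ⊤ K i)
              (Finset.mem_image_of_mem Prod.snd hp)) φ
        · have : iteratedFDeriv ℝ p.2 φ x = 0 := by
            by_contra hcon
            exact hx (φ.tsupport_subset (support_iteratedFDeriv_subset p.2 hcon))
          change ‖x‖ ^ p.1 * ‖iteratedFDeriv ℝ p.2 φ x‖ ≤ _
          rw [this, norm_zero, mul_zero]
          positivity))
    (fun _ _ _ => rfl)

lemma tempered_eq_of_isVanishingOn {G : 𝓢'(ℂ, ℂ)} {K V : Set ℂ}
    (hG : Distribution.IsVanishingOn G Kᶜ) (hV : IsOpen V) (hKV : K ⊆ V) {φ χ : 𝓢(ℂ, ℂ)}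
    (h : Set.EqOn φ χ V) : G φ = G χ := by
  have h1 : G (φ - χ) = 0 := by
    refine hG _ ?_
    have h2 : tsupport (φ - χ : 𝓢(ℂ, ℂ)) ⊆ Vᶜ := by
      refine closure_minimal (fun z hz hzV => hz ?_) hV.isClosed_compl
      have : (φ - χ) z = φ z - χ z := rfl
      rw [this, h hzV, sub_self]
    exact h2.trans (Set.compl_subset_compl.2 hKV)
  rwa [map_sub, sub_eq_zero] at h1

/-- The Wirtinger derivative of a Schwartz function. -/
def wdSchwartz (c : ℂ) (φ : 𝓢(ℂ, ℂ)) : 𝓢(ℂ, ℂ) := (1 / 2 : ℂ) • (∂_{(1 : ℂ)} φ + c • ∂_{I} φ)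

lemma wdSchwartz_apply (c : ℂ) (φ : 𝓢(ℂ, ℂ)) : (wdSchwartz c φ : ℂ → ℂ) = wd c φ := rfl

/-- The Laplacian in terms of Wirtinger derivatives. -/
lemma laplacian_eq_wd (φ : 𝓢(ℂ, ℂ)) (z : ℂ) : (Δ φ : 𝓢(ℂ, ℂ)) z = 4 * wd (-I) (wd I φ) z := by
  -- Averaging over the two orders makes the mixed derivatives in `x` and `y` cancel term by term.
  have h1 : wd (-I) (wd I φ) z = (1 / 2) * (wdSchwartz (-I) (wdSchwartz I φ) z +
      wdSchwartz I (wdSchwartz (-I) φ) z) := by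
    have h := wd_comm_at (c := I) (d := -I) (φ.smooth'.contDiffAt (x := z))
    simp only [wdSchwartz_apply]
    change _ = (1 / 2) * (wd (-I) (wd I φ) z + wd I (wd (-I) φ) z)
    have h' : wd I (wd (-I) φ) z = wd (-I) (wd I φ) z := h
    rw [h']; ring
  have h2 : (Δ φ : 𝓢(ℂ, ℂ)) = ∂_{(1 : ℂ)} (∂_{(1 : ℂ)} φ) + ∂_{I} (∂_{I} φ) := by
    rw [SchwartzMap.laplacian_eq_sum Complex.orthonormalBasisOneI]
    simp
  rw [h1, h2]
  simp only [wdSchwartz, LineDeriv.lineDerivOp_smul, LineDeriv.lineDerivOp_add]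
  simp only [add_apply, smul_apply, smul_eq_mul]
  linear_combination ((∂_{I} (∂_{I} φ) : 𝓢(ℂ, ℂ)) z) * I_mul_I

lemma laplacian_iter_eq_wd (k : ℕ) (φ : 𝓢(ℂ, ℂ)) (z : ℂ) :
    ((Δ : 𝓢(ℂ, ℂ) → 𝓢(ℂ, ℂ))^[k] φ) z = 4 ^ k * (wd (-I))^[k] ((wd I)^[k] φ) z := by
  induction k generalizing z with
  | zero => simp
  | succ k ih =>
    have hs : ContDiffOn ℝ ∞ φ ((⊤ : Opens ℂ) : Set ℂ) := φ.smooth'.contDiffOn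
    have hk := wd_iter_contDiffOn (c := I) k hs
    rw [Function.iterate_succ_apply', laplacian_eq_wd, funext ih]
    have h1 : wd I (fun z => 4 ^ k * (wd (-I))^[k] ((wd I)^[k] φ) z) =
        fun z => 4 ^ k * (wd (-I))^[k] ((wd I)^[k + 1] φ) z := by
      funext w
      rw [wd_const_mul, Function.iterate_succ_apply' (wd I),
        wd_iter_comm (c := I) (d := -I) k hk (Opens.mem_top w)]
    rw [h1, wd_const_mul, ← Function.iterate_succ_apply' (wd (-I))]
    ring

/-- The formal transpose of `opD`. -/
def opDTest (q : ℕ) (φ : 𝓢(ℂ, ℂ)) : 𝓢(ℂ, ℂ) :=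
  ∑ k ∈ Finset.range (q + 1), ((q.choose k : ℂ) * ((q.factorial : ℂ) / (k.factorial : ℂ)) *
    (1 / 4) ^ k) • (Δ : 𝓢(ℂ, ℂ) → 𝓢(ℂ, ℂ))^[k] φ

lemma opD_apply (q : ℕ) (F : 𝓢'(ℂ, ℂ)) (φ : 𝓢(ℂ, ℂ)) : opD q F φ = F (opDTest q φ) := by
  have h : ∀ (k : ℕ) (φ : 𝓢(ℂ, ℂ)), (Δ : 𝓢'(ℂ, ℂ) → 𝓢'(ℂ, ℂ))^[k] F φ =
      F ((Δ : 𝓢(ℂ, ℂ) → 𝓢(ℂ, ℂ))^[k] φ) := by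
    intro k
    induction k with
    | zero => intro φ; rfl
    | succ k ih =>
      intro φ
      rw [Function.iterate_succ_apply', TemperedDistribution.laplacian_apply_apply, ih,
        ← Function.iterate_succ_apply]
  have hcoe : ∀ (s : Finset ℕ) (X : ℕ → 𝓢'(ℂ, ℂ)), (∑ a ∈ s, X a) φ = ∑ a ∈ s, X a φ := by
    intro s X
    induction s using Finset.cons_induction with
    | empty => simp
    | cons a s ha ih => rw [Finset.sum_cons, Finset.sum_cons, ← ih]; rfl
  rw [opD, opDTest, hcoe, map_sum]
  refine Finset.sum_congr rfl fun k _ => ?_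
  rw [map_smul, ← h]; rfl

lemma opDTest_apply (q : ℕ) (φ : 𝓢(ℂ, ℂ)) (z : ℂ) : opDTest q φ z =
    ∑ k ∈ Finset.range (q + 1), (q.choose k : ℂ) * ((q.factorial : ℂ) / (k.factorial : ℂ)) *
      (wd (-I))^[k] ((wd I)^[k] φ) z := by
  rw [opDTest, sum_apply]
  refine Finset.sum_congr rfl fun k _ => ?_
  rw [smul_apply, laplacian_iter_eq_wd, smul_eq_mul]
  have : ((1 : ℂ) / 4) ^ k * 4 ^ k = 1 := by rw [← mul_pow]; norm_num
  linear_combination ((q.choose k : ℂ) * ((q.factorial : ℂ) / (k.factorial : ℂ)) *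
      (wd (-I))^[k] ((wd I)^[k] φ) z) * this

lemma HasCompactSupportIn.opD {F : 𝓢'(ℂ, ℂ)} (hF : HasCompactSupportIn F ⊤) (q : ℕ) :
    HasCompactSupportIn (PolyToeplitz.opD q F) ⊤ := by
  obtain ⟨K, hK, hKΩ, hv⟩ := hF
  refine ⟨K, hK, hKΩ, fun φ hφ => ?_⟩
  rw [opD_apply]
  refine hv _ (Set.Subset.trans ?_ hφ)
  refine closure_minimal (fun z hz => ?_) (isClosed_tsupport _)
  by_contra hcon
  refine hz ?_
  have h1 : Set.EqOn φ (fun _ => (0 : ℂ)) (tsupport φ)ᶜ := fun w hw =>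
    image_eq_zero_of_notMem_tsupport hw
  have hO := (isClosed_tsupport φ).isOpen_compl
  rw [opDTest_apply]
  refine Finset.sum_eq_zero fun k _ => ?_
  rw [wd_iter_congr_open hO (wd_iter_congr_open hO h1 I k) (-I) k hcon, wd_iter_zero, wd_iter_zero,
    mul_zero]

end

end PolyToeplitz


namespace PolyToeplitz

noncomputable section

/-! ### The Fock weight -/

lemma contDiffOn_top {f : ℂ → ℂ} : ContDiffOn ℝ ∞ f ((⊤ : Opens ℂ) : Set ℂ) ↔ ContDiff ℝ ∞ f := by
  rw [Opens.coe_top, contDiffOn_univ]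

/-- The Gaussian weight of the Fock space. -/
def gw (z : ℂ) : ℂ := ((Real.pi⁻¹ * Real.exp (-‖z‖ ^ 2) : ℝ) : ℂ)

lemma gw_eq (z : ℂ) : gw z = (Real.pi : ℂ)⁻¹ * cexp (-(z * conj z)) := by
  rw [gw, mul_conj, normSq_eq_norm_sq]; push_cast; ring

lemma gw_ne (z : ℂ) : gw z ≠ 0 := by
  rw [gw, ofReal_ne_zero]
  have := Real.pi_pos
  positivity

lemma conj_gw (z : ℂ) : conj (gw z) = gw z := conj_ofReal _

lemma contDiff_gw : ContDiff ℝ ∞ gw := by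
  have h : gw = fun z => (Real.pi : ℂ)⁻¹ * cexp (-(z * conj z)) := funext gw_eq
  rw [h]
  exact contDiff_const.mul ((contDiff_id.mul contDiff_conj).neg.cexp)

lemma wd_cexp {u : ℂ → ℂ} {c z : ℂ} (hu : DifferentiableAt ℝ u z) :
    wd c (fun w => cexp (u w)) z = cexp (u z) * wd c u z := by
  have h := hu.hasFDerivAt.cexp
  simp only [wd, h.fderiv, smul_apply, smul_eq_mul]
  ring

lemma wd_gw (c z : ℂ) :
    wd c gw z = -((1 + c * I) / 2 * conj z + z * ((1 - c * I) / 2)) * gw z := by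
  have h : gw = fun z => (Real.pi : ℂ)⁻¹ * cexp ((1 - z * conj z) - 1) :=
    funext fun z => by rw [gw_eq]; ring_nf
  have hd := (contDiff_diskWeight.differentiable (by simp)) z
  have e : wd c gw z = (Real.pi : ℂ)⁻¹ * (cexp ((1 - z * conj z) - 1) *
      wd c (fun z => (1 - z * conj z) - 1) z) := by
    rw [h, wd_const_mul, wd_cexp (hd.fun_sub (differentiableAt_const _))]
  rw [e, wd_sub_at hd (differentiableAt_const _), wd_diskBoundary, wd_const, gw_eq,
    show 1 - z * conj z - 1 = -(z * conj z) by ring]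
  ring

lemma dz_gw (z : ℂ) : wd (-I) gw z = -conj z * gw z := by
  rw [wd_gw]; ring_nf; rw [I_sq]; ring

lemma dzbar_gw (z : ℂ) : wd I gw z = -z * gw z := by
  rw [wd_gw]; ring_nf; rw [I_sq]; ring

/-! ### The operator `-∂ + z̄` -/

/-- The operator `-∂ + z̄`. -/
def fockOp (f : ℂ → ℂ) (z : ℂ) : ℂ := -dz f z + conj z * f z

variable {f g : ℂ → ℂ}

lemma fockOp_contDiff (hf : ContDiff ℝ ∞ f) : ContDiff ℝ ∞ (fockOp f) := by
  have h := wd_contDiff (c := -I) hf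
  rw [← dz_eq_wd] at h
  exact h.neg.add (contDiff_conj.mul hf)

lemma fockOp_iter_contDiff (hf : ContDiff ℝ ∞ f) (p : ℕ) : ContDiff ℝ ∞ (fockOp^[p] f) := by
  induction p with
  | zero => exact hf
  | succ p ih => rw [Function.iterate_succ_apply']; exact fockOp_contDiff ih

lemma dz_fockOp_iter (p : ℕ) (z : ℂ) :
    wd (-I) (fockOp^[p] f) z = conj z * fockOp^[p] f z - fockOp^[p + 1] f z := by
  rw [Function.iterate_succ_apply', fockOp, dz_eq_wd]; ring

lemma fockOp_const_mul (a : ℂ) (f : ℂ → ℂ) (z : ℂ) :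
    fockOp (fun w => a * f w) z = a * fockOp f z := by
  rw [fockOp, fockOp, dz_eq_wd, wd_const_mul]; ring

/-- The canonical commutation relation `[∂̄, -∂ + z̄] = 1`. -/
lemma dzbar_fockOp (hf : ContDiff ℝ ∞ f) (z : ℂ) :
    wd I (fockOp f) z = fockOp (wd I f) z + f z := by
  have h1 : wd I (wd (-I) f) z = wd (-I) (wd I f) z := wd_comm_at hf.contDiffAt
  have hd := (wd_contDiff (c := -I) hf).differentiable (by simp) z
  have hc := (contDiff_conj.differentiable (by simp)) z
  have hf' := (hf.differentiable (by simp)) z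
  have e : fockOp f = fun z => -1 * wd (-I) f z + conj z * f z := by
    funext w; rw [fockOp, dz_eq_wd]; ring
  rw [e, wd_add_at (hd.const_mul _) (hc.fun_mul hf'), wd_const_mul, wd_mul_at hc hf', h1,
    wd_conj_id, fockOp, dz_eq_wd]
  linear_combination (-f z / 2) * I_mul_I

lemma dzbar_fockOp_iter (hf : Differentiable ℂ f) (m : ℕ) :
    wd I (fockOp^[m] f) = fun z => (m : ℂ) * fockOp^[m - 1] f z := by
  have hs : ContDiff ℝ ∞ f := contDiffOn_top.1 (holo_contDiffOn hf.differentiableOn)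
  induction m with
  | zero =>
    funext z
    simpa using dzbar_holo hf.differentiableAt
  | succ m ih =>
    funext z
    rw [Function.iterate_succ_apply', dzbar_fockOp (fockOp_iter_contDiff hs m), ih,
      fockOp_const_mul]
    cases m with
    | zero => simp
    | succ m =>
      rw [Nat.add_sub_cancel, Nat.add_sub_cancel, ← Function.iterate_succ_apply' fockOp]
      push_cast; ring

lemma dzbar_iter_fockOp_iter (hf : Differentiable ℂ f) (q : ℕ) (z : ℂ) :
    (wd I)^[q] (fockOp^[q] f) z = q.factorial * f z := by
  induction q with
  | zero => simp
  | succ q ih =>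
    rw [Function.iterate_succ_apply, dzbar_fockOp_iter hf, wd_iter_const_mul, Nat.add_sub_cancel,
      ih, Nat.factorial_succ]
    push_cast; ring

/-- `∂ω = -z̄ ω`, so `-∂ + z̄` is `-∂` conjugated by the weight. -/
lemma dz_iter_gw_mul (hf : ContDiff ℝ ∞ f) (q : ℕ) (z : ℂ) :
    (wd (-I))^[q] (fun w => gw w * f w) z = (-1) ^ q * (gw z * fockOp^[q] f z) := by
  induction q generalizing z with
  | zero => simp
  | succ q ih =>
    have hd := (fockOp_iter_contDiff hf q).differentiable (by simp) z
    rw [Function.iterate_succ_apply', funext ih, wd_const_mul,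
      wd_mul_at (contDiff_gw.differentiable (by simp) z) hd, dz_gw, dz_fockOp_iter]
    ring

/-- Coefficients of `(-∂ + z̄)^q` on holomorphic functions. -/
def fockCoeff (q a : ℕ) (z : ℂ) : ℂ := (q.choose a : ℂ) * ((-1) ^ a * conj z ^ (q - a))

lemma fockCoeff_pa (q : ℕ) : PACoeff ⊤ q (fockCoeff q) := by
  intro a ha f hf
  have h1 := PA.lin_pow_mul (Ω := ⊤) (α := fun _ => 0) (β := fun _ => 1)
    (differentiable_const _).differentiableOn (differentiable_const _).differentiableOn
    (PA.of_holo (hf.const_mul ((q.choose a : ℂ) * (-1) ^ a))) (q - a)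
  refine (h1.mono (by omega)).congr fun z _ => ?_
  simp only [fockCoeff]
  ring

/-- `-∂` and multiplication by `z̄` commute, so the power is given by the binomial theorem. -/
lemma fockOp_iter_eq (hf : Differentiable ℂ f) (q : ℕ) :
    fockOp^[q] f = holoOp q (fockCoeff q) f := by
  induction q with
  | zero => funext z; simp [holoOp, fockCoeff]
  | succ q ih =>
    funext z
    have hz : z ∈ (⊤ : Opens ℂ) := Opens.mem_top z
    have hfa : ∀ a, Differentiable ℂ (deriv^[a] f) := fun a =>
      differentiableOn_univ.1 (holo_iter_deriv (Ω := ⊤) a hf.differentiableOn)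
    rw [Function.iterate_succ_apply', ih, fockOp, dz_eq_wd]
    have h1 : wd (-I) (holoOp q (fockCoeff q) f) z =
        ∑ a ∈ Finset.range (q + 1), fockCoeff q a z * deriv^[a + 1] f z := by
      have hs : ∀ a, ContDiff ℝ ∞ (fockCoeff q a) := fun a =>
        contDiff_const.mul (contDiff_const.mul (contDiff_conj.pow _))
      have h := wd_iter_sum (c := -I) (Ω := ⊤) 1 (Finset.range (q + 1))
        (fun a z => fockCoeff q a z * deriv^[a] f z) (fun a _ => contDiffOn_top.2
          ((hs a).mul (contDiffOn_top.1 (holo_contDiffOn (hfa a).differentiableOn)))) hz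
      refine h.trans (Finset.sum_congr rfl fun a _ => ?_)
      have h0 : wd (-I) (fockCoeff q a) z = 0 := by
        have e : fockCoeff q a = fun z => conj ((q.choose a : ℂ) * ((-1) ^ a * z ^ (q - a))) := by
          funext w; simp [fockCoeff]
        rw [e]
        exact wd_conj_holo (by fun_prop)
      rw [Function.iterate_one, wd_mul_at ((hs a).differentiable (by simp) z)
        (((hfa a) z).restrictScalars ℝ), h0, dz_holo ((hfa a) z), Function.iterate_succ_apply']
      ring
    rw [h1, holoOp, holoOp]
    have h2 := Finset.sum_choose_succ_mul
      (fun i n => (-1) ^ i * conj z ^ n * deriv^[i] f z) q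
    have h3 : ∑ a ∈ Finset.range (q + 1 + 1), fockCoeff (q + 1) a z * deriv^[a] f z =
        ∑ i ∈ Finset.range (q + 2), ((q + 1).choose i : ℂ) *
          ((-1) ^ i * conj z ^ (q + 1 - i) * deriv^[i] f z) :=
      Finset.sum_congr rfl fun a _ => by rw [fockCoeff]; ring
    rw [h3, h2, Finset.mul_sum, ← Finset.sum_neg_distrib, add_comm]
    congr 1
    · refine Finset.sum_congr rfl fun a ha => ?_
      have ha' : a ≤ q := by simpa [Nat.lt_succ_iff] using ha
      rw [fockCoeff, Nat.succ_sub ha', pow_succ]; ring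
    · refine Finset.sum_congr rfl fun a _ => ?_
      rw [fockCoeff]; ring

/-! ### Products of images under powers of `-∂ + z̄` -/

/-- `ω A^p f · conj (A^m g)`, where `A = -∂ + z̄`. -/
def fockProd (f g : ℂ → ℂ) (p m : ℕ) (z : ℂ) : ℂ :=
  gw z * (fockOp^[p] f z * conj (fockOp^[m] g z))

lemma contDiff_of_entire (hf : Differentiable ℂ f) : ContDiff ℝ ∞ f :=
  contDiffOn_top.1 (holo_contDiffOn hf.differentiableOn)

lemma fockProd_contDiff (hf : Differentiable ℂ f) (hg : Differentiable ℂ g) (p m : ℕ) :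
    ContDiff ℝ ∞ (fockProd f g p m) :=
  contDiff_gw.mul ((fockOp_iter_contDiff (contDiff_of_entire hf) p).mul
    (conjCLE.contDiff.comp (fockOp_iter_contDiff (contDiff_of_entire hg) m)))

/-- With `A = -∂ + z̄`, the term `z̄ A^p f` cancels against `∂ω = -z̄ ω`, and `∂ conj (A^m g)` is
the conjugate of `∂̄ A^m g = m A^{m-1} g`. -/
lemma dz_fockProd (hf : Differentiable ℂ f) (hg : Differentiable ℂ g) (p m : ℕ) (z : ℂ) :
    wd (-I) (fockProd f g p m) z = -fockProd f g (p + 1) m z + m * fockProd f g p (m - 1) z := by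
  have h1 := (fockOp_iter_contDiff (contDiff_of_entire hf) p).differentiable (by simp) z
  have h2s : ContDiff ℝ ∞ fun z => conj (fockOp^[m] g z) :=
    conjCLE.contDiff.comp (fockOp_iter_contDiff (contDiff_of_entire hg) m)
  have h2 := h2s.differentiable (by simp) z
  have e : fockProd f g p m = fun z => gw z * (fockOp^[p] f z * conj (fockOp^[m] g z)) := rfl
  rw [e, wd_mul_at (contDiff_gw.differentiable (by simp) z) (h1.fun_mul h2), wd_mul_at h1 h2,
    dz_gw, dz_fockOp_iter, wd_conj_at, map_neg, conj_I, neg_neg, dzbar_fockOp_iter hg]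
  simp only [fockProd, map_mul, map_natCast]
  ring

lemma dzbar_fockProd (hf : Differentiable ℂ f) (hg : Differentiable ℂ g) (m : ℕ) (z : ℂ) :
    wd I (fockProd f g 0 m) z = -fockProd f g 0 (m + 1) z := by
  have h1 := (contDiff_of_entire hf).differentiable (by simp) z
  have h2s : ContDiff ℝ ∞ fun z => conj (fockOp^[m] g z) :=
    conjCLE.contDiff.comp (fockOp_iter_contDiff (contDiff_of_entire hg) m)
  have h2 := h2s.differentiable (by simp) z
  have e : fockProd f g 0 m = fun z => gw z * (f z * conj (fockOp^[m] g z)) := rfl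
  rw [e, wd_mul_at (contDiff_gw.differentiable (by simp) z) (h1.fun_mul h2), wd_mul_at h1 h2,
    dzbar_gw, dzbar_holo hf.differentiableAt, wd_conj_at, conj_I, dz_fockOp_iter]
  simp only [fockProd, map_sub, map_mul, conj_conj, Function.iterate_zero, id]
  ring

lemma fockProd_zero (hf : Differentiable ℂ f) (hg : Differentiable ℂ g) (m : ℕ) (z : ℂ) :
    fockProd f g 0 m z = (-1) ^ m * (wd I)^[m] (fockProd f g 0 0) z := by
  induction m generalizing z with
  | zero => simp
  | succ m ih =>
    have h := dzbar_fockProd hf hg m z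
    rw [funext ih, wd_const_mul, ← Function.iterate_succ_apply' (wd I)] at h
    rw [pow_succ]
    linear_combination h

/-- Solves the recursion `P_{p+1,m} = -∂P_{p,m} + m P_{p,m-1}` down to `P_{0,0} = ω f ḡ`. For `i >
m` the truncated difference `m - i` is harmless because the falling factorial vanishes. -/
lemma fockProd_eq_sum (hf : Differentiable ℂ f) (hg : Differentiable ℂ g) (p : ℕ) :
    ∀ (m : ℕ) (z : ℂ), fockProd f g p m z = ∑ i ∈ Finset.range (p + 1), (p.choose i : ℂ) *
      ((m.descFactorial i : ℂ) * (-1) ^ (p - i + (m - i)) *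
        (wd (-I))^[p - i] ((wd I)^[m - i] (fockProd f g 0 0)) z) := by
  have hs : ∀ n k : ℕ, ContDiffOn ℝ ∞ ((wd (-I))^[n] ((wd I)^[k] (fockProd f g 0 0)))
      ((⊤ : Opens ℂ) : Set ℂ) := fun n k => wd_iter_contDiffOn n (wd_iter_contDiffOn k
        (contDiffOn_top.2 (fockProd_contDiff hf hg 0 0)))
  induction p with
  | zero => intro m z; simpa using fockProd_zero hf hg m z
  | succ p ih =>
    intro m z
    have h := dz_fockProd hf hg p m z
    have h1 : wd (-I) (fockProd f g p m) z = ∑ i ∈ Finset.range (p + 1), (p.choose i : ℂ) *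
        ((m.descFactorial i : ℂ) * (-1) ^ (p - i + (m - i)) *
          (wd (-I))^[p - i + 1] ((wd I)^[m - i] (fockProd f g 0 0)) z) := by
      rw [funext (ih m)]
      have h := wd_iter_sum (c := -I) (Ω := ⊤) 1 (Finset.range (p + 1))
        (fun i z => (p.choose i : ℂ) * ((m.descFactorial i : ℂ) * (-1) ^ (p - i + (m - i)) *
          (wd (-I))^[p - i] ((wd I)^[m - i] (fockProd f g 0 0)) z))
        (fun i _ => contDiffOn_const.mul (contDiffOn_const.mul (hs _ _))) (Opens.mem_top z)
      refine h.trans (Finset.sum_congr rfl fun i _ => ?_)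
      rw [Function.iterate_one, wd_const_mul, wd_const_mul, ← Function.iterate_succ_apply' (wd (-I))]
    have h2 := Finset.sum_choose_succ_mul (fun i n => (m.descFactorial i : ℂ) *
      (-1) ^ (n + (m - i)) * (wd (-I))^[n] ((wd I)^[m - i] (fockProd f g 0 0)) z) p
    have h3 : ∑ i ∈ Finset.range (p + 1), (p.choose i : ℂ) * ((m.descFactorial i : ℂ) *
        (-1) ^ (p + 1 - i + (m - i)) * (wd (-I))^[p + 1 - i] ((wd I)^[m - i]
          (fockProd f g 0 0)) z) = -wd (-I) (fockProd f g p m) z := by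
      rw [h1, ← Finset.sum_neg_distrib]
      refine Finset.sum_congr rfl fun i hi => ?_
      have hi' : i ≤ p := by simpa [Nat.lt_succ_iff] using hi
      rw [show p + 1 - i + (m - i) = p - i + (m - i) + 1 by omega,
        show p + 1 - i = p - i + 1 by omega, pow_succ]; ring
    have h4 : ∑ i ∈ Finset.range (p + 1), (p.choose i : ℂ) * ((m.descFactorial (i + 1) : ℂ) *
        (-1) ^ (p - i + (m - (i + 1))) * (wd (-I))^[p - i] ((wd I)^[m - (i + 1)]
          (fockProd f g 0 0)) z) = m * fockProd f g p (m - 1) z := by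
      rw [ih (m - 1) z, Finset.mul_sum]
      refine Finset.sum_congr rfl fun i _ => ?_
      cases m with
      | zero => simp
      | succ m =>
        rw [Nat.succ_descFactorial_succ, Nat.add_sub_cancel, Nat.succ_sub_succ]
        push_cast; ring
    rw [show p + 1 + 1 = p + 2 from rfl, h2, h3, h4, h]
    ring

/-- On the diagonal, with `k = q - i`, the exponent of the sign is `2k` and only the powers `∂^k
∂̄^k = (Δ/4)^k` remain: this is the transpose of `D_q` applied to `ω f ḡ`. -/
lemma fockProd_self (hf : Differentiable ℂ f) (hg : Differentiable ℂ g) (q : ℕ) (z : ℂ) :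
    fockProd f g q q z = ∑ k ∈ Finset.range (q + 1),
      (q.choose k : ℂ) * ((q.factorial : ℂ) / (k.factorial : ℂ)) *
        (wd (-I))^[k] ((wd I)^[k] (fockProd f g 0 0)) z := by
  rw [fockProd_eq_sum hf hg, ← Finset.sum_flip]
  refine Finset.sum_congr rfl fun k hk => ?_
  have hk' : k ≤ q := by simpa [Nat.lt_succ_iff] using hk
  have h1 : q - (q - k) = k := by omega
  have h2 : (q.descFactorial (q - k) : ℂ) = (q.factorial : ℂ) / (k.factorial : ℂ) := by
    have := Nat.factorial_mul_descFactorial (Nat.sub_le q k)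
    rw [h1] at this
    rw [← this]
    have := Nat.factorial_ne_zero k
    push_cast
    field_simp
  rw [h1, h2, Nat.choose_symm hk', ← two_mul, pow_mul]
  simp only [neg_one_sq, one_pow]
  ring

end

end PolyToeplitz


namespace PolyToeplitz

noncomputable section

/-! ### Gaussian times temperate growth -/

lemma temperate_fderiv {f : ℂ → ℂ} (hf : f.HasTemperateGrowth) :
    (fderiv ℝ f).HasTemperateGrowth := by
  refine ⟨hf.1.fderiv_right (by simp), fun n => ?_⟩
  obtain ⟨k, C, h⟩ := hf.2 (n + 1)
  exact ⟨k, C, fun x => by rw [norm_iteratedFDeriv_fderiv]; exact h x⟩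

lemma temperate_wd {f : ℂ → ℂ} (c : ℂ) (hf : f.HasTemperateGrowth) :
    (wd c f).HasTemperateGrowth := by
  have h : ∀ v : ℂ, (fun z => fderiv ℝ f z v).HasTemperateGrowth := fun v =>
    (ContinuousLinearMap.apply ℝ ℂ v).hasTemperateGrowth.comp (temperate_fderiv hf)
  have h1 := h 1
  have h2 := h I
  unfold wd
  fun_prop

lemma temperate_conj : (fun z : ℂ => conj z).HasTemperateGrowth :=
  conjCLE.hasTemperateGrowth

lemma temperate_fockOp_iter {f : ℂ → ℂ} (hf : f.HasTemperateGrowth) (q : ℕ) :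
    (fockOp^[q] f).HasTemperateGrowth := by
  induction q with
  | zero => exact hf
  | succ q ih =>
    rw [Function.iterate_succ_apply']
    have h := temperate_wd (-I) ih
    rw [← dz_eq_wd] at h
    exact h.neg.add (temperate_conj.mul ih)

lemma wd_gw_mul (c : ℂ) {g : ℂ → ℂ} (hg : g.HasTemperateGrowth) : ∃ g' : ℂ → ℂ,
    g'.HasTemperateGrowth ∧ wd c (fun z => gw z * g z) = fun z => gw z * g' z := by
  have h1 := temperate_conj
  have h2 := temperate_wd c hg
  refine ⟨fun z => -((1 + c * I) / 2 * conj z + z * ((1 - c * I) / 2)) * g z + wd c g z,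
    by fun_prop, funext fun z => ?_⟩
  rw [wd_mul_at (contDiff_gw.differentiable (by simp) z) (hg.1.differentiable (by simp) z), wd_gw]
  ring

lemma norm_gw (z : ℂ) : ‖gw z‖ = Real.pi⁻¹ * Real.exp (-‖z‖ ^ 2) := by
  have := Real.pi_pos
  rw [gw, norm_real, Real.norm_of_nonneg (by positivity)]

lemma pow_mul_exp_neg_sq_le (m : ℕ) {r : ℝ} (hr : 0 ≤ r) :
    (1 + r) ^ m * Real.exp (-r ^ 2) ≤ m.factorial * Real.exp (5 / 4) := by
  have h1 := Real.pow_div_factorial_le_exp (x := 1 + r) (by linarith) m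
  have h2 : Real.exp (1 + r) * Real.exp (-r ^ 2) ≤ Real.exp (5 / 4) := by
    rw [← Real.exp_add]
    -- `1 + r - r² = 5/4 - (r - 1/2)²`.
    exact Real.exp_le_exp.2 (by nlinarith [sq_nonneg (r - 1 / 2)])
  have hm : (0 : ℝ) < m.factorial := by exact_mod_cast Nat.factorial_pos m
  rw [div_le_iff₀ hm] at h1
  calc (1 + r) ^ m * Real.exp (-r ^ 2) ≤ Real.exp (1 + r) * m.factorial * Real.exp (-r ^ 2) := by
        gcongr
    _ = m.factorial * (Real.exp (1 + r) * Real.exp (-r ^ 2)) := by ring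
    _ ≤ _ := by gcongr

/-- The product of the Gaussian weight and a function of temperate growth as a Schwartz function. -/
lemma exists_schwartz_gw_mul {g : ℂ → ℂ} (hg : g.HasTemperateGrowth) :
    ∃ φ : 𝓢(ℂ, ℂ), ∀ z, φ z = gw z * g z := by
  refine ⟨⟨fun z => gw z * g z, contDiff_gw.mul hg.1, fun K n => ?_⟩, fun _ => rfl⟩
  -- The grading is trivial here: the class `ω · (temperate growth)` is stable under both
  -- derivatives, and each of its members decays faster than the chosen power.
  obtain ⟨C, hC⟩ := norm_iteratedFDeriv_le_of_wd (Ω := ⊤)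
    (fun _ => {f | ∃ g : ℂ → ℂ, g.HasTemperateGrowth ∧ f = fun z => gw z * g z})
    (fun _ z => ((1 + ‖z‖) ^ K)⁻¹)
    (by rintro _ f ⟨g, hg, rfl⟩; exact (contDiff_gw.mul hg.1).contDiffOn)
    (by rintro _ f ⟨g, hg, rfl⟩; exact ⟨wd_gw_mul _ hg, wd_gw_mul _ hg⟩)
    (by
      rintro _ f ⟨g, hg, rfl⟩
      obtain ⟨M, C, h⟩ := hg.2 0
      simp only [norm_iteratedFDeriv_zero] at h
      refine ⟨Real.pi⁻¹ * |C| * ((M + K).factorial * Real.exp (5 / 4)), fun z _ => ?_⟩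
      have hp := Real.pi_pos
      have h1 : 0 < 1 + ‖z‖ := by positivity
      rw [← div_eq_mul_inv, le_div_iff₀ (by positivity), norm_mul, norm_gw]
      have h2 : ‖g z‖ ≤ |C| * (1 + ‖z‖) ^ M :=
        (h z).trans (mul_le_mul_of_nonneg_right (le_abs_self C) (by positivity))
      calc Real.pi⁻¹ * Real.exp (-‖z‖ ^ 2) * ‖g z‖ * (1 + ‖z‖) ^ K
          ≤ Real.pi⁻¹ * Real.exp (-‖z‖ ^ 2) * (|C| * (1 + ‖z‖) ^ M) * (1 + ‖z‖) ^ K := by gcongr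
        _ = Real.pi⁻¹ * |C| * ((1 + ‖z‖) ^ (M + K) * Real.exp (-‖z‖ ^ 2)) := by
            rw [pow_add]; ring
        _ ≤ _ := mul_le_mul_of_nonneg_left (pow_mul_exp_neg_sq_le _ (norm_nonneg z))
            (by positivity))
    n 0 _ ⟨g, hg, rfl⟩
  refine ⟨|C|, fun z => ?_⟩
  have h1 : 0 < 1 + ‖z‖ := by positivity
  have h2 := hC z (Opens.mem_top z)
  calc ‖z‖ ^ K * ‖iteratedFDeriv ℝ n (fun z => gw z * g z) z‖
      ≤ (1 + ‖z‖) ^ K * (|C| * ((1 + ‖z‖) ^ K)⁻¹) := by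
        gcongr
        · linarith
        · exact h2.trans (mul_le_mul_of_nonneg_right (le_abs_self C) (by positivity))
    _ = |C| := by field_simp

/-! ### Gaussian integrals -/

lemma measurable_gaussian_density :
    Measurable fun z : ℂ => ENNReal.ofReal (Real.pi⁻¹ * Real.exp (-‖z‖ ^ 2)) := by fun_prop

lemma toReal_gaussian_density_smul (z w : ℂ) :
    (ENNReal.ofReal (Real.pi⁻¹ * Real.exp (-‖z‖ ^ 2))).toReal • w = gw z * w := by
  have := Real.pi_pos
  rw [ENNReal.toReal_ofReal (by positivity), real_smul, gw]

lemma integrable_gaussian {f : ℂ → ℂ} :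
    Integrable f gaussian ↔ Integrable fun z => gw z * f z := by
  rw [gaussian, integrable_withDensity_iff_integrable_smul' measurable_gaussian_density
    (Eventually.of_forall fun _ => ENNReal.ofReal_lt_top)]
  simp only [toReal_gaussian_density_smul]

lemma integral_gaussian (f : ℂ → ℂ) : ∫ z, f z ∂gaussian = ∫ z, gw z * f z := by
  rw [gaussian, integral_withDensity_eq_integral_toReal_smul measurable_gaussian_density
    (Eventually.of_forall fun _ => ENNReal.ofReal_lt_top)]
  simp only [toReal_gaussian_density_smul]

lemma memLp_gaussian {g : ℂ → ℂ} (hg : g.HasTemperateGrowth) : MemLp g 2 gaussian := by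
  rw [memLp_two_iff_integrable_sq_norm hg.1.continuous.aestronglyMeasurable]
  have h : Integrable (fun z => g z * conj (g z)) gaussian := by
    rw [integrable_gaussian]
    obtain ⟨φ, hφ⟩ := exists_schwartz_gw_mul (hg.fun_mul (temperate_conj.comp hg))
    exact φ.integrable.congr (Eventually.of_forall hφ)
  refine h.norm.congr (Eventually.of_forall fun z => ?_)
  simp [sq]

/-! ### The Fock space -/

/-- The function `exp (-|z|²)` on the plane. -/
def fockBoundary : BoundaryFunction ⊤ where
  toFun z := Real.exp (-‖z‖ ^ 2)
  smooth := (contDiff_norm_sq ℝ).neg.exp.contDiffOn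
  pos z _ := Real.exp_pos _
  compact c hc := by
    refine Metric.isCompact_of_isClosed_isBounded ?_ ?_
    · have : {z : ℂ | z ∈ (⊤ : Opens ℂ) ∧ c ≤ Real.exp (-‖z‖ ^ 2)} =
          {z | c ≤ Real.exp (-‖z‖ ^ 2)} := by ext z; simp
      rw [this]
      exact isClosed_le continuous_const (by fun_prop)
    · refine (Metric.isBounded_closedBall (x := (0 : ℂ)) (r := max 1 (1 / c))).subset ?_
      rintro z ⟨-, hz⟩
      rw [mem_closedBall_zero_iff]
      by_contra! hcon
      have h1 : 1 < ‖z‖ := (le_max_left _ _).trans_lt hcon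
      have h2 : 1 < ‖z‖ * c := (div_lt_iff₀ hc).1 ((le_max_right _ _).trans_lt hcon)
      have h3 := Real.add_one_le_exp (‖z‖ ^ 2)
      have h4 : c * Real.exp (‖z‖ ^ 2) ≤ 1 := by
        calc _ ≤ Real.exp (-‖z‖ ^ 2) * Real.exp (‖z‖ ^ 2) := by gcongr
          _ = 1 := by rw [← Real.exp_add]; simp
      nlinarith

lemma fockBoundary_eq : (fun z => (fockBoundary.toFun z : ℂ)) = fun z => (Real.pi : ℂ) * gw z := by
  funext z
  have := Real.pi_ne_zero
  simp only [fockBoundary, gw]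
  push_cast
  rw [← mul_assoc, mul_inv_cancel₀ (by exact_mod_cast this), one_mul]

/-- Products of the Gaussian weight and functions of temperate growth. -/
def fockAlg : BdryAlg fockBoundary where
  -- No weight is needed, since the polynomial factors created by derivatives of `ω` are absorbed by
  -- temperate growth.
  v _ := 1
  N :=
    { carrier := {m | ∃ g : ℂ → ℂ, g.HasTemperateGrowth ∧ m = fun z => gw z * g z}
      add_mem' := by
        rintro _ _ ⟨g, hg, rfl⟩ ⟨g', hg', rfl⟩
        exact ⟨_, hg.add hg', funext fun z => by simp [mul_add]⟩
      zero_mem' := ⟨fun _ => 0, by fun_prop, funext fun z => by simp⟩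
      smul_mem' := by
        rintro c _ ⟨g, hg, rfl⟩
        exact ⟨fun z => c * g z, by fun_prop, funext fun z => by simp [mul_left_comm]⟩ }
  v_smooth := contDiffOn_const
  v_ne _ _ := one_ne_zero
  smooth := by
    rintro _ ⟨g, hg, rfl⟩
    exact (contDiff_gw.mul hg.1).contDiffOn
  congr := by
    rintro _ ⟨g, hg, rfl⟩ g' e
    exact ⟨g, hg, funext fun z => (e (Opens.mem_top z)).symm⟩
  deriv_mem := by
    rintro c _ ⟨g, hg, rfl⟩
    obtain ⟨g', hg', e⟩ := wd_gw_mul c hg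
    exact ⟨g', hg', by simp [e]⟩
  dv_mem := by
    rintro c _ ⟨g, hg, rfl⟩
    exact ⟨fun _ => 0, by fun_prop, funext fun z => by rw [wd_const]; simp⟩
  ds_mem := by
    rintro c _ ⟨g, hg, rfl⟩
    have h1 := temperate_conj
    refine ⟨fun z => -((1 + c * I) / 2 * conj z + z * ((1 - c * I) / 2)) * g z,
      by fun_prop, funext fun z => ?_⟩
    have h2 := congrFun fockBoundary_eq z
    beta_reduce at h2
    have h3 := gw_ne z
    have h4 : (Real.pi : ℂ) ≠ 0 := by exact_mod_cast Real.pi_ne_zero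
    rw [fockBoundary_eq, wd_const_mul, wd_gw, h2]
    field_simp

/-! ### Orthogonal basis and Toeplitz operators on the plane -/

lemma temperate_pow (k : ℕ) : (fun z : ℂ => z ^ k).HasTemperateGrowth := by fun_prop

lemma fockBasis_eq (q k : ℕ) : fockBasis q k = fockOp^[q] fun z => z ^ k := rfl

lemma temperate_fockBasis (q k : ℕ) : (fockBasis q k).HasTemperateGrowth :=
  temperate_fockOp_iter (temperate_pow k) q

lemma fockBasis_eq_holoOp (q k : ℕ) :
    fockBasis q k = holoOp q (fockCoeff q) fun z => z ^ k :=
  fockOp_iter_eq (differentiable_pow k) q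

lemma exists_fock_bound {K : Set ℂ} (hK : IsCompact K) :
    ∃ ρ ∈ Set.Ioi (0 : ℝ), ∀ z ∈ K, ‖z‖ ≤ ρ := by
  obtain ⟨R, hR⟩ := hK.exists_bound_of_continuousOn (f := fun z : ℂ => z) continuousOn_id
  exact ⟨max R 1, Set.mem_Ioi.2 (lt_max_of_lt_right one_pos), fun z hz => (hR z hz).trans (le_max_left _ _)⟩

lemma exists_gt_Ioi : ∀ ρ ∈ Set.Ioi (0 : ℝ), ∃ ρ' ∈ Set.Ioi (0 : ℝ), ρ < ρ' :=
  fun ρ hρ => ⟨ρ + 1, by have := Set.mem_Ioi.1 hρ; exact Set.mem_Ioi.2 (by linarith), by linarith⟩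

/-- The weight itself serves as the radial function: `θ_k = ω z̄^k`, and `∂̄^q θ_k = (-1)^q ω ū_k`
by the conjugate of `dz_iter_gw_mul`. All positive radii are admissible. -/
theorem fock_polyBasis (q : ℕ) : PolyBasis ⊤ gaussian q (Set.Ioi 0) (fockBasis q) := by
  have hpa : ∀ k, PA ⊤ (q + 1) (fockBasis q k) := fun k => by
    rw [fockBasis_eq_holoOp]
    exact (fockCoeff_pa q).holoOp (differentiableOn_pow k)
  refine PolyBasis.of_radial (A := fockAlg) gw (fun z => Real.pi⁻¹ * Real.exp (-‖z‖ ^ 2))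
    ((-1) ^ q) (by simp) (Eventually.of_forall Opens.mem_top)
    (fun f => by rw [integral_gaussian, Opens.coe_top, Measure.restrict_univ]) ?_
    (fun _ w _ _ => Opens.mem_top w) (by rw [Opens.coe_top]; exact isPreconnected_univ)
    (fun z w h => by simp [fockBoundary, h]) (fun z w h => by simp [h])
    (contDiff_const.mul (contDiff_norm_sq ℝ).neg.exp).contDiffOn
    (fun z _ => mul_pos (inv_pos.2 Real.pi_pos) (Real.exp_pos _)) ?_ ?_ ?_
    (fun k => (temperate_fockBasis q k).1.contDiffOn) (fun k => memLp_gaussian (temperate_fockBasis q k))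
    (fun k => (hpa k).2) ⟨1, Set.mem_Ioi.2 one_pos⟩ (fun ρ hρ => hρ) exists_gt_Ioi
    (fun ρ _ => by rw [Opens.coe_top]; exact Set.subset_univ _) ?_
  · rintro g hg hgL _ ⟨G, hG, rfl⟩
    rw [Opens.coe_top, integrableOn_univ]
    have h := integrable_gaussian.1 (hgL.integrable_mul (memLp_gaussian hG))
    refine h.congr (Eventually.of_forall fun z => ?_)
    simp only [Pi.mul_apply]; ring
  · intro k
    have h1 := temperate_conj.fun_pow k
    exact ⟨_, ⟨fun z => conj z ^ k, h1, rfl⟩, fun z _ => by simp [fockAlg, gw]⟩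
  · intro k z _
    have e : (fun z : ℂ => ((Real.pi⁻¹ * Real.exp (-‖z‖ ^ 2) : ℝ) : ℂ) * conj z ^ k) =
        fun z => conj (gw z * z ^ k) := by
      funext z
      rw [map_mul, conj_gw, map_pow, gw]
    rw [e, wd_iter_conj, conj_I, dz_iter_gw_mul (temperate_pow k).1, fockBasis_eq]
    simp only [map_mul, map_pow, map_neg, map_one, conj_gw]
  · intro k
    refine ⟨q.factorial, ?_, fun z _ => dzbar_iter_fockOp_iter (differentiable_pow k) q z⟩
    rw [Complex.norm_natCast]
    exact_mod_cast Nat.factorial_pos q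
  · intro b hb
    obtain ⟨g, hg, hs⟩ := (fockCoeff_pa q).synth (P := Set.Ioi 0) (fun ρ hρ => hρ) exists_gt_Ioi
      (w := fun _ => 1) (ψ := fun z => z) (differentiable_const _).differentiableOn
      differentiable_id.differentiableOn (fun K hK _ => exists_fock_bound hK) b hb
    refine ⟨g, hg.1, hg.2, fun z hz => ?_⟩
    have := hs z hz
    simp only [one_mul] at this
    simpa only [fockBasis_eq_holoOp] using this

/-- The matrix of a Toeplitz operator in the basis of the true poly-Fock space. -/
lemma exists_fock_matrix (q : ℕ) {F : 𝓢'(ℂ, ℂ)} (hF : HasCompactSupportIn (opD q F) ⊤) :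
    ∃ a : ℕ → ℕ → ℂ, (∀ k l, ∃ φ : 𝓢(ℂ, ℂ),
      (∀ z, φ z = gw z * (fockBasis q k z * conj (fockBasis q l z))) ∧ F φ = a k l) ∧
      ∃ ρ ∈ Set.Ioi (0 : ℝ), ∃ C : ℝ, ∀ k l, ‖a k l‖ ≤ C * ρ ^ (k + l) := by
  have hE : ∀ k l : ℕ, ∃ φ : 𝓢(ℂ, ℂ), ∀ z, φ z = gw z * (z ^ k * conj (z ^ l)) := fun k l =>
    exists_schwartz_gw_mul ((temperate_pow k).fun_mul (temperate_conj.comp (temperate_pow l)))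
  choose E hE using hE
  refine ⟨fun k l => opD q F (E k l), fun k l => ⟨opDTest q (E k l), fun z => ?_,
    (opD_apply q F _).symm⟩, ?_⟩
  · have h := fockProd_self (differentiable_pow k) (differentiable_pow l) q z
    have e : (E k l : ℂ → ℂ) = fockProd (fun z => z ^ k) (fun z => z ^ l) 0 0 := funext (hE k l)
    rw [opDTest_apply, e, ← h]; rfl
  · obtain ⟨K, hK, hKΩ, hv⟩ := hF
    obtain ⟨V, hV, hKV, hVΩ, hone⟩ := fockBoundary.exists_nhds_eq_one hK hKΩ
    obtain ⟨T, hT0, hT⟩ := hone stdCutoff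
    -- The weight `ω` is moved into the distribution, so that only the products `z^k z̄^l` have to
    -- be estimated. The truncation changes nothing near the support.
    obtain ⟨ρ, hρ, C, hC⟩ := CDistribution.exists_bound_pow (s := fockBoundary)
      (mulDist gw contDiff_gw (restrictTest (opD q F))) hT0
      (P := Set.Ioi 0) (fun ρ hρ => hρ) exists_gt_Ioi
      (w := fun _ => 1) (ψ := fun z => z) (differentiable_const _).differentiableOn
      differentiable_id.differentiableOn (fun K hK _ => exists_fock_bound hK)
    refine ⟨ρ, hρ, C, fun k l => ?_⟩
    have hs : ContDiffOn ℝ ∞ (fun z : ℂ => (1 : ℂ) * z ^ k * conj (1 * z ^ l))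
        ((⊤ : Opens ℂ) : Set ℂ) :=
      ((contDiff_const.mul (contDiff_id.pow k)).mul
        (contDiff_conj.comp (contDiff_const.mul (contDiff_id.pow l)))).contDiffOn
    refine le_of_eq_of_le ?_ (hC k l hs)
    congr 1
    refine tempered_eq_of_isVanishingOn hv hV hKV fun z hz => ?_
    have h1 : gw z * truncate fockBoundary stdCutoff T _ hs z = E k l z := by
      rw [truncate_apply _ _ _ (Opens.mem_top z), hT T le_rfl z hz, hE]
      simp
    exact h1.symm

theorem fock_toeplitz (q : ℕ) (F : 𝓢'(ℂ, ℂ))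
    (hF : HasCompactSupportIn (opD q F) ⊤ ∨ HasCompactSupportIn F ⊤) :
    ∃ T, IsToeplitzFock q F T ∧ IsCompactOperator T ∧ ∀ T', IsToeplitzFock q F T' → T' = T := by
  obtain ⟨a, ha, hab⟩ := exists_fock_matrix q (hF.elim id fun h => h.opD q)
  obtain ⟨T, hT, hTc, hTu⟩ := (fock_polyBasis q).exists_toeplitz hab
  refine ⟨T, fun k l => ?_, hTc, fun T' hT' => hTu T' fun k l => ?_⟩
  · obtain ⟨u, v, hu, hv, e⟩ := hT k l
    obtain ⟨φ, hφ, e'⟩ := ha k l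
    exact ⟨u, v, hu, hv, φ, hφ, e'.trans e⟩
  · obtain ⟨u, v, hu, hv, φ, hφ, e⟩ := hT' k l
    obtain ⟨φ', hφ', e'⟩ := ha k l
    have : φ = φ' := SchwartzMap.ext fun z => (hφ z).trans (hφ' z).symm
    exact ⟨u, v, hu, hv, by rw [← e', ← this, e]⟩

end

end PolyToeplitz


namespace PolyToeplitz

noncomputable section

/-! ### Polynomials in `Im z`, `1 / (z + i)` and `1 / (z̄ - i)` -/

lemma wd_of_hasDerivAt {f : ℂ → ℂ} {c d z : ℂ} (h : HasDerivAt f d z) :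
    wd c f z = (1 + c * I) / 2 * d := by
  have h' := h.complexToReal_fderiv
  simp [wd, h'.fderiv]; ring

lemma wd_pow_at {f : ℂ → ℂ} {c z : ℂ} (hf : DifferentiableAt ℝ f z) (n : ℕ) :
    wd c (fun w => f w ^ n) z = n * f z ^ (n - 1) * wd c f z := by
  induction n with
  | zero => simp
  | succ n ih =>
    simp only [pow_succ]
    rw [wd_mul_at (hf.fun_pow n) hf, ih]
    cases n with
    | zero => simp
    | succ n => simp only [Nat.add_sub_cancel, pow_succ]; push_cast; ring

lemma wd_im (c z : ℂ) : wd c (fun w => (w.im : ℂ)) z = c / 2 := by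
  have h : HasFDerivAt (fun w : ℂ => (w.im : ℂ)) (ofRealCLM.comp imCLM) z :=
    (ofRealCLM.comp imCLM).hasFDerivAt
  simp [wd, h.fderiv]; ring

/-- The function `1 / (z + i)`. -/
def hX (z : ℂ) : ℂ := (z + I)⁻¹

lemma add_I_ne {z : ℂ} (hz : -1 < z.im) : z + I ≠ 0 := fun h => by
  have := congrArg im h
  simp at this
  linarith

lemma neg_one_lt_im {z : ℂ} (hz : z ∈ halfPlane) : -1 < z.im := by
  have : 0 < z.im := hz
  linarith

lemma hasDerivAt_hX {z : ℂ} (hz : -1 < z.im) : HasDerivAt hX (-hX z ^ 2) z := by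
  have h := ((hasDerivAt_id z).add_const I).inv (add_I_ne hz)
  refine h.congr_deriv ?_
  simp [hX, div_eq_mul_inv]

/-- The open half-plane `Im z > -1`. -/
def shiftedHalfPlane : Opens ℂ := ⟨{z | -1 < z.im}, isOpen_lt continuous_const continuous_im⟩

lemma contDiffOn_hX : ContDiffOn ℝ ∞ hX shiftedHalfPlane :=
  (contDiff_id.add contDiff_const).contDiffOn.inv fun _ hz => add_I_ne hz

lemma wd_hX (c : ℂ) {z : ℂ} (hz : -1 < z.im) : wd c hX z = -((1 + c * I) / 2) * hX z ^ 2 := by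
  rw [wd_of_hasDerivAt (hasDerivAt_hX hz)]; ring

lemma wd_conj_hX (c : ℂ) {z : ℂ} (hz : -1 < z.im) :
    wd c (fun w => conj (hX w)) z = -((1 - c * I) / 2) * conj (hX z) ^ 2 := by
  rw [wd_conj_at, wd_hX _ hz]
  simp only [map_mul, map_neg, map_div₀, map_add, map_one, conj_conj, conj_I, map_ofNat, map_pow]
  ring

/-- The monomials `(Im z)^i (z + i)^{-p} (z̄ - i)^{-q}`. -/
def hMono (i p q : ℕ) (z : ℂ) : ℂ := (z.im : ℂ) ^ i * (hX z ^ p * conj (hX z) ^ q)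

lemma contDiff_im : ContDiff ℝ ∞ fun z : ℂ => (z.im : ℂ) :=
  (ofRealCLM.comp imCLM).contDiff

lemma contDiffOn_hMono (i p q : ℕ) : ContDiffOn ℝ ∞ (hMono i p q) shiftedHalfPlane :=
  (contDiff_im.pow i).contDiffOn.mul ((contDiffOn_hX.pow p).mul
    ((conj_contDiffOn contDiffOn_hX).pow q))

lemma hMono_mul (i p q i' p' q' : ℕ) (z : ℂ) :
    hMono i p q z * hMono i' p' q' z = hMono (i + i') (p + p') (q + q') z := by
  simp only [hMono, pow_add]; ring

lemma im_mul_wd_hMono (c : ℂ) (i p q : ℕ) {z : ℂ} (hz : -1 < z.im) :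
    (z.im : ℂ) * wd c (hMono i p q) z = i * (c / 2) * hMono i p q z -
      p * ((1 + c * I) / 2) * hMono (i + 1) (p + 1) q z -
      q * ((1 - c * I) / 2) * hMono (i + 1) p (q + 1) z := by
  have hX1 := diffAt_of_contDiffOn contDiffOn_hX (Ω := shiftedHalfPlane) hz
  have hY1 := diffAt_of_contDiffOn (conj_contDiffOn contDiffOn_hX) (Ω := shiftedHalfPlane) hz
  have hy := contDiff_im.differentiable (by simp) z
  have e : hMono i p q = fun z => (z.im : ℂ) ^ i * (hX z ^ p * conj (hX z) ^ q) := rfl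
  have hp : ∀ (n : ℕ) (a : ℂ), (n : ℂ) * a ^ (n - 1) * a = n * a ^ n := by
    intro n a
    cases n with
    | zero => simp
    | succ n => rw [Nat.add_sub_cancel, pow_succ]; ring
  have h1 := hp i z.im
  have h2 := hp p (hX z)
  have h3 := hp q (conj (hX z))
  rw [e, wd_mul_at (hy.fun_pow i) ((hX1.fun_pow p).fun_mul (hY1.fun_pow q)),
    wd_mul_at (hX1.fun_pow p) (hY1.fun_pow q), wd_pow_at hy, wd_pow_at hX1, wd_pow_at hY1,
    wd_im, wd_hX c hz, wd_conj_hX c hz]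
  simp only [hMono, pow_succ]
  linear_combination (c / 2 * (hX z ^ p * conj (hX z) ^ q)) * h1 -
    ((1 + c * I) / 2 * z.im * z.im ^ i * hX z * conj (hX z) ^ q) * h2 -
    ((1 - c * I) / 2 * z.im * z.im ^ i * conj (hX z) * hX z ^ p) * h3

/-- Linear combinations of monomials of order at least `d` at infinity. -/
def hPoly (d : ℕ) : Submodule ℂ (ℂ → ℂ) :=
  Submodule.span ℂ {g | ∃ i p q : ℕ, d + i ≤ p + q ∧ g = hMono i p q}

variable {d : ℕ} {g : ℂ → ℂ}

lemma hMono_mem {i p q : ℕ} (h : d + i ≤ p + q) : hMono i p q ∈ hPoly d :=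
  Submodule.subset_span ⟨i, p, q, h, rfl⟩

lemma hPoly_smooth (hg : g ∈ hPoly d) : ContDiffOn ℝ ∞ g shiftedHalfPlane := by
  induction hg using Submodule.span_induction with
  | mem x hx => obtain ⟨i, p, q, -, rfl⟩ := hx; exact contDiffOn_hMono i p q
  | zero => exact contDiffOn_const
  | add x y _ _ hx hy => exact hx.add hy
  | smul a x _ hx => exact hx.const_smul a

lemma hMono_mul_mem {d' i p q : ℕ} (hd : d' + i ≤ d + p + q) (hg : g ∈ hPoly d) :
    (fun z => hMono i p q z * g z) ∈ hPoly d' := by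
  induction hg using Submodule.span_induction with
  | mem x hx =>
    obtain ⟨i', p', q', h, rfl⟩ := hx
    simp only [hMono_mul]
    exact hMono_mem (by omega)
  | zero =>
    simp only [Pi.zero_apply, mul_zero]
    exact (hPoly d').zero_mem
  | add x y _ _ hx hy =>
    simp only [Pi.add_apply, mul_add]
    exact (hPoly d').add_mem hx hy
  | smul a x _ hx =>
    simp only [Pi.smul_apply, smul_eq_mul, mul_left_comm _ a]
    exact (hPoly d').smul_mem a hx

/-- With `y = Im z`, a derivative of `y^i` multiplied by `y` gives back `y^i`. A derivative of a
power of `(z + i)⁻¹` or its conjugate raises that exponent and, after multiplication by `y`, also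
the exponent of `y`. The order `p + q - i` is preserved. -/
lemma hPoly_deriv (c : ℂ) (hg : g ∈ hPoly d) :
    ∃ g' ∈ hPoly d, ∀ z ∈ shiftedHalfPlane, (z.im : ℂ) * wd c g z = g' z := by
  induction hg using Submodule.span_induction with
  | mem x hx =>
    obtain ⟨i, p, q, h, rfl⟩ := hx
    exact ⟨_, (hPoly d).sub_mem ((hPoly d).sub_mem
      ((hPoly d).smul_mem (i * (c / 2)) (hMono_mem h))
      ((hPoly d).smul_mem (p * ((1 + c * I) / 2)) (hMono_mem (by omega : d + (i + 1) ≤ p + 1 + q))))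
      ((hPoly d).smul_mem (q * ((1 - c * I) / 2)) (hMono_mem (by omega : d + (i + 1) ≤ p + (q + 1)))),
      fun z hz => im_mul_wd_hMono c i p q hz⟩
  | zero => exact ⟨0, (hPoly d).zero_mem, fun z _ => by
      rw [show (0 : ℂ → ℂ) = fun _ => 0 from rfl, wd_const]; simp⟩
  | add x y hx' hy' hx hy =>
    obtain ⟨x', hx1, hx2⟩ := hx
    obtain ⟨y', hy1, hy2⟩ := hy
    refine ⟨_, (hPoly d).add_mem hx1 hy1, fun z hz => ?_⟩
    rw [show x + y = fun z => x z + y z from rfl,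
      wd_add_at (diffAt_of_contDiffOn (hPoly_smooth hx') hz)
        (diffAt_of_contDiffOn (hPoly_smooth hy') hz), mul_add, hx2 z hz, hy2 z hz]; rfl
  | smul a x _ hx =>
    obtain ⟨x', hx1, hx2⟩ := hx
    refine ⟨_, (hPoly d).smul_mem a hx1, fun z hz => ?_⟩
    rw [show a • x = fun z => a * x z from rfl, wd_const_mul, mul_left_comm, hx2 z hz]; rfl

lemma norm_add_I_ge {z : ℂ} (hz : z ∈ halfPlane) : z.im ≤ ‖z + I‖ ∧ 1 + ‖z‖ ≤ 2 * ‖z + I‖ := by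
  have hz' : 0 < z.im := hz
  have h1 : z.im + 1 ≤ ‖z + I‖ := by
    simpa using (le_abs_self _).trans (abs_im_le_norm (z + I))
  have h2 : ‖z‖ ≤ ‖z + I‖ := by
    rw [← sq_le_sq₀ (norm_nonneg _) (norm_nonneg _), ← normSq_eq_norm_sq, ← normSq_eq_norm_sq,
      normSq_apply, normSq_apply]
    simp; nlinarith
  exact ⟨by linarith, by linarith⟩

/-- Each factor `Im z` is paired with one factor `|z + i|⁻¹`, their product being at most one;
surplus factors `|z + i|⁻¹` are also at most one. -/
lemma hPoly_bound (hg : g ∈ hPoly d) : ∃ C : ℝ, ∀ z ∈ halfPlane, ‖g z‖ ≤ C * ‖hX z‖ ^ d := by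
  induction hg using Submodule.span_induction with
  | mem x hx =>
    obtain ⟨i, p, q, h, rfl⟩ := hx
    refine ⟨1, fun z hz => ?_⟩
    have hz' : 0 < z.im := hz
    obtain ⟨h1, h2⟩ := norm_add_I_ge hz
    have h3 : 0 < ‖z + I‖ := by linarith [norm_nonneg z]
    have h4 : z.im * ‖hX z‖ ≤ 1 := by
      rw [hX, norm_inv, ← div_eq_mul_inv, div_le_one h3]; exact h1
    have h5 : ‖hX z‖ ≤ 1 := by
      have : z.im + 1 ≤ ‖z + I‖ := by
        simpa using (le_abs_self _).trans (abs_im_le_norm (z + I))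
      rw [hX, norm_inv]
      exact inv_le_one_of_one_le₀ (by linarith)
    obtain ⟨e, he⟩ : ∃ e, p + q = d + i + e := ⟨_, (Nat.add_sub_cancel' h).symm⟩
    have h6 : ‖hMono i p q z‖ = (z.im * ‖hX z‖) ^ i * ‖hX z‖ ^ e * ‖hX z‖ ^ d := by
      rw [hMono, norm_mul, norm_mul, norm_pow, norm_pow, norm_pow, norm_conj, ← pow_add, he,
        norm_real, Real.norm_of_nonneg hz'.le]
      ring
    rw [h6]
    refine mul_le_mul_of_nonneg_right ?_ (by positivity)
    exact mul_le_one₀ (pow_le_one₀ (by positivity) h4) (by positivity)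
      (pow_le_one₀ (norm_nonneg _) h5)
  | zero => exact ⟨0, fun z _ => by simp⟩
  | add x y _ _ hx hy =>
    obtain ⟨C, hC⟩ := hx
    obtain ⟨D, hD⟩ := hy
    refine ⟨C + D, fun z hz => (norm_add_le _ _).trans ?_⟩
    rw [add_mul]
    exact add_le_add (hC z hz) (hD z hz)
  | smul a x _ hx =>
    obtain ⟨C, hC⟩ := hx
    refine ⟨‖a‖ * C, fun z hz => ?_⟩
    rw [Pi.smul_apply, norm_smul, mul_assoc]
    exact mul_le_mul_of_nonneg_left (hC z hz) (norm_nonneg a)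

/-! ### Function classes on the half-plane adapted to its boundary -/

lemma halfPlane_le : (halfPlane : Set ℂ) ⊆ shiftedHalfPlane := fun _ hz => neg_one_lt_im hz

lemma im_ne {z : ℂ} (hz : z ∈ halfPlane) : (z.im : ℂ) ≠ 0 := by
  have : 0 < z.im := hz
  exact_mod_cast this.ne'

lemma halfPlaneBoundary_eq (z : ℂ) : (halfPlaneBoundary.toFun z : ℂ) = 4 * hMono 1 1 1 z := by
  simp only [halfPlaneBoundary, hMono, pow_one, mul_conj, normSq_eq_norm_sq, hX, norm_inv]
  push_cast; ring

/-- The algebra of the half-plane: restrictions of the functions in `hPoly d`. -/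
def halfPlaneAlg (d : ℕ) : BdryAlg halfPlaneBoundary where
  v z := z.im
  N :=
    { carrier := {g | ∃ G ∈ hPoly d, Set.EqOn g G halfPlane}
      add_mem' := by
        rintro g g' ⟨G, hG, e⟩ ⟨G', hG', e'⟩
        exact ⟨_, (hPoly d).add_mem hG hG', fun z hz => by
          rw [Pi.add_apply, Pi.add_apply, e hz, e' hz]⟩
      zero_mem' := ⟨_, (hPoly d).zero_mem, fun _ _ => rfl⟩
      smul_mem' := by
        rintro c g ⟨G, hG, e⟩
        exact ⟨_, (hPoly d).smul_mem c hG, fun z hz => by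
          rw [Pi.smul_apply, Pi.smul_apply, e hz]⟩ }
  v_smooth := contDiff_im.contDiffOn
  v_ne _ hz := im_ne hz
  smooth := by
    rintro g ⟨G, hG, e⟩
    exact ((hPoly_smooth hG).mono halfPlane_le).congr e
  congr := by
    rintro g ⟨G, hG, e⟩ g' e'
    exact ⟨G, hG, e'.symm.trans e⟩
  deriv_mem := by
    rintro c g ⟨G, hG, e⟩
    obtain ⟨G', hG', e'⟩ := hPoly_deriv c hG
    exact ⟨G', hG', fun z hz => by
      beta_reduce; rw [wd_congr e hz, e' z (halfPlane_le hz)]⟩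
  dv_mem := by
    rintro c g ⟨G, hG, e⟩
    exact ⟨_, (hPoly d).smul_mem (c / 2) hG, fun z hz => by
      beta_reduce; rw [wd_im, e hz]; rfl⟩
  ds_mem := by
    rintro c g ⟨G, hG, e⟩
    -- Since `s = 4 Im z / ((z + i)(z̄ - i))`, the function `v ∂s / s` is a combination of `1`, `Im
    -- z / (z + i)` and `Im z / (z̄ - i)`, all of order zero.
    refine ⟨_, (hPoly d).sub_mem ((hPoly d).sub_mem ((hPoly d).smul_mem (c / 2) hG)
      ((hPoly d).smul_mem ((1 + c * I) / 2)
        (hMono_mul_mem (i := 1) (p := 1) (q := 0) le_rfl hG)))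
      ((hPoly d).smul_mem ((1 - c * I) / 2)
        (hMono_mul_mem (i := 1) (p := 0) (q := 1) le_rfl hG)), fun z hz => ?_⟩
    have h1 : (fun w => (halfPlaneBoundary.toFun w : ℂ)) = fun w => 4 * hMono 1 1 1 w :=
      funext halfPlaneBoundary_eq
    have h2 := im_mul_wd_hMono c 1 1 1 (neg_one_lt_im hz)
    have h3 := halfPlaneBoundary.ne hz
    have h4 : hMono 1 1 1 z ≠ 0 := fun h0 => h3 (by rw [halfPlaneBoundary_eq, h0, mul_zero])
    beta_reduce
    rw [h1, halfPlaneBoundary_eq, wd_const_mul, e hz, mul_div_mul_left _ _ (by norm_num),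
      mul_div_assoc', h2, div_mul_eq_mul_div, div_eq_iff h4]
    simp only [Pi.sub_apply, Pi.smul_apply, smul_eq_mul, hMono]
    push_cast; ring

lemma mem_halfPlaneAlg (hg : g ∈ hPoly d) : g ∈ (halfPlaneAlg d).N := ⟨g, hg, fun _ _ => rfl⟩

lemma const_mul_mem_halfPlaneAlg (a : ℂ) (hg : g ∈ (halfPlaneAlg d).N) :
    (fun z => a * g z) ∈ (halfPlaneAlg d).N :=
  (halfPlaneAlg d).N.smul_mem a hg

lemma sub_conj_eq (z : ℂ) : z - conj z = 2 * I * z.im := by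
  rw [sub_conj]; push_cast; ring

lemma halfPlaneAlg_coeffMem (d j : ℕ) : CoeffMem (halfPlaneAlg d) j (halfPlaneCoeff j) := by
  intro a _ b _ m hm
  have h1 := hm.vpow_mul (a + b)
  have hk : (0 - (a : ℤ) - (b : ℤ)) + ((a + b : ℕ) : ℤ) = 0 := by push_cast; ring
  rw [hk] at h1
  refine (h1.mul_of (w := fun _ => (j.choose a : ℂ) / (a.factorial : ℂ) * (2 * I) ^ a *
    ((j.choose b : ℂ) / (b.factorial : ℂ) * (-(2 * I)) ^ b))
    (fun g hg => const_mul_mem_halfPlaneAlg _ hg)).congr fun z _ => ?_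
  simp only [halfPlaneCoeff, sub_conj_eq, map_mul, map_pow, map_div₀, map_natCast, conj_ofReal,
    conj_I, map_ofNat, halfPlaneAlg, pow_add]
  ring

lemma Mem.sub_conj_pow_mul (j : ℕ) (hg : g ∈ (halfPlaneAlg d).N) :
    (halfPlaneAlg d).Mem j fun z => (z - conj z) ^ j * g z := by
  have h1 := (BdryAlg.mem_zero_iff.2 (const_mul_mem_halfPlaneAlg ((2 * I) ^ j) hg)).vpow_mul j
  rw [zero_add] at h1
  refine h1.congr fun z _ => ?_
  simp only [sub_conj_eq, halfPlaneAlg, mul_pow]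
  ring

/-! ### Symbols and square integrability -/

/-- The functions of order `4` are admissible for symbols: they are smooth on `Im z > -1`, and their
derivatives of order `m` lie in `v^{-m} N`, hence are `O((Im z)^{-m} |z + i|⁻⁴)`. -/
lemma exists_hasValue_halfPlane {F : CDistribution halfPlane} (hF : IsHalfPlaneSymbol F)
    (hg : g ∈ (halfPlaneAlg 4).N) : ∃ L, HasValue halfPlaneBoundary F g L := by
  obtain ⟨G, hG, e⟩ := hg
  have h1 : SmoothUpToBoundary halfPlane G := by
    refine ⟨shiftedHalfPlane, shiftedHalfPlane.isOpen, ?_, hPoly_smooth hG⟩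
    refine (closure_minimal (t := {z : ℂ | 0 ≤ z.im}) (fun z hz => ?_)
      (isClosed_le continuous_const continuous_im)).trans fun z hz => ?_
    · have hz' : 0 < z.im := hz
      exact hz'.le
    · have hz' : 0 ≤ z.im := hz
      exact lt_of_lt_of_le (by norm_num) hz'
  obtain ⟨L, hL⟩ := hF G h1 fun m => by
    obtain ⟨C, hC⟩ := norm_iteratedFDeriv_le_of_wd (Ω := halfPlane)
      (fun k => {f | (halfPlaneAlg 4).Mem (-(k : ℤ)) f})
      (fun k z => ‖hX z‖ ^ 4 / z.im ^ k)
      (fun k f hf => BdryAlg.Mem.smooth hf)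
      (fun k f hf => by
        have h := fun c => BdryAlg.Mem.wd c hf
        rw [show -(k : ℤ) - 1 = -((k + 1 : ℕ) : ℤ) by push_cast; ring] at h
        exact ⟨h _, h _⟩)
      (by
        rintro k f ⟨g, ⟨G, hG, e⟩, hf⟩
        obtain ⟨C, hC⟩ := hPoly_bound hG
        refine ⟨C, fun z hz => ?_⟩
        have hz' : 0 < z.im := hz
        have hv : (halfPlaneAlg 4).v z = z.im := rfl
        rw [hf z hz, e hz, hv, norm_mul, zpow_neg, zpow_natCast, norm_inv, norm_pow, norm_real,
          Real.norm_of_nonneg hz'.le, inv_mul_eq_div, mul_div_assoc']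
        exact div_le_div_of_nonneg_right (hC z hz) (by positivity))
      m 0 G (by simpa using BdryAlg.mem_zero_iff.2 (mem_halfPlaneAlg hG))
    refine ⟨C, fun z hz => ?_⟩
    have hz' : 0 < z.im := hz
    calc z.im ^ m * ‖iteratedFDeriv ℝ m G z‖ ≤ z.im ^ m * (C * (‖hX z‖ ^ 4 / z.im ^ (0 + m))) :=
          mul_le_mul_of_nonneg_left (hC z hz) (by positivity)
      _ = C / ‖z + I‖ ^ 4 := by
          rw [zero_add, hX, norm_inv]
          field_simp
  exact ⟨L, hL.congr e⟩

/-- `|g|² = O(|z + i|⁻⁴)`, and `1 + |z| ≤ 2 |z + i|` compares this with `(1 + |z|)⁻⁴`, integrable in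
dimension two. -/
lemma memLp_halfPlane (hg : g ∈ (halfPlaneAlg 2).N) :
    MemLp g 2 (volume.restrict (halfPlane : Set ℂ)) := by
  have hgs := (halfPlaneAlg 2).smooth g hg
  obtain ⟨G, hG, e⟩ := hg
  obtain ⟨C, hC⟩ := hPoly_bound hG
  have hm := halfPlane.isOpen.measurableSet
  rw [memLp_two_iff_integrable_sq_norm (hgs.continuousOn.aestronglyMeasurable hm)]
  have h1 : Integrable (fun z : ℂ => C ^ 2 * 16 * (1 + ‖z‖) ^ (-4 : ℝ))
      (volume.restrict (halfPlane : Set ℂ)) :=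
    ((integrable_one_add_norm (by simp; norm_num)).const_mul _).restrict
  refine h1.mono' ((hgs.continuousOn.norm.pow 2).aestronglyMeasurable hm) ?_
  filter_upwards [ae_restrict_mem hm] with z hz
  obtain ⟨-, h2⟩ := norm_add_I_ge hz
  have h0 : 0 < 1 + ‖z‖ := by positivity
  have h3 : ‖hX z‖ ≤ 2 * (1 + ‖z‖)⁻¹ := by
    rw [hX, norm_inv, ← div_eq_mul_inv, inv_le_comm₀ (by linarith) (by positivity), inv_div]
    linarith
  have h4 : ‖g z‖ ≤ C * ‖hX z‖ ^ 2 := (e hz).symm ▸ hC z hz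
  rw [Real.norm_of_nonneg (by positivity), show (-4 : ℝ) = -((4 : ℕ) : ℝ) by norm_num,
    Real.rpow_neg h0.le, Real.rpow_natCast]
  calc ‖g z‖ ^ 2 ≤ (C * ‖hX z‖ ^ 2) ^ 2 := pow_le_pow_left₀ (norm_nonneg _) h4 2
    _ = C ^ 2 * ‖hX z‖ ^ 4 := by ring
    _ ≤ C ^ 2 * (2 * (1 + ‖z‖)⁻¹) ^ 4 := by gcongr
    _ = _ := by rw [mul_pow, inv_pow]; ring

end

end PolyToeplitz


namespace PolyToeplitz

noncomputable section

/-! ### The Cayley transform -/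

/-- The Cayley transform `(z - i) / (z + i)`. -/
def hPsi (z : ℂ) : ℂ := (z - I) * hX z

lemma add_I_mul_hX {z : ℂ} (hz : z + I ≠ 0) : (z + I) * hX z = 1 := mul_inv_cancel₀ hz

lemma one_sub_hPsi {z : ℂ} (hz : z + I ≠ 0) : 1 - hPsi z = 2 * I * hX z := by
  have := add_I_mul_hX hz
  rw [hPsi]; linear_combination -this

lemma boundary_eq_hPsi {z : ℂ} (hz : z + I ≠ 0) :
    4 * z.im / ‖z + I‖ ^ 2 = 1 - ‖hPsi z‖ ^ 2 := by
  have h1 := add_I_mul_hX hz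
  have h2 : (conj z - I) * conj (hX z) = 1 := by
    have := congrArg conj h1
    simpa [sub_eq_add_neg] using this
  have h3 := sub_conj_eq z
  have h4 : ((4 * z.im / ‖z + I‖ ^ 2 : ℝ) : ℂ) = 4 * z.im * (hX z * conj (hX z)) := by
    rw [mul_conj, normSq_eq_norm_sq, hX, norm_inv]
    push_cast; ring
  rw [← ofReal_inj, h4, ofReal_sub, ofReal_one, ofReal_pow, ← conj_mul', hPsi]
  simp only [map_mul, map_sub, conj_I]
  linear_combination ((conj z - I) * conj (hX z)) * h1 + h2 +
    (2 * I * hX z * conj (hX z)) * h3 + (4 * (z.im : ℂ) * hX z * conj (hX z)) * I_sq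

lemma halfPlaneBoundary_eq_hPsi {z : ℂ} (hz : z ∈ halfPlane) :
    halfPlaneBoundary.toFun z = 1 - ‖hPsi z‖ ^ 2 :=
  boundary_eq_hPsi (add_I_ne (neg_one_lt_im hz))

lemma hPsi_mem {z : ℂ} (hz : z ∈ halfPlane) : hPsi z ∈ disk := by
  have h1 := halfPlaneBoundary.pos z hz
  rw [halfPlaneBoundary_eq_hPsi hz] at h1
  rw [mem_disk]
  nlinarith [norm_nonneg (hPsi z)]

lemma hasDerivAt_hPsi {z : ℂ} (hz : z ∈ halfPlane) : HasDerivAt hPsi (2 * I * hX z ^ 2) z := by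
  have h := ((hasDerivAt_id z).sub_const I).mul (hasDerivAt_hX (neg_one_lt_im hz))
  have h1 := add_I_mul_hX (add_I_ne (neg_one_lt_im hz))
  refine h.congr_deriv ?_
  simp only [id]
  linear_combination (-hX z) * h1

/-- The inverse of the Cayley transform. -/
def hInv (z : ℂ) : ℂ := I * (1 + z) / (1 - z)

lemma hInv_hPsi {z : ℂ} (hz : z ∈ halfPlane) : hInv (hPsi z) = z := by
  have h := add_I_ne (neg_one_lt_im hz)
  have h1 := add_I_mul_hX h
  have h2 : hX z ≠ 0 := inv_ne_zero h
  have h3 := I_ne_zero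
  rw [hInv, one_sub_hPsi h, div_eq_iff (by simp [h2]), hPsi]
  linear_combination (-I) * h1

lemma one_sub_ne {z : ℂ} (hz : z ∈ disk) : 1 - z ≠ 0 := fun h => by
  rw [mem_disk, ← sub_eq_zero.1 h] at hz
  simp at hz

lemma hInv_add_I {z : ℂ} (hz : z ∈ disk) : hInv z + I = 2 * I / (1 - z) := by
  have := one_sub_ne hz
  rw [hInv]; field_simp; ring

lemma hPsi_hInv {z : ℂ} (hz : z ∈ disk) : hPsi (hInv z) = z := by
  have h1 := one_sub_ne hz
  have h2 := I_ne_zero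
  rw [hPsi, hX, hInv_add_I hz, hInv]; field_simp; ring

lemma hInv_mem {z : ℂ} (hz : z ∈ disk) : hInv z ∈ halfPlane := by
  have h0 : hInv z + I ≠ 0 := by
    rw [hInv_add_I hz]
    exact div_ne_zero (by simp) (one_sub_ne hz)
  have h1 := boundary_eq_hPsi h0
  have h2 : 0 < 1 - ‖z‖ ^ 2 := diskBoundary.pos z hz
  rw [hPsi_hInv hz] at h1
  rw [← h1] at h2
  have h3 : 0 < ‖hInv z + I‖ ^ 2 := by positivity
  have h4 := (div_pos_iff_of_pos_right h3).1 h2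
  have : 0 < (hInv z).im := by linarith
  exact this

lemma hPsi_image : hPsi '' halfPlane = disk :=
  Set.Subset.antisymm (Set.image_subset_iff.2 fun _ hz => hPsi_mem hz)
    fun z hz => ⟨hInv z, hInv_mem hz, hPsi_hInv hz⟩

lemma det_smul_one (a : ℂ) : (a • (1 : ℂ →L[ℝ] ℂ)).det = ‖a‖ ^ 2 := by
  have h : Algebra.norm ℝ a = normSq a := by rw [Algebra.norm_complex_eq]; rfl
  rw [← normSq_eq_norm_sq, ← h, Algebra.norm_apply]
  rfl

/-- Change of variables by the Cayley transform, with Jacobian `|ψ'|² = 4 |z + i|⁻⁴`. -/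
lemma integral_disk_eq (f : ℂ → ℂ) : ∫ z in disk, f z =
    ∫ z in halfPlane, 4 * (hX z ^ 2 * conj (hX z) ^ 2) * f (hPsi z) := by
  have hinj : Set.InjOn hPsi halfPlane := fun z hz w hw h => by
    rw [← hInv_hPsi hz, h, hInv_hPsi hw]
  have hm := halfPlane.isOpen.measurableSet
  have h := integral_image_eq_integral_abs_det_fderiv_smul volume hm
    (fun z hz => (hasDerivAt_hPsi hz).complexToReal_fderiv.hasFDerivWithinAt) hinj f
  rw [hPsi_image] at h
  rw [h]
  refine setIntegral_congr_fun hm fun z _ => ?_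
  rw [det_smul_one, abs_of_nonneg (by positivity), real_smul, ← normSq_eq_norm_sq, ← mul_conj]
  simp only [map_mul, map_pow, conj_I, map_ofNat]
  linear_combination (-4 * hX z ^ 2 * conj (hX z) ^ 2 * f (hPsi z)) * I_sq

/-! ### The basis -/

/-- The functions `(z - i)^k / (z + i)^{k+2}`. -/
def hE (k : ℕ) (z : ℂ) : ℂ := hX z ^ 2 * hPsi z ^ k

lemma differentiableOn_hX : DifferentiableOn ℂ hX halfPlane := fun _ hz =>
  (hasDerivAt_hX (neg_one_lt_im hz)).differentiableAt.differentiableWithinAt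

lemma differentiableOn_hPsi : DifferentiableOn ℂ hPsi halfPlane := fun _ hz =>
  (hasDerivAt_hPsi hz).differentiableAt.differentiableWithinAt

lemma differentiableOn_hE (k : ℕ) : DifferentiableOn ℂ (hE k) halfPlane :=
  (differentiableOn_hX.pow 2).mul (differentiableOn_hPsi.pow k)

lemma halfPlaneBasis_eq (j k : ℕ) (z : ℂ) : halfPlaneBasis j k z =
    (j.factorial : ℂ)⁻¹ * (wd (-I))^[j] (fun w => (w - conj w) ^ j * hE k w) z := by
  have e : (fun z : ℂ => (z - conj z) ^ j * ((z - I) ^ k / (z + I) ^ (k + 2))) =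
      fun w => (w - conj w) ^ j * hE k w := by
    funext z
    rw [hE, hPsi, mul_pow, hX, div_eq_mul_inv, ← inv_pow]; ring
  rw [halfPlaneBasis, e, dz_eq_wd, div_eq_inv_mul]

lemma wd_sub_conj (c z : ℂ) : wd c (fun w => w - conj w) z = c * I := by
  rw [wd_sub_at differentiableAt_fun_id (contDiff_conj.differentiable (by simp) z), wd_id,
    wd_conj_id]
  ring

lemma contDiff_sub_conj : ContDiff ℝ ∞ fun w : ℂ => w - conj w := contDiff_id.sub contDiff_conj

lemma halfPlaneBasis_eq_holoOp (j k : ℕ) {z : ℂ} (hz : z ∈ halfPlane) :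
    halfPlaneBasis j k z = holoOp j (halfPlaneCoeff j) (hE k) z := by
  have hf := differentiableOn_hE k
  rw [halfPlaneBasis_eq, wd_iter_pow_mul j j (β := fun _ => 1) contDiff_sub_conj.contDiffOn
    contDiffOn_const (fun w _ => by rw [wd_sub_conj]; simp) (fun w _ => wd_const 1 w)
    (holo_contDiffOn hf) hz, holoOp, Finset.mul_sum]
  refine Finset.sum_congr rfl fun a ha => ?_
  have ha' : a ≤ j := by simpa [Nat.lt_succ_iff] using ha
  have h1 : j - (j - a) = a := by omega
  have h2 : (j.descFactorial (j - a) : ℂ) = (j.factorial : ℂ) / (a.factorial : ℂ) := by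
    have := Nat.factorial_mul_descFactorial (Nat.sub_le j a)
    rw [h1] at this
    rw [← this]
    have := Nat.factorial_ne_zero a
    push_cast
    field_simp
  have h3 : (j.factorial : ℂ) ≠ 0 := by exact_mod_cast Nat.factorial_ne_zero j
  rw [dz_iter_holo a hf hz, halfPlaneCoeff, h1, h2, one_pow]
  field_simp

lemma halfPlaneCoeff_pa (j : ℕ) : PACoeff halfPlane j (halfPlaneCoeff j) := by
  intro a ha f hf
  have h1 := PA.lin_pow_mul (Ω := halfPlane) (α := fun z => z) (β := fun _ => -1)
    differentiable_id.differentiableOn (differentiable_const _).differentiableOn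
    (PA.of_holo (hf.const_mul ((j.choose a : ℂ) / (a.factorial : ℂ)))) a
  refine (h1.mono (by omega)).congr fun z _ => ?_
  simp only [halfPlaneCoeff]
  ring

lemma hPoly_psi_pow_mul {d : ℕ} {g : ℂ → ℂ} (hg : g ∈ hPoly d) (k : ℕ) :
    (fun z => (1 - 2 * I * hX z) ^ k * g z) ∈ hPoly d := by
  induction k with
  | zero => simpa using hg
  | succ k ih =>
    have h := (hPoly d).sub_mem ih ((hPoly d).smul_mem (2 * I)
      (hMono_mul_mem (i := 0) (p := 1) (q := 0) (d' := d) (by omega) ih))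
    convert h using 1
    funext z
    simp [hMono]; ring

lemma hPoly_conj_psi_pow_mul {d : ℕ} {g : ℂ → ℂ} (hg : g ∈ hPoly d) (k : ℕ) :
    (fun z => conj (1 - 2 * I * hX z) ^ k * g z) ∈ hPoly d := by
  induction k with
  | zero => simpa using hg
  | succ k ih =>
    have h := (hPoly d).add_mem ih ((hPoly d).smul_mem (2 * I)
      (hMono_mul_mem (i := 0) (p := 0) (q := 1) (d' := d) (by omega) ih))
    convert h using 1
    funext z
    simp [hMono, map_ofNat]; ring

lemma hPsi_eq {z : ℂ} (hz : z ∈ halfPlane) : hPsi z = 1 - 2 * I * hX z := by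
  have := one_sub_hPsi (add_I_ne (neg_one_lt_im hz))
  linear_combination -this

lemma hE_mem (k : ℕ) : hE k ∈ (halfPlaneAlg 2).N :=
  ⟨_, hPoly_psi_pow_mul (hMono_mem (i := 0) (p := 2) (q := 0) le_rfl) k, fun z hz => by
    simp [hE, hPsi_eq hz, hMono]; ring⟩

lemma conj_hE_mem (k : ℕ) : (fun z => conj (hE k z)) ∈ (halfPlaneAlg 2).N :=
  ⟨_, hPoly_conj_psi_pow_mul (hMono_mem (i := 0) (p := 0) (q := 2) le_rfl) k, fun z hz => by
    simp [hE, hPsi_eq hz, hMono]; ring⟩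

lemma hE_mul_conj_hE_mem (k l : ℕ) : (fun z => hE k z * conj (hE l z)) ∈ (halfPlaneAlg 4).N :=
  ⟨_, hPoly_psi_pow_mul (hPoly_conj_psi_pow_mul
    (hMono_mem (i := 0) (p := 2) (q := 2) le_rfl) l) k, fun z hz => by
    simp [hE, hPsi_eq hz, hMono]; ring⟩

lemma halfPlaneBasis_mem (j k : ℕ) : halfPlaneBasis j k ∈ (halfPlaneAlg 2).N := by
  have h := (Mem.sub_conj_pow_mul j (hE_mem k)).wd_iter (-I) j
  rw [sub_self, BdryAlg.mem_zero_iff] at h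
  rw [show halfPlaneBasis j k = _ from funext (halfPlaneBasis_eq j k)]
  exact const_mul_mem_halfPlaneAlg _ h

/-- The conjugate of `(z - z̄)^j e_k / j!`. -/
def hTheta (j k : ℕ) (z : ℂ) : ℂ := conj ((j.factorial : ℂ)⁻¹ * ((z - conj z) ^ j * hE k z))

lemma hTheta_mem (j k : ℕ) : (halfPlaneAlg 2).Mem j (hTheta j k) := by
  refine (Mem.sub_conj_pow_mul j (const_mul_mem_halfPlaneAlg ((j.factorial : ℂ)⁻¹ * (-1) ^ j)
    (conj_hE_mem k))).congr fun z _ => ?_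
  simp only [hTheta, map_mul, map_pow, map_sub, conj_conj, map_inv₀, map_natCast]
  rw [← neg_sub z, neg_pow]
  ring

lemma dzbar_iter_hTheta (j k : ℕ) (z : ℂ) :
    (wd I)^[j] (hTheta j k) z = conj (halfPlaneBasis j k z) := by
  unfold hTheta
  rw [wd_iter_conj, conj_I, wd_iter_const_mul, halfPlaneBasis_eq]

lemma dzbar_iter_sub_conj_pow_mul (j k : ℕ) {z : ℂ} (hz : z ∈ halfPlane) :
    (wd I)^[j] (fun w => (w - conj w) ^ j * hE k w) z = j.factorial * (-1) ^ j * hE k z :=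
  dzbar_iter_pow_mul_holo j contDiff_sub_conj.contDiffOn
    (differentiable_const (-1 : ℂ)).differentiableOn (fun w _ => by rw [wd_sub_conj, I_mul_I])
    (differentiableOn_hE k) hz

lemma dz_iter_hTheta (j k : ℕ) {z : ℂ} (hz : z ∈ halfPlane) :
    (wd (-I))^[j] (hTheta j k) z = (-1) ^ j * conj (hE k z) := by
  have h : (j.factorial : ℂ) ≠ 0 := by exact_mod_cast Nat.factorial_ne_zero j
  unfold hTheta
  rw [wd_iter_conj, map_neg, conj_I, neg_neg, wd_iter_const_mul, dzbar_iter_sub_conj_pow_mul j k hz,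
    mul_assoc, inv_mul_cancel_left₀ h]
  simp

/-- `∂̄^j` commutes with `∂^j` and turns `(z - z̄)^j e_k` into `j! (-1)^j e_k`. -/
lemma dzbar_iter_halfPlaneBasis (j k : ℕ) {z : ℂ} (hz : z ∈ halfPlane) :
    (wd I)^[j] (halfPlaneBasis j k) z = (-1) ^ j * (wd (-I))^[j] (hE k) z := by
  have h : (j.factorial : ℂ) ≠ 0 := by exact_mod_cast Nat.factorial_ne_zero j
  have hs : ContDiffOn ℝ ∞ (fun w => (w - conj w) ^ j * hE k w) halfPlane :=
    (contDiff_sub_conj.pow j).contDiffOn.mul (holo_contDiffOn (differentiableOn_hE k))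
  rw [show halfPlaneBasis j k = _ from funext (halfPlaneBasis_eq j k), wd_iter_const_mul,
    wd_iter_iter_comm j j hs hz,
    wd_iter_congr j (fun w hw => dzbar_iter_sub_conj_pow_mul j k hw) hz, wd_iter_const_mul,
    mul_assoc, inv_mul_cancel_left₀ h]

lemma tendsto_halfPlane_ibp (j k : ℕ) {g : ℂ → ℂ} (hg : ContDiffOn ℝ ∞ g halfPlane)
    (hgL : MemLp g 2 (volume.restrict (halfPlane : Set ℂ))) :
    Tendsto (fun t : ℝ => ∫ z in halfPlane, (wd I)^[j] g z *
      ((stdCutoff.toFun (t * halfPlaneBoundary.toFun z) : ℂ) * hTheta j k z)) atTop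
      (𝓝 ((-1) ^ j * ∫ z in halfPlane, g z * conj (halfPlaneBasis j k z))) := by
  have h := BdryAlg.tendsto_ibp (c := I) stdCutoff hg (hTheta_mem j k)
    (fun m hm => hgL.integrable_mul (memLp_halfPlane hm))
  simpa only [dzbar_iter_hTheta] using h

/-- Two integrations by parts: `∂̄^j` is moved from `θ_k` to `u_l`, where it gives `(-1)^j ∂^j e_l`,
and then `∂^j` is moved back to `θ_k`, where it gives `(-1)^j ē_k`. Thus `S` preserves the inner
products of the `e_k`, and the Cayley transform turns these into moments of the disk. -/
lemma integral_halfPlaneBasis (j k l : ℕ) :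
    ∫ z in halfPlane, halfPlaneBasis j l z * conj (halfPlaneBasis j k z) =
      (1 / 4) * ∫ z in disk, z ^ l * conj z ^ k := by
  have hm := halfPlane.isOpen.measurableSet
  have h1 := tendsto_halfPlane_ibp j k ((halfPlaneAlg 2).smooth _ (halfPlaneBasis_mem j l))
    (memLp_halfPlane (halfPlaneBasis_mem j l))
  have h2 := (BdryAlg.tendsto_ibp (c := -I) stdCutoff ((halfPlaneAlg 2).smooth _ (hE_mem l))
    (hTheta_mem j k) (fun m hm => (memLp_halfPlane (hE_mem l)).integrable_mul
      (memLp_halfPlane hm))).const_mul ((-1) ^ j)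
  have h3 : ∀ t : ℝ, (-1) ^ j * ∫ z in halfPlane, (wd (-I))^[j] (hE l) z *
      ((stdCutoff.toFun (t * halfPlaneBoundary.toFun z) : ℂ) * hTheta j k z) =
      ∫ z in halfPlane, (wd I)^[j] (halfPlaneBasis j l) z *
        ((stdCutoff.toFun (t * halfPlaneBoundary.toFun z) : ℂ) * hTheta j k z) := by
    intro t
    rw [← integral_const_mul]
    refine setIntegral_congr_fun hm fun z hz => ?_
    rw [dzbar_iter_halfPlaneBasis j l hz]; ring
  have h4 := tendsto_nhds_unique h1 (h2.congr h3)
  have h5 := mul_left_cancel₀ (pow_ne_zero j (by norm_num : (-1 : ℂ) ≠ 0)) h4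
  rw [h5, integral_disk_eq, ← integral_const_mul, ← integral_const_mul]
  refine setIntegral_congr_fun hm fun z hz => ?_
  rw [dz_iter_hTheta j k hz]
  have : ((-1 : ℂ) ^ j) * (-1) ^ j = 1 := by rw [← mul_pow]; simp
  simp only [hE, map_mul, map_pow]
  linear_combination (hX z ^ 2 * hPsi z ^ l * (conj (hX z) ^ 2 * conj (hPsi z) ^ k)) * this

lemma integrableOn_truncate {Ω : Opens ℂ} (s : BoundaryFunction Ω) (h : Cutoff) (t : ℝ) {f : ℂ → ℂ}
    (hf : ContDiffOn ℝ ∞ f Ω) :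
    IntegrableOn (fun z => (h.toFun (t * s.toFun z) : ℂ) * f z) Ω := by
  have h1 : Integrable (truncate s h t f hf) :=
    (truncate s h t f hf).continuous.integrable_of_hasCompactSupport
      (truncate s h t f hf).hasCompactSupport
  exact h1.integrableOn.congr_fun (fun z hz => truncate_apply h t hf hz) Ω.isOpen.measurableSet

end

end PolyToeplitz


namespace PolyToeplitz

noncomputable section

/-! ### The half-plane -/

lemma exists_halfPlane_bound {K : Set ℂ} (hK : IsCompact K) (hKΩ : K ⊆ (halfPlane : Set ℂ)) :
    ∃ ρ ∈ Set.Ioo (0 : ℝ) 1, ∀ z ∈ K, ‖hPsi z‖ ≤ ρ := by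
  obtain ⟨ρ, hρ, h⟩ := exists_disk_bound
    (hK.image_of_continuousOn (differentiableOn_hPsi.continuousOn.mono hKΩ))
    (Set.image_subset_iff.2 fun z hz => hPsi_mem (hKΩ hz))
  exact ⟨ρ, hρ, fun z hz => h _ (Set.mem_image_of_mem _ hz)⟩

/-- `conj (1 - ψ) θ_m = θ_m - θ_{m+1}`, so the vanishing of all limits is inherited by the multiples
by powers of `conj (1 - ψ)`. -/
lemma tendsto_one_sub_hPsi_pow {H : ℂ → ℂ} (hH : ContDiffOn ℝ ∞ H halfPlane) (j : ℕ)
    (h : ∀ k, Tendsto (fun t : ℝ => ∫ z in halfPlane, H z *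
      ((stdCutoff.toFun (t * halfPlaneBoundary.toFun z) : ℂ) * hTheta j k z)) atTop (𝓝 0))
    (n m : ℕ) : Tendsto (fun t : ℝ => ∫ z in halfPlane, H z *
      ((stdCutoff.toFun (t * halfPlaneBoundary.toFun z) : ℂ) *
        (conj (1 - hPsi z) ^ n * hTheta j m z))) atTop (𝓝 0) := by
  induction n generalizing m with
  | zero => simpa using h m
  | succ n ih =>
    have h1 := (ih m).sub (ih (m + 1))
    rw [sub_zero] at h1
    refine h1.congr fun t => ?_
    have hψ : ContDiffOn ℝ ∞ (fun z => conj (1 - hPsi z) ^ n) halfPlane :=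
      (conj_contDiffOn (contDiffOn_const.sub (holo_contDiffOn differentiableOn_hPsi))).pow n
    have hi : ∀ m, IntegrableOn (fun z => H z *
        ((stdCutoff.toFun (t * halfPlaneBoundary.toFun z) : ℂ) *
          (conj (1 - hPsi z) ^ n * hTheta j m z))) halfPlane := fun m => by
      refine (integrableOn_truncate halfPlaneBoundary stdCutoff t
        (hH.mul (hψ.mul (hTheta_mem j m).smooth))).congr_fun (fun z _ => ?_)
        halfPlane.isOpen.measurableSet
      ring
    rw [← integral_sub (hi m) (hi (m + 1))]
    refine integral_congr_ae (Eventually.of_forall fun z => ?_)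
    simp only [hTheta, hE, map_mul, map_pow, map_sub, map_one]
    ring

/-- The moments of `∂̄^j g` against `θ_m` involve `(z - z̄)^j`, which is not radial after the Cayley
transform. The extra factor `conj (1 - ψ)^j`, compensated by a holomorphic factor, turns it into the
radial weight `(1 - |ψ|²)^j`, and the moment argument of the disk applies. -/
lemma halfPlane_complete (j : ℕ) {g : ℂ → ℂ} (hg : ContDiffOn ℝ ∞ g halfPlane)
    (hgL : MemLp g 2 (volume.restrict (halfPlane : Set ℂ)))
    (hg0 : ∀ z ∈ halfPlane, (wd I)^[j + 1] g z = 0)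
    (horth : ∀ k, ∫ z in halfPlane, g z * conj (halfPlaneBasis j k z) = 0) :
    ∀ z ∈ halfPlane, (wd I)^[j] g z = 0 := by
  have hHs := wd_iter_contDiffOn (c := I) j hg
  set H := (wd I)^[j] g with hHdef
  have hH : DifferentiableOn ℂ H halfPlane := by
    refine holo_of_dzbar_eq_zero hHs fun z hz => ?_
    have := hg0 z hz
    rwa [Function.iterate_succ_apply'] at this
  have hlim := tendsto_one_sub_hPsi_pow hHs j (fun k => by
    have := tendsto_halfPlane_ibp j k hg hgL
    rwa [horth k, mul_zero] at this) j
  have hW : ∀ z : ℂ, (((1 - ‖z‖ ^ 2) ^ j : ℝ) : ℂ) = (1 - z * conj z) ^ j := by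
    intro z
    rw [← diskBoundary_eq]; simp [diskBoundary]
  have hWs : ContDiffOn ℝ ∞ (fun z : ℂ => (1 - ‖z‖ ^ 2) ^ j) (disk : Set ℂ) :=
    ((contDiff_const.sub (contDiff_norm_sq ℝ)).pow j).contDiffOn
  have hWc : ContDiffOn ℝ ∞ (fun z : ℂ => (((1 - ‖z‖ ^ 2) ^ j : ℝ) : ℂ)) (disk : Set ℂ) :=
    ofRealCLM.contDiff.comp_contDiffOn hWs
  have hrad : ∀ z w : ℂ, ‖w‖ ≤ ‖z‖ → z ∈ disk → w ∈ disk := fun z w h hz => by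
    rw [mem_disk] at *
    linarith
  set Φ : ℝ → 𝓓(disk, ℂ) := fun t => truncate diskBoundary stdCutoff t _ hWc with hΦdef
  have hΦ : ∀ t, ∀ z ∈ disk, Φ t z = (stdCutoff.toFun (t * (1 - ‖z‖ ^ 2)) : ℂ) *
      (((1 - ‖z‖ ^ 2) ^ j : ℝ) : ℂ) := fun t z hz => truncate_apply _ _ _ hz
  have hΦrad : ∀ t, ∀ z w : ℂ, ‖z‖ = ‖w‖ → Φ t z = Φ t w := by
    intro t z w hzw
    by_cases hz : z ∈ disk
    · rw [hΦ t z hz, hΦ t w (hrad z w hzw.ge hz), hzw]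
    · rw [image_eq_zero_of_notMem_tsupport fun h => hz ((Φ t).tsupport_subset h),
        image_eq_zero_of_notMem_tsupport fun h => hz (hrad w z hzw.le ((Φ t).tsupport_subset h))]
  have hInvd : DifferentiableOn ℂ hInv disk := fun z hz =>
    ((((differentiableAt_id.const_add 1).const_mul I).div
      ((differentiableAt_const (1 : ℂ)).sub differentiableAt_id)
      (one_sub_ne hz)).differentiableWithinAt)
  -- Two of the factors `z + i` cancel the holomorphic half `(z + i)⁻²` of the Jacobian; the other
  -- `j` enter the identity `e1` below.
  have hH' : DifferentiableOn ℂ (fun z => H (hInv z) * (hInv z + I) ^ (j + 2)) disk :=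
    (hH.comp hInvd fun z hz => hInv_mem hz).mul ((hInvd.add_const I).pow (j + 2))
  have key : ∀ z ∈ disk, H (hInv z) * (hInv z + I) ^ (j + 2) = 0 := by
    refine eq_zero_of_tendsto_moments hH' (convex_ball (0 : ℂ) 1).isPreconnected
      (mem_disk.2 (by simp)) hΦrad (fun t => (Φ t).continuous)
      (fun t => exists_closedBall hrad (Φ t)) (fun m => ?_) fun m => ?_
    · obtain ⟨c, hc, h⟩ := exists_le_norm_integral_truncate diskBoundary hWs
        (fun z hz => pow_pos (diskBoundary.pos z hz) j) hWc (ρ := 1 / 3) (ρ' := 1 / 2)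
        (by norm_num) (by norm_num) (fun z hz => mem_disk.2 (by
          have : ‖z‖ ≤ 1 / 2 := by simpa using hz
          linarith))
      exact ⟨_, by positivity, h m⟩
    · have h1 := (hlim m).const_mul (4 * (-1) ^ j * (j.factorial : ℂ))
      rw [mul_zero] at h1
      refine h1.congr fun t => ?_
      rw [integral_disk_eq, ← integral_const_mul]
      refine setIntegral_congr_fun halfPlane.isOpen.measurableSet fun z hz => ?_
      have hzI := add_I_ne (neg_one_lt_im hz)
      have hXz := add_I_mul_hX hzI
      have hf : (j.factorial : ℂ) ≠ 0 := by exact_mod_cast Nat.factorial_ne_zero j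
      have hs := halfPlaneBoundary_eq_hPsi hz
      -- From `1 - |ψ|² = 4 Im z / |z + i|²` and `1 - ψ = 2i / (z + i)`.
      have e1 : ((1 - ‖hPsi z‖ ^ 2 : ℝ) : ℂ) ^ j * (z + I) ^ j =
          (-1) ^ j * (conj (1 - hPsi z) ^ j * conj (z - conj z) ^ j) := by
        rw [← hs, halfPlaneBoundary_eq, one_sub_hPsi hzI, sub_conj_eq, ← mul_pow, ← mul_pow,
          ← mul_pow]
        congr 1
        simp only [hMono, map_mul, map_ofNat, conj_I, conj_ofReal, pow_one]
        linear_combination (4 * (z.im : ℂ) * conj (hX z)) * hXz +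
          (4 * (z.im : ℂ) * conj (hX z)) * I_sq
      have e2 : (z + I) ^ 2 * hX z ^ 2 = 1 := by rw [← mul_pow, hXz, one_pow]
      have e3 : ((-1 : ℂ) ^ j) * (-1) ^ j = 1 := by rw [← mul_pow]; simp
      rw [hΦ t _ (hPsi_mem hz), hInv_hPsi hz, hs, hTheta, hE]
      simp only [map_mul, map_pow, map_inv₀, map_natCast, ofReal_pow, pow_add]
      set h0 : ℂ := (stdCutoff.toFun (t * (1 - ‖hPsi z‖ ^ 2)) : ℂ)
      rw [show 4 * (hX z ^ 2 * conj (hX z) ^ 2) * (h0 * ((1 - ‖hPsi z‖ ^ 2 : ℝ) : ℂ) ^ j *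
          (H z * ((z + I) ^ j * (z + I) ^ 2) * conj (hPsi z) ^ m)) =
          4 * conj (hX z) ^ 2 * h0 * H z * conj (hPsi z) ^ m *
            (((1 - ‖hPsi z‖ ^ 2 : ℝ) : ℂ) ^ j * (z + I) ^ j) * ((z + I) ^ 2 * hX z ^ 2) by ring,
        e1, e2]
      field_simp
  intro z hz
  have h := key (hPsi z) (hPsi_mem hz)
  rw [hInv_hPsi hz] at h
  exact (mul_eq_zero.1 h).resolve_right (pow_ne_zero _ (add_I_ne (neg_one_lt_im hz)))

/-- The half-plane is not invariant under rotations, so `PolyBasis.of_radial` does not apply.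
Orthogonality and the lower bounds of the norms come from the explicit moments of the disk in
`integral_halfPlaneBasis`. -/
theorem halfPlane_polyBasis (j : ℕ) :
    PolyBasis halfPlane (volume.restrict (halfPlane : Set ℂ)) j (Set.Ioo 0 1)
      (halfPlaneBasis j) := by
  have hm := halfPlane.isOpen.measurableSet
  have hpa : ∀ k, PA halfPlane (j + 1) (halfPlaneBasis j k) := fun k =>
    ((halfPlaneCoeff_pa j).holoOp (differentiableOn_hE k)).congr fun z hz =>
      halfPlaneBasis_eq_holoOp j k hz
  have hball : ∀ f : ℂ → ℂ, ∫ z in disk, f z = ∫ z, (disk : Set ℂ).indicator f z := fun f =>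
    (integral_indicator disk.isOpen.measurableSet).symm
  refine ⟨ae_restrict_mem hm, fun k => (halfPlaneAlg 2).smooth _ (halfPlaneBasis_mem j k),
    fun k => memLp_halfPlane (halfPlaneBasis_mem j k), fun k => (hpa k).2, ?_,
    fun g hg hgL hg0 horth => halfPlane_complete j hg hgL hg0 horth, ?_, fun ρ hρ => hρ.1,
    exists_gt_Ioo, ?_, ?_⟩
  · intro g hg hgL hg0 k
    have h1 := tendsto_halfPlane_ibp j k hg hgL
    have e : ∀ t : ℝ, ∫ z in halfPlane, (wd I)^[j] g z *
        ((stdCutoff.toFun (t * halfPlaneBoundary.toFun z) : ℂ) * hTheta j k z) = 0 := fun t =>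
      setIntegral_eq_zero_of_forall_eq_zero fun z hz => by
        rw [show (wd I)^[j] g z = 0 from hg0 z hz, zero_mul]
    simp only [e] at h1
    exact (mul_eq_zero.1 (tendsto_nhds_unique h1 tendsto_const_nhds)).resolve_left
      (pow_ne_zero j (by norm_num))
  · intro k l hkl
    rw [integral_halfPlaneBasis, hball]
    have h := integral_radial_monomial (Φ := (disk : Set ℂ).indicator 1) (fun z w hzw => by
      by_cases hz : z ∈ disk
      · rw [Set.indicator_of_mem (by exact hz),
          Set.indicator_of_mem (by rw [SetLike.mem_coe, mem_disk] at *; rwa [← hzw])]; rfl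
      · rw [Set.indicator_of_notMem (by exact hz),
          Set.indicator_of_notMem (by rw [SetLike.mem_coe, mem_disk] at *; rwa [← hzw])])
      hkl.symm
    rw [← mul_zero (1 / 4 : ℂ), ← h]
    congr 2
    funext z
    by_cases hz : z ∈ (disk : Set ℂ) <;> simp [hz]
  · intro ρ hρ
    obtain ⟨ρ', hρ', hlt⟩ := exists_gt_Ioo ρ hρ
    have hv := volume_annulus_pos hρ.1 hlt
    refine ⟨√((volume (annulus ρ ρ')).toReal / 4), by positivity, fun k => ?_⟩
    have h := le_norm_integral_annulus (Φ := fun _ => 1) disk.isOpen.measurableSet hρ.1 zero_le_one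
      (fun z hz => mem_disk.2 (lt_of_le_of_lt hz.2 hρ'.2)) (fun _ _ => zero_le_one)
      (fun _ _ => le_rfl) k (by
        have hc : Continuous fun z : ℂ => (1 : ℝ) * ‖z‖ ^ (2 * k) := by fun_prop
        exact (hc.continuousOn.integrableOn_compact (isCompact_closedBall (0 : ℂ) 1)).mono_set
          Metric.ball_subset_closedBall)
    have e : (∫ z in disk, z ^ k * conj z ^ k) =
        ∫ z in (disk : Set ℂ), ((1 : ℝ) : ℂ) * (‖z‖ : ℂ) ^ (2 * k) := by
      congr 1; funext z
      rw [← mul_pow, mul_conj, normSq_eq_norm_sq, pow_mul]; simp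
    rw [integral_halfPlaneBasis, e, norm_mul, mul_pow, Real.sq_sqrt (by positivity), ← pow_mul,
      mul_comm k 2]
    have : ‖(1 / 4 : ℂ)‖ = 1 / 4 := by norm_num
    rw [this]
    linarith
  · intro b hb
    obtain ⟨g, hg, hs⟩ := (halfPlaneCoeff_pa j).synth (P := Set.Ioo 0 1) (fun ρ hρ => hρ.1)
      exists_gt_Ioo (w := fun z => hX z ^ 2) (ψ := hPsi) (differentiableOn_hX.pow 2)
      differentiableOn_hPsi (fun K hK hKd => exists_halfPlane_bound hK hKd) b hb
    refine ⟨g, hg.1, hg.2, fun z hz => ?_⟩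
    simp only [halfPlaneBasis_eq_holoOp j _ hz]
    exact hs z hz

theorem halfPlane_toeplitz (j : ℕ) (F : CDistribution halfPlane)
    (hF : (IsHalfPlaneSymbol F ∧ HasCompactSupportIn (opK j F) halfPlane) ∨
      HasCompactSupportIn F halfPlane) :
    ∃ T, IsToeplitzHalfPlane j F T ∧ IsCompactOperator T ∧
      ∀ T', IsToeplitzHalfPlane j F T' → T' = T := by
  have hN : ∀ g ∈ (halfPlaneAlg 4).N, ∃ L, HasValue halfPlaneBoundary F g L := by
    intro g hg
    rcases hF with ⟨h, -⟩ | h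
    · exact exists_hasValue_halfPlane h hg
    · exact exists_hasValue_of_hasCompactSupportIn h ((halfPlaneAlg 4).smooth g hg)
  have hv : HasCompactSupportIn (opK j F) halfPlane := by
    rcases hF with ⟨-, h⟩ | h
    · exact h
    · exact h.transOp _
  obtain ⟨a, ha, hab⟩ := exists_matrix (halfPlaneAlg_coeffMem 4 j) (halfPlaneCoeff_contDiff j) hN hv
    (P := Set.Ioo 0 1) (fun ρ hρ => hρ.1) exists_gt_Ioo (w := fun z => hX z ^ 2) (ψ := hPsi)
    (differentiableOn_hX.pow 2) differentiableOn_hPsi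
    (fun K hK hKd => exists_halfPlane_bound hK hKd) hE_mul_conj_hE_mem
  have ha' : ∀ k l, HasValue halfPlaneBoundary F
      (fun z => halfPlaneBasis j k z * conj (halfPlaneBasis j l z)) (a k l) := fun k l => by
    refine (ha k l).congr fun z hz => ?_
    simp only [halfPlaneBasis_eq_holoOp j _ hz]
    rfl
  obtain ⟨T, hT, hTc, hTu⟩ := (halfPlane_polyBasis j).exists_toeplitz hab
  refine ⟨T, fun k l => ?_, hTc, fun T' hT' => hTu T' fun k l => ?_⟩
  · obtain ⟨u, v, hu, hv, e⟩ := hT k l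
    exact ⟨u, v, hu, hv, e ▸ ha' k l⟩
  · obtain ⟨u, v, hu, hv, e⟩ := hT' k l
    exact ⟨u, v, hu, hv, (ha' k l).unique e⟩

end

end PolyToeplitz

/-! ### The theorem for the three domains -/

theorem mainTheorem7 (j : ℕ) :
    (∀ F : PolyToeplitz.CDistribution PolyToeplitz.halfPlane,
      ((PolyToeplitz.IsHalfPlaneSymbol F ∧
          PolyToeplitz.HasCompactSupportIn (PolyToeplitz.opK j F) PolyToeplitz.halfPlane) ∨
        PolyToeplitz.HasCompactSupportIn F PolyToeplitz.halfPlane) →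
      ∃ T, PolyToeplitz.IsToeplitzHalfPlane j F T ∧ IsCompactOperator T ∧
        ∀ T', PolyToeplitz.IsToeplitzHalfPlane j F T' → T' = T) ∧
    (∀ F : PolyToeplitz.CDistribution PolyToeplitz.disk,
      ((PolyToeplitz.IsDiskSymbol F ∧
          PolyToeplitz.HasCompactSupportIn (PolyToeplitz.opM j F) PolyToeplitz.disk) ∨
        PolyToeplitz.HasCompactSupportIn F PolyToeplitz.disk) →
      ∃ T, PolyToeplitz.IsToeplitzDisk j F T ∧ IsCompactOperator T ∧
        ∀ T', PolyToeplitz.IsToeplitzDisk j F T' → T' = T) ∧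
    (∀ F : 𝓢'(ℂ, ℂ),
      (PolyToeplitz.HasCompactSupportIn (PolyToeplitz.opD j F) ⊤ ∨
        PolyToeplitz.HasCompactSupportIn F ⊤) →
      ∃ T, PolyToeplitz.IsToeplitzFock j F T ∧ IsCompactOperator T ∧
        ∀ T', PolyToeplitz.IsToeplitzFock j F T' → T' = T) :=
  ⟨fun F hF => PolyToeplitz.halfPlane_toeplitz j F hF,
    fun F hF => PolyToeplitz.disk_toeplitz j F hF,
    fun F hF => PolyToeplitz.fock_toeplitz j F hF⟩
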